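/- **Deriving precision limits from superreplication.** *Setting (states).* Let $H$ be a Hermitian $d\times d$ matrix, $\psi\in\mathbb C^d$ a unit vector that is not an eigenvector of $H$, and $|\psi_t\rangle=e^{-itH}|\psi\rangle$, $t\in\mathbb R$, the corresponding clock states. An estimator from $N$ copies is a POVM $(P_{\hat t})_{\hat t\in\mathbb R}$ on $(\mathbb C^d)^{\otimes N}$, complete if it is deterministic, possibly with a failure outcome if it is probabilistic. Its error, conditional on success, is measured either by the infidelity $1-|\langle\psi_{\hat t}|\psi_t\rangle|^2$ or by the squared distance from $\hat t$ to the nearest parameter that labels the same state as $t$. An $N$-to-$M$ cloner is a quantum channel (deterministic) or a completely positive trace non-increasing map (probabilistic) from $N$ to $M$ systems; its fidelity is the mean of $\langle\psi_t^{\otimes M}|\rho_t'|\psi_t^{\otimes M}\rangle$ conditional on success, where $\rho'_t$ is its normalized output on $|\psi_t\rangle^{\otimes N}$. For a prior $\pi$ on $t$, errors and fidelities are averaged with the conditional distribution of $t$ given success. In the asymptotic statements they are taken, consistently, either in the worst case over $t\in\mathbb R$ or for $t$ uniform in $[-T,T]$ in the limit $T\to\infty$. The rate of a process $N\mapsto M(N)$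 is $\alpha=\liminf_N \log[M(N)-N]/\log N$. Strong converse of the asymptotic no-cloning theorem: deterministic cloning processes with $\alpha>1$ have fidelity tending to $0$. Strong converse of the Heisenberg limit for superreplication: cloning processes with $\alpha>2$, with whatever probability of success, have fidelity tending to $0$. *Claim (states).* 1. For every estimator from $N$ copies and every $M$, the measure-and-prepare cloner $\rho\mapsto\int \mathrm{Tr}[P_{\hat t}\,\rho]\,|\psi_{\hat t}\rangle\langle\psi_{\hat t}|^{\otimes M}$, which is a channel if the estimator is deterministic, has fidelity at least $(1-e)^M$ for every prior probability measure for which the estimator succeeds with nonzero probability, where $e$ is the mean infidelity of the estimator for this prior. The infidelity of an estimate is at most the energy variance of $\psi$ times its squared distance. Consequently, for every $\beta>0$, estimators with error $O(1/N^\beta)$ yield, for every function $M(N)$, cloners (deterministic if the estimators are) with fidelity at least $1-O(M(N)/N^\beta)$. 2. Let $\varepsilon>0$. If there were deterministic estimators with error $O(1/N^{1+\varepsilon})$, there would be a deterministic cloning process with $M(N)=\Theta(N^{1+\varepsilon/2})$, rate $1+\varepsilon/2$ and fidelity tending to $1$, in violation of the strong converse of the asymptotic no-cloning theorem. 3. Let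 $\varepsilon>0$. If there were probabilistic estimators with error $O(1/N^{2+\varepsilon})$, there would be a cloning process with $M(N)=\Theta(N^{2+\varepsilon/2})$, rate $2+\varepsilon/2$ and fidelity tending to $1$, in violation of the strong converse of the Heisenberg limit for superreplication. 4. Hence for no $\varepsilon>0$ are there deterministic estimators with error $O(1/N^{1+\varepsilon})$, or probabilistic estimators with error $O(1/N^{2+\varepsilon})$. *Setting (gates).* Let $d\ge2$, and let $dU$ be the normalized Haar measure on $U(d)$. A network with $N$ uses of an unknown gate $U$ on $\mathbb C^d$ consists of an encoding, $N$ applications of $U\otimes I_A$ with $A$ a finite-dimensional ancilla, each followed by a fixed quantum operation, and a decoding; it is deterministic if all operations are channels. $F_{\rm gate}[N\to M]$ is the fidelity (conditional on success) of its output with $U^{\otimes M}|\Psi\rangle$, averaged over uniform pure states $\Psi$ of $M$ systems and over a distribution of $U$: Haar measure, or the phase gates $U_t=\sum_{n=0}^{d-1}e^{-int}|n\rangle\langle n|$ with $t$ uniform in $[0,2\pi)$. A gate estimator prepares a state, uses $U$ $N$ times in the same way with channels in between, and performs a complete measurement with outcome $\hat U\in U(d)$ distributed as $p_N(\hat U|U)$;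 its fidelity is $F_{\rm est,gate}[N]=\int dU\int p_N(d\hat U|U)\int d\psi\,|\langle\psi|U^\dagger\hat U|\psi\rangle|^2$. Strong converse for gate replication: processes, with whatever probability of success, that replicate phase gates at a rate $\alpha>2$ have gate fidelity tending to $0$. *Claim (gates).* 5. For every gate estimator with $N$ uses and every $M$, there is a deterministic network with $N$ uses that acts as $\rho\mapsto\int p_N(d\hat U|U)\,\hat U^{\otimes M}\rho\,\hat U^{\dagger\otimes M}$ and satisfies $F_{\rm gate}[N\to M]\ge 1-\frac{d+1}{d}M(1-F_{\rm est,gate}[N])$ for Haar distributed gates; there is also a deterministic network with $N$ uses that satisfies the same bound for phase gates. Consequently, for every $\beta>0$, $F_{\rm est,gate}[N]=1-O(1/N^\beta)$ yields $F_{\rm gate}[N\to M(N)]\ge1-O(M(N)/N^\beta)$ for Haar distributed gates and every function $M(N)$. 6. Let $\varepsilon>0$. If there were gate estimators with $F_{\rm est,gate}[N]=1-O(1/N^{2+\varepsilon})$, there would be a function $M(N)=\Theta(N^{2+\varepsilon/2})$ of rate $2+\varepsilon/2$ and deterministic networks replicating $M(N)$ copies with gate fidelity tending to $1$, for Haar distributed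 gates as well as for phase gates, in violation of the strong converse for gate replication. 7. Hence for no $\varepsilon>0$ are there gate estimators with $F_{\rm est,gate}[N]=1-O(1/N^{2+\varepsilon})$. -/

import Mathlib

open Filter Topology MeasureTheory Matrix
open scoped ENNReal ComplexOrder Kronecker

noncomputable section

namespace Replication

/-! ### Quantum operations and measurements in finite dimension -/

/-- `(id_k ⊗ Φ)(X)` for a linear map `Φ` on matrices. -/
def ampliate {m n : Type} (k : ℕ) (Φ : Matrix m m ℂ →ₗ[ℂ] Matrix n n ℂ)
    (X : Matrix (Fin k × m) (Fin k × m) ℂ) : Matrix (Fin k × n) (Fin k × n) ℂ :=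
  Matrix.of fun p q => Φ (Matrix.of fun i j => X (p.1, i) (q.1, j)) p.2 q.2

/-- A quantum operation: a completely positive, trace non-increasing linear map. -/
structure QOp (m n : Type) [Fintype m] [Fintype n] where
  map : Matrix m m ℂ →ₗ[ℂ] Matrix n n ℂ
  completelyPositive : ∀ (k : ℕ) (X : Matrix (Fin k × m) (Fin k × m) ℂ),
    X.PosSemidef → (ampliate k map X).PosSemidef
  trace_le : ∀ ρ : Matrix m m ℂ, ρ.PosSemidef → (map ρ).trace.re ≤ ρ.trace.re

/-- A quantum channel: a trace-preserving quantum operation. -/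
def QOp.IsChannel {m n : Type} [Fintype m] [Fintype n] (C : QOp m n) : Prop :=
  ∀ ρ : Matrix m m ℂ, (C.map ρ).trace = ρ.trace

/-- A (possibly incomplete) measurement with outcomes in `Ω`, given by a density `s ↦ P_s` of
positive operators with respect to a finite measure.  In finite dimension every positive
operator valued measure is of this form (take its trace as the base measure), and sums
`∑_s P_s` over countably many outcomes are included.  The missing part `1 - ∫ P_s` is the
effect of the failure outcome. -/
structure Povm (Ω : Type) [MeasurableSpace Ω] (n : Type) [Fintype n] [DecidableEq n] where
  base : Measure Ω
  finite_base : IsFiniteMeasure base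
  P : Ω → Matrix n n ℂ
  measurable_P : ∀ i j, Measurable fun s => P s i j
  posSemidef_P : ∀ s, (P s).PosSemidef
  integrable_P : ∀ i j, Integrable (fun s => P s i j) base
  failure_posSemidef : (1 - Matrix.of fun i j => ∫ s, P s i j ∂base).PosSemidef

/-- The measurement never fails. -/
def Povm.IsComplete {Ω : Type} [MeasurableSpace Ω] {n : Type} [Fintype n] [DecidableEq n]
    (E : Povm Ω n) : Prop :=
  (Matrix.of fun i j => ∫ s, E.P s i j ∂E.base) = 1

/-- The distribution `Tr[P_s ρ]` of the outcome on the state `ρ`; its total mass is the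
probability of success. -/
def Povm.law {Ω : Type} [MeasurableSpace Ω] {n : Type} [Fintype n] [DecidableEq n]
    (E : Povm Ω n) (ρ : Matrix n n ℂ) : Measure Ω :=
  E.base.withDensity fun s => ENNReal.ofReal (E.P s * ρ).trace.re

/-- `|v⟩⟨v|`. -/
def proj {n : Type} (v : n → ℂ) : Matrix n n ℂ := Matrix.vecMulVec v (star v)

/-- `|v⟩^{⊗ N}`, a vector with entries indexed by `Fin N → Fin d`. -/
def tensorPow {d : ℕ} (N : ℕ) (v : Fin d → ℂ) : (Fin N → Fin d) → ℂ := fun i => ∏ k, v (i k)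

/-- `U^{⊗ M}`. -/
def gatePow {d : ℕ} (M : ℕ) (U : Matrix (Fin d) (Fin d) ℂ) :
    Matrix (Fin M → Fin d) (Fin M → Fin d) ℂ :=
  Matrix.of fun i j => ∏ k, U (i k) (j k)

/-- The replication rate `liminf log (M(N) - N) / log N`. Indices with `M(N) ≤ N` contribute
the value `0`. -/
def replicationRate (M : ℕ → ℕ) : EReal :=
  liminf (fun N : ℕ => ((Real.log ((M N - N : ℕ) : ℝ) / Real.log (N : ℝ) : ℝ) : EReal)) atTop

/-- `e N = O(1 / N ^ β)`. -/
def ErrorScaling (e : ℕ → ℝ≥0∞) (β : ℝ) : Prop :=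
  ∃ C : ℝ, ∀ᶠ N : ℕ in atTop, e N ≤ ENNReal.ofReal (C / (N : ℝ) ^ β)

/-! ### Clock states: estimation and cloning -/

/-- A family of clock states `|ψ_t⟩ = e^{-itH} |ψ⟩`, `t ∈ ℝ`, which does evolve: `ψ` is a unit
vector that is not an eigenvector of the Hamiltonian `H`. -/
structure ClockFamily (d : ℕ) where
  H : Matrix (Fin d) (Fin d) ℂ
  hermitian : H.IsHermitian
  ψ : Fin d → ℂ
  unit : star ψ ⬝ᵥ ψ = 1
  evolves : ¬ ∃ E : ℂ, H *ᵥ ψ = E • ψ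

namespace ClockFamily

variable {d : ℕ} (c : ClockFamily d)

def state (t : ℝ) : Fin d → ℂ := NormedSpace.exp ((-(Complex.I * (t : ℂ))) • c.H) *ᵥ c.ψ

/-- `(|ψ_t⟩⟨ψ_t|)^{⊗ N}`. -/
def copies (N : ℕ) (t : ℝ) : Matrix (Fin N → Fin d) (Fin N → Fin d) ℂ :=
  proj (tensorPow N (c.state t))

/-- The energy variance `⟨ψ|H²|ψ⟩ - ⟨ψ|H|ψ⟩²`. -/
def energyVariance : ℝ :=
  (star c.ψ ⬝ᵥ (c.H * c.H) *ᵥ c.ψ).re - (star c.ψ ⬝ᵥ c.H *ᵥ c.ψ).re ^ 2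

end ClockFamily

/-- How the error of an estimate `s` of the parameter `t` is measured. -/
inductive Loss where
  /-- `1 - |⟨ψ_s|ψ_t⟩|²` -/
  | infidelity
  /-- the squared distance from `s` to the nearest parameter that labels the same state as `t` -/
  | squaredDistance

def Loss.cost {d : ℕ} (c : ClockFamily d) : Loss → ℝ → ℝ → ℝ≥0∞
  | .infidelity, s, t => ENNReal.ofReal (1 - ‖star (c.state s) ⬝ᵥ c.state t‖ ^ 2)
  | .squaredDistance, s, t =>
      ENNReal.ofReal (Metric.infDist s {r : ℝ | proj (c.state r) = proj (c.state t)} ^ 2)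

/-- An estimator of the parameter from `N` copies; the estimate is the outcome of the
measurement. The estimator is deterministic if the measurement is complete. -/
abbrev Estimator (d N : ℕ) := Povm ℝ (Fin N → Fin d)

/-- Probability of success, averaged over `t` distributed according to `π`. -/
def Estimator.success {d N : ℕ} (c : ClockFamily d) (E : Estimator d N) (π : Measure ℝ) : ℝ≥0∞ :=
  ∫⁻ t, E.law (c.copies N t) Set.univ ∂π

/-- Expected loss conditional on success, for `t` distributed according to `π`; an estimator
that never succeeds has error `∞`. The value does not change when `π` is rescaled. -/
def Estimator.error {d N : ℕ} (c : ClockFamily d) (ℓ : Loss) (E : Estimator d N)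
    (π : Measure ℝ) : ℝ≥0∞ :=
  open Classical in
  if E.success c π = 0 then ∞
  else (∫⁻ t, ∫⁻ s, ℓ.cost c s t ∂E.law (c.copies N t) ∂π) / E.success c π

/-- An `N`-to-`M` cloner: the successful quantum operation of a cloning instrument. It is
deterministic if it is a channel. -/
abbrev Cloner (d N M : ℕ) := QOp (Fin N → Fin d) (Fin M → Fin d)

/-- The average fidelity conditional on success, for `t` distributed according to `π`. -/
def Cloner.fidelity {d N M : ℕ} (c : ClockFamily d) (C : Cloner d N M) (π : Measure ℝ) : ℝ≥0∞ :=
  (∫⁻ t, ENNReal.ofReal (c.copies M t * C.map (c.copies N t)).trace.re ∂π) /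
    ∫⁻ t, ENNReal.ofReal (C.map (c.copies N t)).trace.re ∂π

/-- How figures of merit are aggregated over `t ∈ ℝ`: in the worst case, or averaged over a
uniform `t ∈ [-T, T]` in the limit `T → ∞` (for a periodic family this is the average over a
period). -/
inductive Aggregate where
  | worstCase
  | timeAverage

/-- The aggregated value of a quantity that is to be small. -/
def Aggregate.ofError : Aggregate → (Measure ℝ → ℝ≥0∞) → ℝ≥0∞
  | .worstCase, g => ⨆ t : ℝ, g (Measure.dirac t)
  | .timeAverage, g => limsup (fun T : ℝ => g (volume.restrict (Set.Icc (-T) T))) atTop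

/-- The aggregated value of a quantity that is to be large. -/
def Aggregate.ofFidelity : Aggregate → (Measure ℝ → ℝ≥0∞) → ℝ≥0∞
  | .worstCase, g => ⨅ t : ℝ, g (Measure.dirac t)
  | .timeAverage, g => liminf (fun T : ℝ => g (volume.restrict (Set.Icc (-T) T))) atTop

/-- Strong converse of the asymptotic no-cloning theorem: deterministic cloning processes of
rate larger than one have vanishing fidelity. -/
def StrongConverseNoCloning {d : ℕ} (c : ClockFamily d) (a : Aggregate) : Prop :=
  ∀ (M : ℕ → ℕ) (C : ∀ N, Cloner d N (M N)), (∀ N, (C N).IsChannel) → 1 < replicationRate M →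
    Tendsto (fun N => a.ofFidelity ((C N).fidelity c)) atTop (𝓝 0)

/-- Strong converse of the Heisenberg limit for superreplication: cloning processes of rate
larger than two have vanishing fidelity, whatever their probability of success. -/
def StrongConverseHeisenberg {d : ℕ} (c : ClockFamily d) (a : Aggregate) : Prop :=
  ∀ (M : ℕ → ℕ) (C : ∀ N, Cloner d N (M N)), 2 < replicationRate M →
    Tendsto (fun N => a.ofFidelity ((C N).fidelity c)) atTop (𝓝 0)

/-! ### Unitary gates: estimation and replication -/

/-- The group of unitary gates on a system with basis indexed by `ι`. -/
abbrev Gate (ι : Type) [Fintype ι] [DecidableEq ι] := ↥(Matrix.unitaryGroup ι ℂ)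

instance (ι : Type) [Fintype ι] [DecidableEq ι] : MeasurableSpace (Gate ι) := borel _

instance (ι : Type) [Fintype ι] [DecidableEq ι] : BorelSpace (Gate ι) := ⟨rfl⟩

instance (ι : Type) [Fintype ι] [DecidableEq ι] : CompactSpace (Gate ι) := by
  refine (isCompact_iff_compactSpace (s := (Matrix.unitaryGroup ι ℂ : Set (Matrix ι ι ℂ)))).mp ?_
  have hK : IsCompact (Set.pi Set.univ fun _ : ι => Set.pi Set.univ fun _ : ι =>
      Metric.closedBall (0 : ℂ) 1) :=
    isCompact_univ_pi fun _ => isCompact_univ_pi fun _ => isCompact_closedBall 0 1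
  have hK' : IsCompact {A : Matrix ι ι ℂ | ∀ i j, ‖A i j‖ ≤ 1} := by
    have : (Set.pi Set.univ fun _ : ι => Set.pi Set.univ fun _ : ι =>
        Metric.closedBall (0 : ℂ) 1) = {A : Matrix ι ι ℂ | ∀ i j, ‖A i j‖ ≤ 1} := by
      ext A
      simp only [Set.mem_pi, Set.mem_univ, mem_closedBall_zero_iff, true_implies]
      exact Iff.rfl
    rw [← this]
    exact hK
  refine hK'.of_isClosed_subset ?_ fun U hU i j => entry_norm_bound_of_unitary hU i j
  have : (Matrix.unitaryGroup ι ℂ : Set (Matrix ι ι ℂ)) = {A | A * star A = 1} := by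
    ext A
    exact Matrix.mem_unitaryGroup_iff
  rw [this]
  exact isClosed_eq (by fun_prop) continuous_const

/-- The normalized Haar measure on the unitary gates. -/
def haar (ι : Type) [Fintype ι] [DecidableEq ι] : Measure (Gate ι) := Measure.haarMeasure ⊤

/-- The integral of `f` over the uniformly distributed pure state `V|e⟩`, where `V` is Haar
distributed and `|e⟩` is a basis vector (which one does not matter). -/
def pureStateAverage {ι : Type} [Fintype ι] [DecidableEq ι] [Nonempty ι]
    (f : (ι → ℂ) → ℝ≥0∞) : ℝ≥0∞ :=
  ∫⁻ V : Gate ι, f ((V : Matrix ι ι ℂ) *ᵥ Pi.single (Classical.arbitrary ι) 1) ∂haar ι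

/-- The average fidelity `∫ dψ |⟨ψ|U† Û|ψ⟩|²` of two gates. -/
def gateFidelity {ι : Type} [Fintype ι] [DecidableEq ι] [Nonempty ι]
    (V U : Matrix ι ι ℂ) : ℝ≥0∞ :=
  pureStateAverage fun ψ : ι → ℂ => ENNReal.ofReal (‖star ψ ⬝ᵥ (Uᴴ * V) *ᵥ ψ‖ ^ 2)

/-- The phase gate `U_t = ∑ n, e^{-int} |n⟩⟨n|`. -/
def phaseGate (d : ℕ) (t : ℝ) : Gate (Fin d) :=
  ⟨Matrix.diagonal fun n : Fin d => Complex.exp (-(Complex.I * ((n : ℕ) : ℂ) * (t : ℂ))), by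
    rw [Matrix.mem_unitaryGroup_iff, Matrix.star_eq_conjTranspose, Matrix.diagonal_conjTranspose,
      Matrix.diagonal_mul_diagonal, ← Matrix.diagonal_one]
    congr 1
    funext n
    simp [← Complex.exp_conj, ← Complex.exp_add]⟩

/-- The phase gates with `t` uniform in `[0, 2π)` (up to normalization, which is irrelevant for
the conditional fidelities below). -/
def phaseGates (d : ℕ) : Measure (Gate (Fin d)) :=
  (volume.restrict (Set.Ico (0 : ℝ) (2 * Real.pi))).map (phaseGate d)

/-- `k` uses of the gate `U`, each acting on the system `Fin d` next to an ancilla `A`, and each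
followed by a fixed quantum operation on system and ancilla. -/
def runUses {d : ℕ} {A : Type} [Fintype A] [DecidableEq A] (U : Matrix (Fin d) (Fin d) ℂ)
    (step : ℕ → QOp (Fin d × A) (Fin d × A)) :
    ℕ → Matrix (Fin d × A) (Fin d × A) ℂ → Matrix (Fin d × A) (Fin d × A) ℂ
  | 0, ρ => ρ
  | k + 1, ρ => (step k).map
      ((U ⊗ₖ (1 : Matrix A A ℂ)) * runUses U step k ρ * (U ⊗ₖ (1 : Matrix A A ℂ))ᴴ)

/-- A quantum network on the system `ι` that uses an unknown gate on `Fin d` exactly `N` times: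
encode, use the gate `N` times with quantum operations in between, decode. -/
structure GateNetwork (d N : ℕ) (ι : Type) [Fintype ι] where
  A : Type
  [fintypeA : Fintype A]
  [decidableEqA : DecidableEq A]
  encode : QOp ι (Fin d × A)
  step : ℕ → QOp (Fin d × A) (Fin d × A)
  decode : QOp (Fin d × A) ι

attribute [instance] GateNetwork.fintypeA GateNetwork.decidableEqA

/-- The quantum operation that results from inserting the gate `U` in the network. -/
def GateNetwork.run {d N : ℕ} {ι : Type} [Fintype ι] (W : GateNetwork d N ι)
    (U : Matrix (Fin d) (Fin d) ℂ) (ρ : Matrix ι ι ℂ) : Matrix ι ι ℂ :=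
  W.decode.map (runUses U W.step N (W.encode.map ρ))

def GateNetwork.IsDeterministic {d N : ℕ} {ι : Type} [Fintype ι] (W : GateNetwork d N ι) : Prop :=
  W.encode.IsChannel ∧ (∀ k, (W.step k).IsChannel) ∧ W.decode.IsChannel

/-- The fidelity `F_gate[N → M]` between the output of the network and `U^{⊗ M}|Ψ⟩`, averaged
over a uniform pure state `Ψ` of `M` systems and over a gate `U` distributed according to `ν`,
conditional on success. -/
def GateNetwork.fidelity {d N M : ℕ} [NeZero d] (W : GateNetwork d N (Fin M → Fin d))
    (ν : Measure (Gate (Fin d))) : ℝ≥0∞ :=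
  (∫⁻ U, pureStateAverage (fun Ψ : (Fin M → Fin d) → ℂ => ENNReal.ofReal
      (star (gatePow M (U : Matrix (Fin d) (Fin d) ℂ) *ᵥ Ψ) ⬝ᵥ
        W.run U (proj Ψ) *ᵥ (gatePow M (U : Matrix (Fin d) (Fin d) ℂ) *ᵥ Ψ)).re) ∂ν) /
    ∫⁻ U : Gate (Fin d), pureStateAverage (fun Ψ : (Fin M → Fin d) → ℂ => ENNReal.ofReal
      (W.run U (proj Ψ)).trace.re) ∂ν

/-- A deterministic strategy for the estimation of an unknown gate used `N` times: prepare a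
state, use the gate `N` times with channels in between, measure; the outcome is the estimate. -/
structure GateEstimator (d N : ℕ) where
  A : Type
  [fintypeA : Fintype A]
  [decidableEqA : DecidableEq A]
  init : Matrix (Fin d × A) (Fin d × A) ℂ
  init_posSemidef : init.PosSemidef
  init_trace : init.trace = 1
  step : ℕ → QOp (Fin d × A) (Fin d × A)
  step_isChannel : ∀ k, (step k).IsChannel
  povm : Povm (Gate (Fin d)) (Fin d × A)
  povm_isComplete : povm.IsComplete

attribute [instance] GateEstimator.fintypeA GateEstimator.decidableEqA

/-- The distribution `p_N(Û | U)` of the estimate. -/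
def GateEstimator.law {d N : ℕ} (E : GateEstimator d N) (U : Gate (Fin d)) :
    Measure (Gate (Fin d)) :=
  E.povm.law (runUses (U : Matrix (Fin d) (Fin d) ℂ) E.step N E.init)

/-- The gate estimation fidelity `∫ dU ∫ p_N(dÛ | U) F_gate(Û, U)`. -/
def GateEstimator.fidelity {d N : ℕ} [NeZero d] (E : GateEstimator d N) : ℝ≥0∞ :=
  ∫⁻ U, ∫⁻ V, gateFidelity (V : Matrix (Fin d) (Fin d) ℂ) (U : Matrix (Fin d) (Fin d) ℂ)
    ∂E.law U ∂haar (Fin d)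

/-- Strong converse for gate replication: processes that replicate phase gates at a rate larger
than two have vanishing gate fidelity, whatever their probability of success. -/
def StrongConverseGates (d : ℕ) [NeZero d] : Prop :=
  ∀ (M : ℕ → ℕ) (W : ∀ N, GateNetwork d N (Fin (M N) → Fin d)), 2 < replicationRate M →
    Tendsto (fun N => (W N).fidelity (phaseGates d)) atTop (𝓝 0)

end Replication

end

/-! The constructive claims rest on measuring and preparing. If the estimate `s` is prepared `M`
times, the fidelity for the true value `t` is the mean of `(1 - infidelity (s - t)) ^ M` over the
estimates. Jensen's inequality for `x ^ M`, applied to the joint law of parameter and estimate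
normalized by its mass (the probability of success), gives `(1 - e) ^ M`
(`Estimator.one_sub_error_pow_le`). Bernoulli's inequality turns this into `1 - M e`. With `M = ⌈N ^
r⌉₊` and `r` halfway between the critical exponent and the exponent of the error, `M e` tends to `0`
while the rate is `r`, so the limit `1` contradicts the limit `0` of a strong converse.

The impossibility statements do not assume any strong converse; they are proved directly. In the
energy eigenbasis the infidelity of two clock states is a mean of `1 - cos ((E_i - E_j) τ)`. It is
at most the variance times `τ ^ 2`, and at least `κ (1 - cos (ω τ))` because `ψ` is not an
eigenvector.

Standard quantum limit: two parameters with one-copy infidelity `1 / (2 N)` have `N`-copy squared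
overlap at least `1 / 2`. A complete measurement therefore cannot tell them apart reliably, and the
two risks add up to at least `1 / (32 N)` (`le_risk_add_risk`). Averaging over translates gives
`le_of_bounded_of_isComplete`.

Heisenberg limit: the probability of any outcome, as a function of `t`, is a trigonometric
polynomial of bandwidth proportional to `N`. For a frequency `Ω` beyond the band, the integral of
`cos (Ω (s - t))` against it over `[-T, T]` stays bounded, so the estimate does not follow the phase
`Ω t`. Since `1 - cos (L x) ≤ L ^ 2 (1 - cos x)`, this failure at the harmonic `Ω = L ω` forces an
infidelity of order `1 / L ^ 2`. Postselection does not help: the integrated probability of success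
of an estimator that ever succeeds is unbounded, by `eq_zero_of_integral_norm_le`, and so outgrows
the bounded term.

Gates: the second moments of a Haar random pure state follow from invariance and give the average
fidelity as `(1 + d F) / (d + 1)`, where the entanglement fidelity `F` is multiplicative under
tensor powers; hence the factor `(d + 1) / d * M`. A good Haar average says nothing about phase
gates alone, but estimating `g * U` for a suitable fixed `g` does at least as well on them as the
Haar average. The lower bound repeats the bandwidth argument on each orbit `t ↦ phaseGate d t * U`;
here the frequencies are integers, so orthogonality over a period is exact. -/

noncomputable section

namespace Replication

set_option linter.unusedSectionVars false

/-! ### Positive matrices -/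

section Matrices

variable {m n : Type} [Fintype m] [Fintype n]

instance (m n : Type) [Fintype m] [Fintype n] : SecondCountableTopology (Matrix m n ℂ) :=
  inferInstanceAs (SecondCountableTopology (m → n → ℂ))

lemma proj_apply (v : n → ℂ) (i j : n) : proj v i j = v i * star (v j) := rfl

lemma posSemidef_proj (v : n → ℂ) : (proj v).PosSemidef :=
  posSemidef_vecMulVec_self_star v

lemma trace_mul_proj (A : Matrix n n ℂ) (v : n → ℂ) :
    (A * proj v).trace = star v ⬝ᵥ A *ᵥ v := by
  rw [proj, mul_vecMulVec, trace_vecMulVec, dotProduct_comm]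

lemma trace_proj (v : n → ℂ) : (proj v).trace = star v ⬝ᵥ v := by
  rw [proj, trace_vecMulVec, dotProduct_comm]

lemma star_dotProduct_proj_mulVec (v w : n → ℂ) :
    star v ⬝ᵥ proj w *ᵥ v = ((‖star w ⬝ᵥ v‖ ^ 2 : ℝ) : ℂ) := by
  rw [proj, vecMulVec_mulVec, dotProduct_smul, MulOpposite.smul_eq_mul_unop, MulOpposite.unop_op,
    Complex.ofReal_pow, ← Complex.mul_conj', mul_comm]
  congr 1
  rw [starRingEnd_apply, star_dotProduct]

lemma trace_mul_nonneg {A B : Matrix n n ℂ} (hA : A.PosSemidef) (hB : B.PosSemidef) :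
    0 ≤ (A * B).trace := by
  obtain ⟨r, v, rfl⟩ := posSemidef_iff_eq_sum_vecMulVec.mp hB
  rw [Finset.mul_sum, trace_sum]
  exact Finset.sum_nonneg fun i _ => (trace_mul_proj A (v i)).symm ▸ hA.dotProduct_mulVec_nonneg _

lemma eq_ofReal_re_of_nonneg {z : ℂ} (hz : 0 ≤ z) : z = (z.re : ℂ) :=
  Complex.ext rfl (by simpa using (Complex.nonneg_iff.mp hz).2.symm)

lemma trace_mul_eq_ofReal {A B : Matrix n n ℂ} (hA : A.PosSemidef) (hB : B.PosSemidef) :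
    (A * B).trace = ((A * B).trace.re : ℂ) :=
  eq_ofReal_re_of_nonneg (trace_mul_nonneg hA hB)

lemma trace_mul_eq_sum (A B : Matrix n n ℂ) : (A * B).trace = ∑ i, ∑ j, A i j * B j i := by
  simp [Matrix.trace, Matrix.mul_apply]

/-- The quadratic form of the entrywise integral is the integral of the quadratic forms, which are
nonnegative. -/
lemma posSemidef_integral {Ω : Type} [MeasurableSpace Ω] {μ : Measure Ω} {F : Ω → Matrix n n ℂ}
    (hF : ∀ s, (F s).PosSemidef) (hi : ∀ i j, Integrable (fun s => F s i j) μ) :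
    (Matrix.of fun i j => ∫ s, F s i j ∂μ).PosSemidef := by
  refine PosSemidef.of_dotProduct_mulVec_nonneg ?_ fun x => ?_
  · ext i j
    rw [conjTranspose_apply, of_apply, of_apply, ← starRingEnd_apply, ← integral_conj]
    refine integral_congr_ae (.of_forall fun s => ?_)
    have := congrFun (congrFun (hF s).1 i) j
    simpa using this
  · have h : star x ⬝ᵥ (Matrix.of fun i j => ∫ s, F s i j ∂μ) *ᵥ x
        = ∫ s, star x ⬝ᵥ F s *ᵥ x ∂μ := by
      simp only [dotProduct, mulVec, of_apply]
      rw [integral_finsetSum _ fun i _ => (integrable_finsetSum _ fun j _ =>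
        (hi i j).mul_const _).const_mul _]
      refine Finset.sum_congr rfl fun i _ => ?_
      rw [integral_const_mul, integral_finsetSum _ fun j _ => (hi i j).mul_const _]
      simp_rw [integral_mul_const]
    have h' : ∀ s, star x ⬝ᵥ F s *ᵥ x = ((star x ⬝ᵥ F s *ᵥ x).re : ℂ) := fun s =>
      eq_ofReal_re_of_nonneg ((hF s).dotProduct_mulVec_nonneg x)
    rw [h, integral_congr_ae (.of_forall h'), integral_complex_ofReal]
    exact_mod_cast integral_nonneg fun s =>
      (Complex.nonneg_iff.mp ((hF s).dotProduct_mulVec_nonneg x)).1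

end Matrices

/-! ### Completely positive maps -/

section CompletelyPositive

variable {m n : Type} [Fintype m] [Fintype n]

/-- Complete positivity of a linear map on matrices. -/
def IsCP (Φ : Matrix m m ℂ →ₗ[ℂ] Matrix n n ℂ) : Prop :=
  ∀ (k : ℕ) (X : Matrix (Fin k × m) (Fin k × m) ℂ), X.PosSemidef → (ampliate k Φ X).PosSemidef

/-- Ampliation replaces each Kraus operator `L` by `1 ⊗ L`, so the ampliated map is again a sum of
congruences. -/
lemma isCP_of_kraus {r : ℕ} (L : Fin r → Matrix n m ℂ) {Φ : Matrix m m ℂ →ₗ[ℂ] Matrix n n ℂ}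
    (h : ∀ X, Φ X = ∑ i, L i * X * (L i)ᴴ) : IsCP Φ := by
  intro k X hX
  have : ampliate k Φ X = ∑ i, ((1 : Matrix (Fin k) (Fin k) ℂ) ⊗ₖ L i) * X *
      ((1 : Matrix (Fin k) (Fin k) ℂ) ⊗ₖ L i)ᴴ := by
    ext ⟨p, i⟩ ⟨q, j⟩
    simp only [ampliate, of_apply, h, Matrix.sum_apply]
    refine Finset.sum_congr rfl fun a _ => ?_
    simp [Matrix.mul_apply, Fintype.sum_prod_type, Matrix.one_apply, Finset.sum_mul, ite_mul,
      apply_ite star, mul_ite]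
  rw [this]
  exact posSemidef_sum _ fun i _ => hX.mul_mul_conjTranspose_same _

/-- The integral of a family of linear maps on matrices. -/
def integralMap {Ω : Type} [MeasurableSpace Ω] (μ : Measure Ω)
    (Ψ : Ω → Matrix m m ℂ →ₗ[ℂ] Matrix n n ℂ)
    (hi : ∀ X i j, Integrable (fun s => Ψ s X i j) μ) : Matrix m m ℂ →ₗ[ℂ] Matrix n n ℂ where
  toFun X := Matrix.of fun i j => ∫ s, Ψ s X i j ∂μ
  map_add' X Y := by
    ext i j
    simp only [of_apply, map_add, Matrix.add_apply]
    exact integral_add (hi X i j) (hi Y i j)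
  map_smul' c X := by
    ext i j
    simp only [of_apply, map_smul, Matrix.smul_apply, smul_eq_mul, RingHom.id_apply]
    exact integral_const_mul _ _

/-- Ampliation only rearranges entries, so it commutes with entrywise integration by definition. -/
lemma isCP_integralMap {Ω : Type} [MeasurableSpace Ω] {μ : Measure Ω}
    {Ψ : Ω → Matrix m m ℂ →ₗ[ℂ] Matrix n n ℂ}
    (hi : ∀ X i j, Integrable (fun s => Ψ s X i j) μ) (h : ∀ s, IsCP (Ψ s)) :
    IsCP (integralMap μ Ψ hi) := fun k X hX =>
  posSemidef_integral (F := fun s => ampliate k (Ψ s) X) (fun s => h s k X hX) fun p q =>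
    hi _ p.2 q.2

/-- Complete positivity with an arbitrary finite auxiliary system. -/
lemma IsCP.posSemidef_of {Φ : Matrix m m ℂ →ₗ[ℂ] Matrix n n ℂ} (hΦ : IsCP Φ) {K : Type} [Fintype K]
    {X : Matrix (K × m) (K × m) ℂ} (hX : X.PosSemidef) :
    (Matrix.of fun p q : K × n =>
      Φ (Matrix.of fun i j => X (p.1, i) (q.1, j)) p.2 q.2).PosSemidef := by
  let e := Fintype.equivFin K
  have := (hΦ _ _ (hX.submatrix fun p : Fin (Fintype.card K) × m => (e.symm p.1, p.2))).submatrix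
    fun p : K × n => (e p.1, p.2)
  convert this using 1
  ext p q
  simp [ampliate]

/-- The case of a trivial auxiliary system. -/
lemma IsCP.posSemidef_map {Φ : Matrix m m ℂ →ₗ[ℂ] Matrix n n ℂ} (hΦ : IsCP Φ)
    {X : Matrix m m ℂ} (hX : X.PosSemidef) : (Φ X).PosSemidef :=
  (hΦ.posSemidef_of (hX.submatrix fun p : Unit × m => p.2)).submatrix fun i => ((), i)

lemma QOp.posSemidef_map (C : QOp m n) {X : Matrix m m ℂ} (hX : X.PosSemidef) :
    (C.map X).PosSemidef :=
  IsCP.posSemidef_map C.completelyPositive hX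

/-- A completely positive trace-preserving map as a quantum operation. -/
def channelOf (Φ : Matrix m m ℂ →ₗ[ℂ] Matrix n n ℂ) (h : IsCP Φ) (ht : ∀ X, (Φ X).trace = X.trace) :
    QOp m n :=
  ⟨Φ, h, fun ρ _ => (ht ρ ▸ le_rfl)⟩

end CompletelyPositive

/-! ### The joint distribution of a parameter and a measurement outcome -/

section Joint

variable {Ω : Type} [MeasurableSpace Ω] {n : Type} [Fintype n] [DecidableEq n]

instance (E : Povm Ω n) : IsFiniteMeasure E.base := E.finite_base

/-- The density `Tr[P_s ρ]`. -/
def Povm.density (E : Povm Ω n) (ρ : Matrix n n ℂ) (s : Ω) : ℝ≥0∞ :=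
  ENNReal.ofReal (E.P s * ρ).trace.re

lemma Povm.law_eq (E : Povm Ω n) (ρ : Matrix n n ℂ) :
    E.law ρ = E.base.withDensity (E.density ρ) := rfl

lemma Povm.measurable_trace {X : Type} [MeasurableSpace X] (E : Povm Ω n) {ρ : X → Matrix n n ℂ}
    (hρ : ∀ i j, Measurable fun x => ρ x i j) :
    Measurable fun p : X × Ω => (E.P p.2 * ρ p.1).trace := by
  simp only [trace_mul_eq_sum]
  exact Finset.measurable_sum _ fun i _ => Finset.measurable_sum _ fun j _ =>
    ((E.measurable_P i j).comp measurable_snd).mul ((hρ j i).comp measurable_fst)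

lemma Povm.measurable_density_prod {X : Type} [MeasurableSpace X] (E : Povm Ω n)
    {ρ : X → Matrix n n ℂ} (hρ : ∀ i j, Measurable fun x => ρ x i j) :
    Measurable fun p : X × Ω => E.density (ρ p.1) p.2 :=
  (Complex.measurable_re.comp (E.measurable_trace hρ)).ennreal_ofReal

lemma Povm.measurable_density (E : Povm Ω n) (ρ : Matrix n n ℂ) : Measurable (E.density ρ) := by
  have h : Measurable fun s => (E.P s * ρ).trace := by
    simp only [trace_mul_eq_sum]
    exact Finset.measurable_sum _ fun i _ => Finset.measurable_sum _ fun j _ =>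
      (E.measurable_P i j).mul_const _
  exact (Complex.measurable_re.comp h).ennreal_ofReal

lemma Povm.lintegral_law (E : Povm Ω n) (ρ : Matrix n n ℂ) {f : Ω → ℝ≥0∞} (hf : Measurable f) :
    ∫⁻ s, f s ∂E.law ρ = ∫⁻ s, E.density ρ s * f s ∂E.base := by
  rw [Povm.law_eq, lintegral_withDensity_eq_lintegral_mul _ (E.measurable_density ρ) hf]
  rfl

lemma Povm.measurable_lintegral_law {X : Type} [MeasurableSpace X] (E : Povm Ω n)
    {ρ : X → Matrix n n ℂ} (hρ : ∀ i j, Measurable fun x => ρ x i j) {f : X → Ω → ℝ≥0∞}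
    (hf : Measurable (Function.uncurry f)) : Measurable fun x => ∫⁻ s, f x s ∂E.law (ρ x) := by
  have : (fun x => ∫⁻ s, f x s ∂E.law (ρ x)) =
      fun x => ∫⁻ s, E.density (ρ x) s * f x s ∂E.base :=
    funext fun x => E.lintegral_law _ (hf.comp measurable_prodMk_left)
  rw [this]
  exact ((E.measurable_density_prod hρ).mul hf).lintegral_prod_right'

/-- The joint distribution of `x`, distributed according to `ν`, and of the outcome of the
measurement on `ρ x`. -/
def Povm.joint {X : Type} [MeasurableSpace X] (E : Povm Ω n) (ρ : X → Matrix n n ℂ)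
    (ν : Measure X) : Measure (X × Ω) :=
  (ν.prod E.base).withDensity fun p => E.density (ρ p.1) p.2

lemma Povm.lintegral_joint {X : Type} [MeasurableSpace X] (E : Povm Ω n)
    {ρ : X → Matrix n n ℂ} (hρ : ∀ i j, Measurable fun x => ρ x i j) (ν : Measure X) [SFinite ν]
    {f : X → Ω → ℝ≥0∞} (hf : Measurable (Function.uncurry f)) :
    ∫⁻ p, f p.1 p.2 ∂E.joint ρ ν = ∫⁻ x, ∫⁻ s, f x s ∂E.law (ρ x) ∂ν := by
  have h := E.measurable_density_prod hρ
  have hm := h.mul hf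
  have e₁ : ∫⁻ p, f p.1 p.2 ∂E.joint ρ ν =
      ∫⁻ p, E.density (ρ p.1) p.2 * f p.1 p.2 ∂ν.prod E.base :=
    lintegral_withDensity_eq_lintegral_mul _ h hf
  have e₂ : ∫⁻ p, E.density (ρ p.1) p.2 * f p.1 p.2 ∂ν.prod E.base =
      ∫⁻ x, ∫⁻ s, E.density (ρ x) s * f x s ∂E.base ∂ν := lintegral_prod _ hm.aemeasurable
  rw [e₁, e₂]
  refine lintegral_congr fun x => ?_
  have hx : Measurable (f x) := hf.comp measurable_prodMk_left
  exact (E.lintegral_law (ρ x) hx).symm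

lemma Povm.joint_univ {X : Type} [MeasurableSpace X] (E : Povm Ω n)
    {ρ : X → Matrix n n ℂ} (hρ : ∀ i j, Measurable fun x => ρ x i j) (ν : Measure X) [SFinite ν] :
    E.joint ρ ν Set.univ = ∫⁻ x, E.law (ρ x) Set.univ ∂ν := by
  have := E.lintegral_joint hρ ν (f := fun _ _ => 1) measurable_const
  simpa using this

/-- The success effect `∫ P_s`. -/
def Povm.total (E : Povm Ω n) : Matrix n n ℂ := Matrix.of fun i j => ∫ s, E.P s i j ∂E.base

lemma Povm.posSemidef_total (E : Povm Ω n) : E.total.PosSemidef :=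
  posSemidef_integral E.posSemidef_P E.integrable_P

lemma Povm.integrable_trace (E : Povm Ω n) (ρ : Matrix n n ℂ) :
    Integrable (fun s => (E.P s * ρ).trace) E.base := by
  simp only [trace_mul_eq_sum]
  exact integrable_finsetSum _ fun i _ => integrable_finsetSum _ fun j _ =>
    (E.integrable_P i j).mul_const _

lemma Povm.integral_trace (E : Povm Ω n) (ρ : Matrix n n ℂ) :
    ∫ s, (E.P s * ρ).trace ∂E.base = (E.total * ρ).trace := by
  simp only [trace_mul_eq_sum]
  rw [integral_finsetSum _ fun i _ => integrable_finsetSum _ fun j _ =>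
    (E.integrable_P i j).mul_const _]
  refine Finset.sum_congr rfl fun i _ => ?_
  rw [integral_finsetSum _ fun j _ => (E.integrable_P i j).mul_const _]
  simp_rw [integral_mul_const]
  rfl

/-- The law uses the truncated real part of `Tr[P_s ρ]`. For positive `ρ` this trace is a
nonnegative real, so nothing is lost and complex functions can be integrated against the trace
itself. -/
lemma Povm.integral_law (E : Povm Ω n) {ρ : Matrix n n ℂ} (hρ : ρ.PosSemidef) (f : Ω → ℂ) :
    ∫ s, f s ∂E.law ρ = ∫ s, (E.P s * ρ).trace * f s ∂E.base := by
  rw [Povm.law_eq, integral_withDensity_eq_integral_toReal_smul (E.measurable_density ρ)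
    (.of_forall fun s => ENNReal.ofReal_lt_top)]
  refine integral_congr_ae (.of_forall fun s => ?_)
  have h := trace_mul_nonneg (E.posSemidef_P s) hρ
  simp only [Povm.density]
  rw [ENNReal.toReal_ofReal (Complex.nonneg_iff.mp h).1, eq_ofReal_re_of_nonneg h]
  simp

lemma Povm.law_univ (E : Povm Ω n) {ρ : Matrix n n ℂ} (hρ : ρ.PosSemidef) :
    E.law ρ Set.univ = ENNReal.ofReal (E.total * ρ).trace.re := by
  rw [Povm.law_eq, withDensity_apply _ MeasurableSet.univ, Measure.restrict_univ]
  simp only [Povm.density]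
  refine (ofReal_integral_eq_lintegral_ofReal (E.integrable_trace ρ).re
    (.of_forall fun s =>
      (Complex.nonneg_iff.mp (trace_mul_nonneg (E.posSemidef_P s) hρ)).1)).symm.trans ?_
  congr 1
  rw [← E.integral_trace]
  exact integral_re (E.integrable_trace ρ)

/-- The difference of the two sides is the probability of the failure outcome. -/
lemma Povm.trace_total_le (E : Povm Ω n) {ρ : Matrix n n ℂ} (hρ : ρ.PosSemidef) :
    (E.total * ρ).trace.re ≤ ρ.trace.re := by
  have h := (Complex.nonneg_iff.mp (trace_mul_nonneg E.failure_posSemidef hρ)).1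
  rw [Matrix.sub_mul, trace_sub, one_mul, Complex.sub_re] at h
  exact sub_nonneg.mp h

lemma Povm.law_univ_le (E : Povm Ω n) {ρ : Matrix n n ℂ} (hρ : ρ.PosSemidef) :
    E.law ρ Set.univ ≤ ENNReal.ofReal ρ.trace.re := by
  rw [E.law_univ hρ]
  exact ENNReal.ofReal_le_ofReal (E.trace_total_le hρ)

lemma Povm.IsComplete.law_univ {E : Povm Ω n} (hE : E.IsComplete) {ρ : Matrix n n ℂ}
    (hρ : ρ.PosSemidef) : E.law ρ Set.univ = ENNReal.ofReal ρ.trace.re := by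
  have h : E.total = 1 := hE
  rw [E.law_univ hρ, h, one_mul]

end Joint

/-! ### Clock states in the energy eigenbasis -/

namespace ClockFamily

variable {d : ℕ} (c : ClockFamily d)

/-- The matrix of energy eigenvectors. -/
def eigenbasis : Matrix (Fin d) (Fin d) ℂ := c.hermitian.eigenvectorUnitary

/-- The energy levels. -/
def energy (i : Fin d) : ℝ := c.hermitian.eigenvalues i

/-- The energy amplitudes of `ψ`. -/
def amplitude : Fin d → ℂ := star c.eigenbasis *ᵥ c.ψ

/-- The energy distribution of `ψ`. -/
def weight (i : Fin d) : ℝ := ‖c.amplitude i‖ ^ 2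

lemma star_eigenbasis_mul : star c.eigenbasis * c.eigenbasis = 1 :=
  Unitary.coe_star_mul_self c.hermitian.eigenvectorUnitary

lemma eigenbasis_mul_star : c.eigenbasis * star c.eigenbasis = 1 :=
  Unitary.coe_mul_star_self c.hermitian.eigenvectorUnitary

lemma H_eq : c.H = c.eigenbasis * diagonal (fun i => (c.energy i : ℂ)) * star c.eigenbasis := by
  conv_lhs => rw [c.hermitian.spectral_theorem, Unitary.conjStarAlgAut_apply]
  rfl

lemma eigenbasis_mulVec_amplitude : c.eigenbasis *ᵥ c.amplitude = c.ψ := by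
  rw [amplitude, mulVec_mulVec, eigenbasis_mul_star, one_mulVec]

/-- In the energy eigenbasis the evolution multiplies each amplitude by a phase; overlaps, variance
and bandwidth are all read off from this form. -/
lemma state_eq (t : ℝ) : c.state t = c.eigenbasis *ᵥ fun i =>
    Complex.exp (-(Complex.I * (c.energy i : ℂ) * (t : ℂ))) * c.amplitude i := by
  have hinv : c.eigenbasis⁻¹ = star c.eigenbasis :=
    Matrix.inv_eq_right_inv c.eigenbasis_mul_star
  have hU : IsUnit c.eigenbasis := ⟨⟨_, _, c.eigenbasis_mul_star, c.star_eigenbasis_mul⟩, rfl⟩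
  have : (-(Complex.I * (t : ℂ))) • c.H = c.eigenbasis *
      diagonal (fun i => -(Complex.I * (c.energy i : ℂ) * (t : ℂ))) * c.eigenbasis⁻¹ := by
    rw [hinv, c.H_eq, ← Matrix.smul_mul, ← Matrix.mul_smul, ← diagonal_smul]
    congr 3
    funext i
    simp only [Pi.smul_apply, smul_eq_mul]
    ring
  rw [state, this, Matrix.exp_conj _ _ hU, Matrix.exp_diagonal, hinv, ← mulVec_mulVec,
    ← mulVec_mulVec, ← amplitude]
  congr 1
  funext i
  rw [mulVec_diagonal, Pi.coe_exp, Complex.exp_eq_exp_ℂ]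

lemma star_eigenbasis_dotProduct (a b : Fin d → ℂ) :
    star (c.eigenbasis *ᵥ a) ⬝ᵥ c.eigenbasis *ᵥ b = star a ⬝ᵥ b := by
  rw [star_mulVec, dotProduct_mulVec, vecMul_vecMul, ← star_eq_conjTranspose,
    c.star_eigenbasis_mul, vecMul_one]

/-- The overlap is the characteristic function of the energy distribution at the time difference. -/
lemma overlap (s t : ℝ) : star (c.state s) ⬝ᵥ c.state t =
    ∑ i, (c.weight i : ℂ) * Complex.exp (Complex.I * ((c.energy i * (s - t) : ℝ) : ℂ)) := by
  rw [c.state_eq, c.state_eq, c.star_eigenbasis_dotProduct, dotProduct]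
  refine Finset.sum_congr rfl fun i _ => ?_
  rw [Pi.star_apply, star_mul', ← starRingEnd_apply, ← starRingEnd_apply, ← Complex.exp_conj,
    weight, Complex.ofReal_pow, ← Complex.conj_mul']
  have : Complex.exp (Complex.I * ((c.energy i * (s - t) : ℝ) : ℂ)) =
      Complex.exp ((starRingEnd ℂ) (-(Complex.I * (c.energy i : ℂ) * (s : ℂ)))) *
        Complex.exp (-(Complex.I * (c.energy i : ℂ) * (t : ℂ))) := by
    rw [← Complex.exp_add]
    congr 1
    simp only [map_neg, map_mul, Complex.conj_I, Complex.conj_ofReal]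
    push_cast
    ring
  rw [this]
  ring

lemma weight_nonneg (i : Fin d) : 0 ≤ c.weight i := sq_nonneg _

lemma star_dotProduct_self_eq (a : Fin d → ℂ) : star a ⬝ᵥ a = ((∑ i, ‖a i‖ ^ 2 : ℝ) : ℂ) := by
  rw [dotProduct]
  push_cast
  exact Finset.sum_congr rfl fun i _ => Complex.conj_mul' _

lemma sum_weight : ∑ i, c.weight i = 1 := by
  have h := c.unit
  rw [← c.eigenbasis_mulVec_amplitude, c.star_eigenbasis_dotProduct,
    star_dotProduct_self_eq] at h
  exact_mod_cast h

lemma state_unit (t : ℝ) : star (c.state t) ⬝ᵥ c.state t = 1 := by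
  rw [c.overlap]
  simp only [sub_self, mul_zero, Complex.ofReal_zero, Complex.exp_zero, mul_one]
  exact_mod_cast c.sum_weight

/-- The infidelity of two clock states as a function of the time difference. -/
def infidelity (τ : ℝ) : ℝ :=
  ∑ i, ∑ j, c.weight i * c.weight j * (1 - Real.cos ((c.energy i - c.energy j) * τ))

/-- The squared modulus of the characteristic function is a double sum over pairs of levels, in
which the addition formula leaves only cosines of energy differences. -/
lemma norm_overlap_sq (s t : ℝ) :
    ‖star (c.state s) ⬝ᵥ c.state t‖ ^ 2 = 1 - c.infidelity (s - t) := by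
  have h1 : (1 : ℝ) = ∑ i, ∑ j, c.weight i * c.weight j := by
    rw [← Finset.sum_mul_sum, c.sum_weight, one_mul]
  have h : 1 - c.infidelity (s - t) = ∑ i, ∑ j, c.weight i * c.weight j *
      Real.cos ((c.energy i - c.energy j) * (s - t)) := by
    rw [h1, infidelity, ← Finset.sum_sub_distrib]
    refine Finset.sum_congr rfl fun i _ => ?_
    rw [← Finset.sum_sub_distrib]
    exact Finset.sum_congr rfl fun j _ => by ring
  rw [h, ← Complex.normSq_eq_norm_sq, Complex.normSq_apply, c.overlap]
  simp only [Complex.re_sum, Complex.im_sum, Complex.re_ofReal_mul, Complex.im_ofReal_mul,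
    mul_comm Complex.I, Complex.exp_ofReal_mul_I_re, Complex.exp_ofReal_mul_I_im]
  rw [Finset.sum_mul_sum, Finset.sum_mul_sum, ← Finset.sum_add_distrib]
  refine Finset.sum_congr rfl fun i _ => ?_
  rw [← Finset.sum_add_distrib]
  refine Finset.sum_congr rfl fun j _ => ?_
  rw [sub_mul, Real.cos_sub]
  ring

lemma infidelity_nonneg (τ : ℝ) : 0 ≤ c.infidelity τ :=
  Finset.sum_nonneg fun i _ => Finset.sum_nonneg fun j _ =>
    mul_nonneg (mul_nonneg (c.weight_nonneg i) (c.weight_nonneg j))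
      (sub_nonneg.mpr (Real.cos_le_one _))

lemma infidelity_le_one (τ : ℝ) : c.infidelity τ ≤ 1 := by
  have h := c.norm_overlap_sq τ 0
  rw [sub_zero] at h
  linarith [sq_nonneg ‖star (c.state τ) ⬝ᵥ c.state 0‖]

lemma infidelity_neg (τ : ℝ) : c.infidelity (-τ) = c.infidelity τ := by
  simp [infidelity, Real.cos_neg]

lemma infidelity_zero : c.infidelity 0 = 0 := by simp [infidelity]

lemma continuous_infidelity : Continuous c.infidelity := by
  unfold infidelity
  fun_prop

lemma cost_infidelity (s t : ℝ) :
    Loss.infidelity.cost c s t = ENNReal.ofReal (c.infidelity (s - t)) := by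
  rw [Loss.cost, c.norm_overlap_sq, sub_sub_cancel]

/-- The variance is half the mean squared difference of two independent copies, which matches the
double sum in `infidelity`. -/
lemma energyVariance_eq : c.energyVariance =
    (∑ i, ∑ j, c.weight i * c.weight j * (c.energy i - c.energy j) ^ 2) / 2 := by
  have hH : c.H *ᵥ c.ψ = c.eigenbasis *ᵥ fun i => (c.energy i : ℂ) * c.amplitude i := by
    conv_lhs => rw [c.H_eq, ← mulVec_mulVec, ← mulVec_mulVec, ← amplitude]
    congr 1
    funext i
    rw [mulVec_diagonal]
  have hH2 : star c.ψ ⬝ᵥ (c.H * c.H) *ᵥ c.ψ = ((∑ i, c.weight i * c.energy i ^ 2 : ℝ) : ℂ) := by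
    have : star c.ψ ⬝ᵥ (c.H * c.H) *ᵥ c.ψ = star (c.H *ᵥ c.ψ) ⬝ᵥ c.H *ᵥ c.ψ := by
      rw [star_mulVec, c.hermitian.eq, ← mulVec_mulVec, dotProduct_mulVec]
    rw [this, hH, c.star_eigenbasis_dotProduct, star_dotProduct_self_eq]
    congr 1
    refine Finset.sum_congr rfl fun i _ => ?_
    rw [norm_mul, mul_pow, weight, Complex.norm_real, Real.norm_eq_abs, sq_abs]
    ring
  have hH1 : star c.ψ ⬝ᵥ c.H *ᵥ c.ψ = ((∑ i, c.weight i * c.energy i : ℝ) : ℂ) := by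
    rw [hH]
    conv_lhs => rw [← c.eigenbasis_mulVec_amplitude]
    rw [c.star_eigenbasis_dotProduct, dotProduct]
    push_cast
    refine Finset.sum_congr rfl fun i _ => ?_
    rw [weight, Complex.ofReal_pow, ← Complex.conj_mul', Pi.star_apply, ← starRingEnd_apply]
    ring
  rw [energyVariance, hH1, hH2, Complex.ofReal_re, Complex.ofReal_re]
  have e : ∀ i j, c.weight i * c.weight j * (c.energy i - c.energy j) ^ 2 =
      (c.weight i * c.energy i ^ 2) * c.weight j + c.weight i * (c.weight j * c.energy j ^ 2)
        - 2 * ((c.weight i * c.energy i) * (c.weight j * c.energy j)) := fun i j => by ring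
  simp only [e, Finset.sum_sub_distrib, Finset.sum_add_distrib, ← Finset.mul_sum,
    ← Finset.sum_mul, c.sum_weight]
  ring

/-- Termwise `1 - cos x ≤ x ^ 2 / 2`; the factor one half is the one in `energyVariance_eq`. -/
lemma infidelity_le (τ : ℝ) : c.infidelity τ ≤ c.energyVariance * τ ^ 2 := by
  rw [c.energyVariance_eq, infidelity, Finset.sum_div, Finset.sum_mul]
  refine Finset.sum_le_sum fun i _ => ?_
  rw [Finset.sum_div, Finset.sum_mul]
  refine Finset.sum_le_sum fun j _ => ?_
  have h := Real.one_sub_sq_div_two_le_cos (x := (c.energy i - c.energy j) * τ)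
  have hw := mul_nonneg (c.weight_nonneg i) (c.weight_nonneg j)
  nlinarith

lemma energyVariance_nonneg : 0 ≤ c.energyVariance := by
  rw [c.energyVariance_eq]
  exact div_nonneg (Finset.sum_nonneg fun i _ => Finset.sum_nonneg fun j _ =>
    mul_nonneg (mul_nonneg (c.weight_nonneg i) (c.weight_nonneg j)) (sq_nonneg _)) two_pos.le

/-- A quasi-triangle inequality, needed because the infidelity behaves like a squared distance.
Termwise it is `|1 - zw|² ≤ 2 (|1 - z|² + |1 - w|²)` for phases `z`, `w`. -/
lemma infidelity_add_le (a b : ℝ) :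
    c.infidelity (a + b) ≤ 2 * (c.infidelity a + c.infidelity b) := by
  simp only [infidelity, ← Finset.sum_add_distrib, Finset.mul_sum]
  refine Finset.sum_le_sum fun i _ => Finset.sum_le_sum fun j _ => ?_
  have hw := mul_nonneg (c.weight_nonneg i) (c.weight_nonneg j)
  have key : ∀ x y : ℝ, 1 - Real.cos (x + y) ≤ 2 * ((1 - Real.cos x) + (1 - Real.cos y)) := by
    intro x y
    rw [Real.cos_add]
    nlinarith [sq_nonneg (Real.sin x - Real.sin y), Real.sin_sq_add_cos_sq x,
      Real.sin_sq_add_cos_sq y, sq_nonneg (Real.cos x + Real.cos y - 2)]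
  have := key ((c.energy i - c.energy j) * a) ((c.energy i - c.energy j) * b)
  rw [mul_add]
  nlinarith

/-- If all populated levels had the same energy, `ψ` would be an eigenvector. -/
lemma exists_energy_ne : ∃ i j, 0 < c.weight i * c.weight j ∧ c.energy j < c.energy i := by
  have hne : ∃ i, c.weight i ≠ 0 := by
    by_contra! h
    simpa [h] using c.sum_weight
  obtain ⟨i, hi⟩ := hne
  have : ∃ j, c.weight j ≠ 0 ∧ c.energy j ≠ c.energy i := by
    by_contra! h
    refine c.evolves ⟨c.energy i, ?_⟩
    conv_lhs => rw [c.H_eq, ← mulVec_mulVec, ← mulVec_mulVec, ← amplitude]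
    rw [← c.eigenbasis_mulVec_amplitude, ← mulVec_smul]
    congr 1
    funext j
    rw [mulVec_diagonal, Pi.smul_apply, smul_eq_mul]
    by_cases hj : c.weight j = 0
    · have : c.amplitude j = 0 := by simpa [weight] using hj
      simp [this]
    · rw [h j hj]
  obtain ⟨j, hj, hji⟩ := this
  have hp : 0 < c.weight i * c.weight j :=
    mul_pos (lt_of_le_of_ne (c.weight_nonneg i) hi.symm) (lt_of_le_of_ne (c.weight_nonneg j) hj.symm)
  rcases lt_or_gt_of_ne hji with h | h
  · exact ⟨i, j, hp, h⟩
  · exact ⟨j, i, mul_comm (c.weight i) _ ▸ hp, h⟩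

/-- All terms of the double sum are nonnegative, so a single pair of populated levels with different
energies suffices. -/
lemma exists_le_infidelity : ∃ κ ω : ℝ, 0 < κ ∧ 0 < ω ∧
    ∀ τ, κ * (1 - Real.cos (ω * τ)) ≤ c.infidelity τ := by
  obtain ⟨i, j, hw, hE⟩ := c.exists_energy_ne
  refine ⟨c.weight i * c.weight j, c.energy i - c.energy j, hw, sub_pos.mpr hE, fun τ => ?_⟩
  have hn : ∀ i j, 0 ≤ c.weight i * c.weight j * (1 - Real.cos ((c.energy i - c.energy j) * τ)) :=
    fun i j => mul_nonneg (mul_nonneg (c.weight_nonneg i) (c.weight_nonneg j))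
      (sub_nonneg.mpr (Real.cos_le_one _))
  refine le_trans ?_ (Finset.single_le_sum (fun i _ => Finset.sum_nonneg fun j _ => hn i j)
    (Finset.mem_univ i))
  exact Finset.single_le_sum (f := fun j => c.weight i * c.weight j *
    (1 - Real.cos ((c.energy i - c.energy j) * τ))) (fun j _ => hn i j) (Finset.mem_univ j)

lemma continuous_state : Continuous c.state := by
  have : c.state = fun t : ℝ => c.eigenbasis *ᵥ fun i =>
    Complex.exp (-(Complex.I * (c.energy i : ℂ) * (t : ℂ))) * c.amplitude i := funext c.state_eq
  rw [this]
  fun_prop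

/-- The parameters that label the state of `t` form a closed nonempty set, so the distance from `s`
is attained at some `r`. Replacing `t` by `r` changes no overlap, and the quadratic bound applies to
`s - r`. -/
lemma cost_infidelity_le (s t : ℝ) : Loss.infidelity.cost c s t ≤
    ENNReal.ofReal c.energyVariance * Loss.squaredDistance.cost c s t := by
  set A : Set ℝ := {r : ℝ | proj (c.state r) = proj (c.state t)}
  have hA : IsClosed A := by
    refine isClosed_eq ?_ continuous_const
    have := c.continuous_state
    exact continuous_matrix fun i j => by
      simp only [proj_apply]
      exact (continuous_apply i |>.comp this).mul ((continuous_apply j |>.comp this).star)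
  obtain ⟨r, hr, hd⟩ := hA.exists_infDist_eq_dist ⟨t, rfl⟩ s
  have hst : c.infidelity (s - t) = c.infidelity (s - r) := by
    have h := c.norm_overlap_sq t s
    have h' := c.norm_overlap_sq r s
    have hr : proj (c.state r) = proj (c.state t) := hr
    have e := congrArg (fun X => star (c.state s) ⬝ᵥ X *ᵥ c.state s) hr
    simp only [star_dotProduct_proj_mulVec, Complex.ofReal_inj] at e
    rw [← neg_sub t s, ← neg_sub r s, c.infidelity_neg, c.infidelity_neg]
    linarith
  rw [c.cost_infidelity, Loss.cost, ← ENNReal.ofReal_mul c.energyVariance_nonneg, hst, hd,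
    Real.dist_eq, sq_abs]
  exact ENNReal.ofReal_le_ofReal (c.infidelity_le _)

/-! ### Copies of clock states -/

lemma star_tensorPow_dotProduct (M : ℕ) (v w : Fin d → ℂ) :
    star (tensorPow M v) ⬝ᵥ tensorPow M w = (star v ⬝ᵥ w) ^ M := by
  simp only [dotProduct, tensorPow, Pi.star_apply, star_prod, ← Finset.prod_mul_distrib]
  rw [← Fintype.prod_sum (f := fun (_ : Fin M) a => star (v a) * w a)]
  simp

lemma posSemidef_copies (N : ℕ) (t : ℝ) : (c.copies N t).PosSemidef := posSemidef_proj _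

lemma trace_copies (N : ℕ) (t : ℝ) : (c.copies N t).trace = 1 := by
  rw [copies, trace_proj, star_tensorPow_dotProduct, c.state_unit, one_pow]

lemma trace_copies_mul_copies (M : ℕ) (t s : ℝ) : (c.copies M t * c.copies M s).trace =
    (((1 - c.infidelity (s - t)) ^ M : ℝ) : ℂ) := by
  rw [copies, copies, trace_mul_proj, star_dotProduct_proj_mulVec, star_tensorPow_dotProduct,
    norm_pow, ← pow_mul, mul_comm M 2, pow_mul, c.norm_overlap_sq, ← neg_sub t s, infidelity_neg]

lemma continuous_copies (N : ℕ) (i j : Fin N → Fin d) : Continuous fun t => c.copies N t i j := by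
  simp only [copies, proj_apply, tensorPow]
  have := c.continuous_state
  fun_prop

lemma measurable_copies (N : ℕ) (i j : Fin N → Fin d) : Measurable fun t => c.copies N t i j :=
  (c.continuous_copies N i j).measurable

end ClockFamily

/-! ### The measure-and-prepare cloner -/

lemma norm_proj_apply_le_one {n : Type} [Fintype n] {v : n → ℂ} (hv : star v ⬝ᵥ v = 1) (i j : n) :
    ‖proj v i j‖ ≤ 1 := by
  have h : ∑ k, ‖v k‖ ^ 2 = 1 := by
    have : ((∑ k, ‖v k‖ ^ 2 : ℝ) : ℂ) = 1 := by
      rw [← hv, dotProduct]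
      push_cast
      exact Finset.sum_congr rfl fun i _ => (Complex.conj_mul' _).symm
    exact_mod_cast this
  have hk : ∀ k, ‖v k‖ ≤ 1 := fun k => by
    have := Finset.single_le_sum (f := fun k => ‖v k‖ ^ 2) (fun k _ => sq_nonneg _)
      (Finset.mem_univ k)
    nlinarith [norm_nonneg (v k)]
  rw [proj_apply, norm_mul, norm_star]
  exact mul_le_one₀ (hk i) (norm_nonneg _) (hk j)

/-- Writing `A` as a sum of `|w⟩⟨w|` yields the Kraus operators `|v⟩⟨w|`. -/
lemma isCP_trace_smul {m n : Type} [Fintype m] [Fintype n] {A : Matrix m m ℂ}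
    (hA : A.PosSemidef) (v : n → ℂ) {Φ : Matrix m m ℂ →ₗ[ℂ] Matrix n n ℂ}
    (h : ∀ X, Φ X = (A * X).trace • proj v) : IsCP Φ := by
  obtain ⟨r, w, rfl⟩ := posSemidef_iff_eq_sum_vecMulVec.mp hA
  refine isCP_of_kraus (fun i => vecMulVec v (star (w i))) fun X => ?_
  rw [h, Finset.sum_mul, trace_sum, Finset.sum_smul]
  refine Finset.sum_congr rfl fun i _ => ?_
  rw [conjTranspose_vecMulVec, star_star, vecMulVec_mul, vecMulVec_mul,
    vecMulVec_mul_vecMulVec, trace_vecMulVec, dotProduct_comm, proj]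
  ext a b
  simp [vecMulVec_apply]
  ring

namespace Estimator

variable {d N : ℕ} (c : ClockFamily d) (E : Estimator d N) (M : ℕ)

/-- The operation `X ↦ Tr[P_s X] |ψ_s⟩⟨ψ_s|^{⊗ M}`. -/
def prepare (s : ℝ) : Matrix (Fin N → Fin d) (Fin N → Fin d) ℂ →ₗ[ℂ]
    Matrix (Fin M → Fin d) (Fin M → Fin d) ℂ where
  toFun X := (E.P s * X).trace • c.copies M s
  map_add' X Y := by rw [Matrix.mul_add, trace_add, add_smul]
  map_smul' r X := by rw [Matrix.mul_smul, trace_smul, smul_assoc, RingHom.id_apply]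

lemma integrable_trace_mul_copies (X : Matrix (Fin N → Fin d) (Fin N → Fin d) ℂ)
    (i j : Fin M → Fin d) : Integrable (fun s => (E.P s * X).trace * c.copies M s i j) E.base := by
  refine (E.integrable_trace X).mul_bdd (c := 1) (c.measurable_copies M i j).aestronglyMeasurable
    (.of_forall fun s => norm_proj_apply_le_one ?_ i j)
  rw [ClockFamily.star_tensorPow_dotProduct, c.state_unit, one_pow]

/-- The linear map `X ↦ ∫ Tr[P_s X] |ψ_s⟩⟨ψ_s|^{⊗ M}`. -/
def measurePrepareMap : Matrix (Fin N → Fin d) (Fin N → Fin d) ℂ →ₗ[ℂ]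
    Matrix (Fin M → Fin d) (Fin M → Fin d) ℂ :=
  integralMap E.base (E.prepare c M) (E.integrable_trace_mul_copies c M)

lemma measurePrepareMap_apply (X : Matrix (Fin N → Fin d) (Fin N → Fin d) ℂ)
    (i j : Fin M → Fin d) : E.measurePrepareMap c M X i j =
      ∫ s, (E.P s * X).trace * c.copies M s i j ∂E.base := rfl

lemma trace_mul_measurePrepareMap (A : Matrix (Fin M → Fin d) (Fin M → Fin d) ℂ)
    (X : Matrix (Fin N → Fin d) (Fin N → Fin d) ℂ) : (A * E.measurePrepareMap c M X).trace =
      ∫ s, (E.P s * X).trace * (A * c.copies M s).trace ∂E.base := by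
  simp only [trace_mul_eq_sum A, measurePrepareMap_apply, Finset.mul_sum]
  have hi : ∀ i j, Integrable (fun s => (E.P s * X).trace * (A i j * c.copies M s j i)) E.base :=
    fun i j => by
      simpa only [mul_left_comm] using (E.integrable_trace_mul_copies c M X j i).const_mul (A i j)
  rw [integral_finsetSum _ fun i _ => integrable_finsetSum _ fun j _ => hi i j]
  refine Finset.sum_congr rfl fun i _ => ?_
  rw [integral_finsetSum _ fun j _ => hi i j]
  refine Finset.sum_congr rfl fun j _ => ?_
  rw [← integral_const_mul]
  exact integral_congr_ae (.of_forall fun s => mul_left_comm _ _ _)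

lemma trace_measurePrepareMap (X : Matrix (Fin N → Fin d) (Fin N → Fin d) ℂ) :
    (E.measurePrepareMap c M X).trace = (E.total * X).trace := by
  have h := E.trace_mul_measurePrepareMap c M 1 X
  simp only [Matrix.one_mul, c.trace_copies, mul_one] at h
  rw [h, E.integral_trace]

/-- The cloner that measures the estimator and prepares `M` copies of the estimated state. -/
def measurePrepare : Cloner d N M where
  map := E.measurePrepareMap c M
  completelyPositive := isCP_integralMap _ fun s =>
    isCP_trace_smul (E.posSemidef_P s) _ fun _ => rfl
  trace_le ρ hρ := by
    rw [E.trace_measurePrepareMap]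
    exact E.trace_total_le hρ

lemma measurePrepare_apply {ρ : Matrix (Fin N → Fin d) (Fin N → Fin d) ℂ} (hρ : ρ.PosSemidef)
    (i j : Fin M → Fin d) :
    (E.measurePrepare c M).map ρ i j = ∫ s, c.copies M s i j ∂E.law ρ :=
  (E.integral_law hρ _).symm

variable {E} in
lemma isChannel_measurePrepare (hE : E.IsComplete) : (E.measurePrepare c M).IsChannel := by
  intro ρ
  have h : E.total = 1 := hE
  exact (E.trace_measurePrepareMap c M ρ).trans (by rw [h, Matrix.one_mul])

lemma isFiniteMeasure_law (t : ℝ) : IsFiniteMeasure (E.law (c.copies N t)) :=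
  ⟨(E.law_univ_le (c.posSemidef_copies N t)).trans_lt ENNReal.ofReal_lt_top⟩

lemma law_univ_le_one (t : ℝ) : E.law (c.copies N t) Set.univ ≤ 1 := by
  simpa [c.trace_copies] using E.law_univ_le (c.posSemidef_copies N t)

/-- Given the estimate `s`, the output is a product state, and its overlap with the target is the
`M`-th power of the one-copy overlap. -/
lemma ofReal_trace_copies_mul_measurePrepare (t : ℝ) :
    ENNReal.ofReal (c.copies M t * (E.measurePrepare c M).map (c.copies N t)).trace.re =
      ∫⁻ s, ENNReal.ofReal ((1 - c.infidelity (s - t)) ^ M) ∂E.law (c.copies N t) := by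
  have := E.isFiniteMeasure_law c t
  have h : (c.copies M t * (E.measurePrepare c M).map (c.copies N t)).trace =
      ((∫ s, (1 - c.infidelity (s - t)) ^ M ∂E.law (c.copies N t) : ℝ) : ℂ) := by
    refine (E.trace_mul_measurePrepareMap c M _ _).trans ?_
    rw [← integral_complex_ofReal, E.integral_law (c.posSemidef_copies N t)]
    simp_rw [c.trace_copies_mul_copies]
  have hc := c.continuous_infidelity
  have h0 : ∀ s, 0 ≤ 1 - c.infidelity (s - t) := fun s => sub_nonneg.mpr (c.infidelity_le_one _)
  rw [h, Complex.ofReal_re, ofReal_integral_eq_lintegral_ofReal _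
    (.of_forall fun s => pow_nonneg (h0 s) M)]
  refine Integrable.of_bound (C := 1) (by fun_prop) (.of_forall fun s => ?_)
  rw [Real.norm_of_nonneg (pow_nonneg (h0 s) M)]
  exact pow_le_one₀ (h0 s) (sub_le_self _ (c.infidelity_nonneg _))

lemma ofReal_trace_measurePrepare (t : ℝ) :
    ENNReal.ofReal ((E.measurePrepare c M).map (c.copies N t)).trace.re =
      E.law (c.copies N t) Set.univ := by
  rw [E.law_univ (c.posSemidef_copies N t)]
  exact congrArg (fun z : ℂ => ENNReal.ofReal z.re) (E.trace_measurePrepareMap c M _)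

end Estimator

/-- Jensen's inequality for powers, in terms of conditional expectations. -/
lemma one_sub_lintegral_div_pow_le {Y : Type} [MeasurableSpace Y] (μ : Measure Y)
    [IsFiniteMeasure μ] (hμ : μ Set.univ ≠ 0) {f : Y → ℝ} (hf : Measurable f) (h0 : ∀ y, 0 ≤ f y)
    (h1 : ∀ y, f y ≤ 1) (M : ℕ) :
    (1 - (∫⁻ y, ENNReal.ofReal (f y) ∂μ) / μ Set.univ) ^ M ≤
      (∫⁻ y, ENNReal.ofReal ((1 - f y) ^ M) ∂μ) / μ Set.univ := by
  have hne : NeZero μ := ⟨fun h => hμ (by simp [h])⟩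
  have avg : ∀ g : Y → ℝ, Integrable g μ → (∀ y, 0 ≤ g y) →
      (∫⁻ y, ENNReal.ofReal (g y) ∂μ) / μ Set.univ = ENNReal.ofReal (⨍ y, g y ∂μ) := by
    intro g hg hg0
    rw [ofReal_average hg (.of_forall hg0)]
  have hi : Integrable f μ := Integrable.of_bound (C := 1) hf.aestronglyMeasurable
    (.of_forall fun y => by rw [Real.norm_of_nonneg (h0 y)]; exact h1 y)
  have hg0 : ∀ y, 0 ≤ 1 - f y := fun y => sub_nonneg.mpr (h1 y)
  have hp : Integrable (fun y => (1 - f y) ^ M) μ :=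
    Integrable.of_bound (C := 1) (by fun_prop) (.of_forall fun y => by
      rw [Real.norm_of_nonneg (pow_nonneg (hg0 y) M)]
      exact pow_le_one₀ (hg0 y) (sub_le_self _ (h0 y)))
  rw [avg f hi h0, avg _ hp fun y => pow_nonneg (hg0 y) M, ← ENNReal.ofReal_one,
    ← ENNReal.ofReal_sub _ (by
      rw [average_eq]
      exact smul_nonneg (inv_nonneg.mpr measureReal_nonneg) (integral_nonneg h0))]
  have h : 1 - ⨍ y, f y ∂μ = ⨍ y, (1 - f y) ∂μ := by
    have hu : μ.real Set.univ ≠ 0 := (measureReal_ne_zero_iff (by finiteness)).mpr hμ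
    rw [average_eq, average_eq, integral_sub (integrable_const _) hi, smul_sub, integral_const]
    simp [inv_mul_cancel₀ hu]
  have h' : 0 ≤ ⨍ y, (1 - f y) ∂μ := by
    rw [average_eq]
    exact smul_nonneg (inv_nonneg.mpr measureReal_nonneg) (integral_nonneg hg0)
  rw [h, ← ENNReal.ofReal_pow h']
  refine ENNReal.ofReal_le_ofReal ?_
  -- Jensen for the convex function `x ^ M` on `[0, ∞)`.
  exact (convexOn_pow M).map_average_le (f := fun y => 1 - f y) (continuous_pow M).continuousOn
    isClosed_Ici (.of_forall hg0) ((integrable_const 1).sub hi) hp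

namespace Estimator

variable {d N : ℕ} (c : ClockFamily d) (E : Estimator d N)

/-- The joint distribution of parameter and estimate. -/
def joint (π : Measure ℝ) : Measure (ℝ × ℝ) := Povm.joint E (c.copies N) π

lemma lintegral_joint (π : Measure ℝ) [SFinite π] {f : ℝ → ℝ → ℝ≥0∞}
    (hf : Measurable (Function.uncurry f)) : ∫⁻ p, f p.1 p.2 ∂E.joint c π =
      ∫⁻ t, ∫⁻ s, f t s ∂E.law (c.copies N t) ∂π :=
  Povm.lintegral_joint E (c.measurable_copies N) π hf

lemma joint_univ (π : Measure ℝ) [SFinite π] : E.joint c π Set.univ = E.success c π :=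
  Povm.joint_univ E (c.measurable_copies N) π

lemma success_le (π : Measure ℝ) : E.success c π ≤ π Set.univ := by
  refine (lintegral_mono fun t => E.law_univ_le_one c t).trans ?_
  simp

lemma measurable_infidelity :
    Measurable (Function.uncurry fun t s : ℝ => c.infidelity (s - t)) :=
  c.continuous_infidelity.measurable.comp (measurable_snd.sub measurable_fst)

/-- The fidelity of the measure-and-prepare cloner. -/
lemma one_sub_error_pow_le (M : ℕ) (π : Measure ℝ) [IsFiniteMeasure π]
    (h : E.success c π ≠ 0) :
    (1 - E.error c .infidelity π) ^ M ≤ (E.measurePrepare c M).fidelity c π := by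
  have hm := measurable_infidelity c
  have : IsFiniteMeasure (E.joint c π) :=
    ⟨by rw [E.joint_univ]; exact (E.success_le c π).trans_lt (by finiteness)⟩
  -- The mass of the joint law is the probability of success, so normalizing it is exactly
  -- conditioning on success.
  have key := one_sub_lintegral_div_pow_le (E.joint c π) (by rwa [E.joint_univ]) hm
    (fun p => c.infidelity_nonneg _) (fun p => c.infidelity_le_one _) M
  rw [E.joint_univ] at key
  rw [error, if_neg h, Cloner.fidelity]
  simp only [c.cost_infidelity, E.ofReal_trace_copies_mul_measurePrepare,
    E.ofReal_trace_measurePrepare]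
  rw [← E.lintegral_joint c π (f := fun t s => ENNReal.ofReal (c.infidelity (s - t)))
    hm.ennreal_ofReal, ← E.lintegral_joint c π
    (f := fun t s => ENNReal.ofReal ((1 - c.infidelity (s - t)) ^ M))
    (((measurable_const (a := (1 : ℝ))).sub hm).pow_const M).ennreal_ofReal]
  exact key

end Estimator

/-! ### Rates and asymptotics -/

/-- Bernoulli's inequality with truncated subtraction: for `e ≥ 1` and `M ≥ 1` the left side is `0`,
and otherwise all quantities are real. -/
lemma one_sub_mul_le_pow (e : ℝ≥0∞) (M : ℕ) : 1 - (M : ℝ≥0∞) * e ≤ (1 - e) ^ M := by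
  rcases Nat.eq_zero_or_pos M with rfl | hM
  · simp
  rcases le_total 1 e with h | h
  · have : (1 : ℝ≥0∞) ≤ M * e := by
      calc (1 : ℝ≥0∞) = 1 * 1 := (one_mul 1).symm
        _ ≤ M * e := mul_le_mul' (by exact_mod_cast hM) h
    rw [tsub_eq_zero_of_le this]
    exact zero_le
  · lift e to NNReal using ne_top_of_le_ne_top ENNReal.one_ne_top h
    have h' : (e : ℝ) ≤ 1 := by exact_mod_cast h
    have hb := one_add_mul_le_pow (a := -(e : ℝ)) (by linarith) M
    have e1 : (e : ℝ≥0∞) = ENNReal.ofReal e := by simp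
    rw [e1, ← ENNReal.ofReal_natCast, ← ENNReal.ofReal_mul (by positivity), ← ENNReal.ofReal_one,
      ← ENNReal.ofReal_sub _ (by positivity), ← ENNReal.ofReal_sub _ (by positivity),
      ← ENNReal.ofReal_pow (by linarith)]
    refine ENNReal.ofReal_le_ofReal ?_
    simpa [sub_eq_add_neg] using hb

lemma isTheta_ceil_rpow {r : ℝ} (hr : 0 < r) :
    (fun N : ℕ => ((⌈(N : ℝ) ^ r⌉₊ : ℕ) : ℝ)) =Θ[atTop] (fun N : ℕ => (N : ℝ) ^ r) := by
  refine ⟨Asymptotics.IsBigO.of_bound 2 ?_, Asymptotics.IsBigO.of_bound 1 ?_⟩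
  · filter_upwards [eventually_ge_atTop 1] with N hN
    have h1 : (1 : ℝ) ≤ (N : ℝ) ^ r := Real.one_le_rpow (by exact_mod_cast hN) hr.le
    have := Nat.ceil_lt_add_one (show 0 ≤ (N : ℝ) ^ r by positivity)
    rw [Real.norm_of_nonneg (by positivity), Real.norm_of_nonneg (by positivity)]
    linarith
  · filter_upwards with N
    rw [Real.norm_of_nonneg (by positivity), Real.norm_of_nonneg (by positivity), one_mul]
    exact Nat.le_ceil _

/-- Since `r > 1`, eventually `2 N ≤ N ^ r`, so `⌈N ^ r⌉₊ - N` lies between `N ^ r / 2` and `2 N ^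
r`. The quotient of logarithms then differs from `r` by at most `log 2 / log N`. -/
lemma replicationRate_ceil_rpow {r : ℝ} (hr : 1 < r) :
    replicationRate (fun N => ⌈(N : ℝ) ^ r⌉₊) = (r : EReal) := by
  refine Tendsto.liminf_eq ?_
  refine (continuous_coe_real_ereal.tendsto r).comp ?_
  have hlog : Tendsto (fun N : ℕ => Real.log (N : ℝ)) atTop atTop :=
    Real.tendsto_log_atTop.comp tendsto_natCast_atTop_atTop
  have hs : Tendsto (fun N : ℕ => (N : ℝ) ^ (r - 1)) atTop atTop :=
    (tendsto_rpow_atTop (by linarith)).comp tendsto_natCast_atTop_atTop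
  have hlim : ∀ b : ℝ, Tendsto (fun N : ℕ => r + b / Real.log (N : ℝ)) atTop (𝓝 r) := fun b => by
    simpa using tendsto_const_nhds.add (hlog.const_div_atTop b)
  refine tendsto_of_tendsto_of_tendsto_of_le_of_le' (hlim (-Real.log 2)) (hlim (Real.log 2)) ?_ ?_
  all_goals
    filter_upwards [hlog.eventually_gt_atTop 0, hs.eventually_ge_atTop 2,
      eventually_ge_atTop 1] with N hl hN2 hN1
    have hN : (1 : ℝ) ≤ N := by exact_mod_cast hN1
    have hpow : (N : ℝ) ^ r = (N : ℝ) ^ (r - 1) * N := by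
      conv_rhs => rw [← Real.rpow_one (N : ℝ), ← Real.rpow_mul (by positivity), one_mul,
        ← Real.rpow_add (by positivity)]
      congr 1
      ring
    have hge : 2 * (N : ℝ) ≤ (N : ℝ) ^ r := by
      rw [hpow]
      exact mul_le_mul_of_nonneg_right hN2 (by positivity)
    have hle : N ≤ ⌈(N : ℝ) ^ r⌉₊ := by
      have := Nat.le_ceil ((N : ℝ) ^ r)
      exact_mod_cast (by linarith : (N : ℝ) ≤ (⌈(N : ℝ) ^ r⌉₊ : ℝ))
    have hpos : 0 < (N : ℝ) ^ r := by positivity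
    have hlogr : Real.log ((N : ℝ) ^ r) = r * Real.log N := Real.log_rpow (by positivity) _
    have hc1 := Nat.le_ceil ((N : ℝ) ^ r)
    have hc2 := Nat.ceil_lt_add_one hpos.le
  · rw [← sub_nonneg, Nat.cast_sub hle]
    have : Real.log ((N : ℝ) ^ r / 2) ≤ Real.log ((⌈(N : ℝ) ^ r⌉₊ : ℝ) - N) :=
      Real.log_le_log (by positivity) (by linarith)
    rw [Real.log_div hpos.ne' two_ne_zero, hlogr] at this
    rw [sub_nonneg, le_div_iff₀ hl, add_mul, div_mul_cancel₀ _ hl.ne']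
    linarith
  · rw [Nat.cast_sub hle]
    have : Real.log ((⌈(N : ℝ) ^ r⌉₊ : ℝ) - N) ≤ Real.log ((N : ℝ) ^ r * 2) :=
      Real.log_le_log (by linarith) (by linarith)
    rw [Real.log_mul hpos.ne' two_ne_zero, hlogr] at this
    rw [div_le_iff₀ hl, add_mul, div_mul_cancel₀ _ hl.ne']
    linarith

/-- The subtracted term is of order `N ^ (r - β)`. -/
lemma tendsto_one_sub_ofReal_ceil_rpow (K : ℝ) {r β : ℝ} (hr : 0 < r) (h : r < β) :
    Tendsto (fun N : ℕ => 1 - ENNReal.ofReal (K * ((⌈(N : ℝ) ^ r⌉₊ : ℕ) / (N : ℝ) ^ β))) atTop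
      (𝓝 (1 : ℝ≥0∞)) := by
  have h0 : Tendsto (fun N : ℕ => ((⌈(N : ℝ) ^ r⌉₊ : ℕ) : ℝ) / (N : ℝ) ^ β) atTop (𝓝 0) := by
    have hneg : Tendsto (fun N : ℕ => (N : ℝ) ^ (-(β - r))) atTop (𝓝 0) :=
      (tendsto_rpow_neg_atTop (by linarith)).comp tendsto_natCast_atTop_atTop
    refine ((isTheta_ceil_rpow hr).isBigO.mul (Asymptotics.isBigO_refl
      (fun N : ℕ => ((N : ℝ) ^ β)⁻¹) atTop)).trans_tendsto ?_
    refine hneg.congr' ?_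
    filter_upwards [eventually_gt_atTop 0] with N hN
    have hN : (0 : ℝ) < N := by exact_mod_cast hN
    rw [← Real.rpow_neg hN.le, ← Real.rpow_add hN]
    congr 1
    ring
  have h1 := ENNReal.tendsto_ofReal (h0.const_mul K)
  have h2 := ENNReal.Tendsto.sub (tendsto_const_nhds (x := (1 : ℝ≥0∞))) h1 (.inl ENNReal.one_ne_top)
  simpa using h2

/-- No error of order `1/N^α` is also of order `1/N^β` for some `β > α`. -/
lemma not_eventually_div_rpow_le {κ K α β : ℝ} (hκ : 0 < κ) (h : α < β) :
    ¬ ∀ᶠ N : ℕ in atTop, κ / (N : ℝ) ^ α ≤ K / (N : ℝ) ^ β := by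
  intro hev
  have ht : Tendsto (fun N : ℕ => (N : ℝ) ^ (β - α)) atTop atTop :=
    (tendsto_rpow_atTop (by linarith)).comp tendsto_natCast_atTop_atTop
  obtain ⟨N, hN, hN1, hN2⟩ := (hev.and ((eventually_gt_atTop 0).and
    (ht.eventually_gt_atTop (K / κ)))).exists
  have hN1 : (0 : ℝ) < N := by exact_mod_cast hN1
  rw [div_le_div_iff₀ (by positivity) (by positivity)] at hN
  rw [Real.rpow_sub hN1, div_lt_div_iff₀ hκ (by positivity)] at hN2
  linarith

/-! ### Aggregated errors and fidelities -/

/-- The bound `e` holds for the errors that enter the aggregate. -/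
def Aggregate.Bounded (a : Aggregate) (g : Measure ℝ → ℝ≥0∞) (e : ℝ≥0∞) : Prop :=
  match a with
  | .worstCase => ∀ t : ℝ, g (Measure.dirac t) ≤ e
  | .timeAverage => ∀ᶠ T : ℝ in atTop, g (volume.restrict (Set.Icc (-T) T)) ≤ e

/-- The inequality is strict because a limsup equal to `e` would not keep the values eventually
below `e`. -/
lemma Aggregate.bounded_of_ofError_lt {a : Aggregate} {g : Measure ℝ → ℝ≥0∞} {e : ℝ≥0∞}
    (h : a.ofError g < e) : a.Bounded g e := by
  cases a
  · exact fun t => (le_iSup (fun t => g (Measure.dirac t)) t).trans h.le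
  · exact (eventually_lt_of_limsup_lt h).mono fun T hT => hT.le

lemma Aggregate.Bounded.mono {a : Aggregate} {g g' : Measure ℝ → ℝ≥0∞} {e e' : ℝ≥0∞}
    (h : a.Bounded g e) (hg : ∀ π, g π ≤ e → g' π ≤ e') : a.Bounded g' e' := by
  cases a
  · exact fun t => hg _ (h t)
  · exact Eventually.mono h fun T hT => hg _ hT

/-- A bound for each prior passes to either aggregate; the priors that occur, point masses and
Lebesgue measure on bounded intervals, are finite. -/
lemma Aggregate.le_ofFidelity {a : Aggregate} {g f : Measure ℝ → ℝ≥0∞} {e b : ℝ≥0∞}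
    (h : a.Bounded g e) (hg : ∀ π, IsFiniteMeasure π → g π ≤ e → b ≤ f π) : b ≤ a.ofFidelity f := by
  cases a
  · exact le_iInf fun t => hg _ inferInstance (h t)
  · exact le_liminf_of_le (by isBoundedDefault) (Eventually.mono h fun T hT =>
      hg _ ⟨by simp⟩ hT)

lemma Aggregate.ofFidelity_le {a : Aggregate} {f : Measure ℝ → ℝ≥0∞} {b : ℝ≥0∞}
    (h : ∀ π, f π ≤ b) : a.ofFidelity f ≤ b := by
  cases a
  · exact (iInf_le _ 0).trans (h _)
  · exact liminf_le_of_le (by isBoundedDefault) fun b' hb' => by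
      obtain ⟨T, hT⟩ := hb'.exists
      exact hT.trans (h _)

namespace Estimator

variable {d : ℕ} (c : ClockFamily d)

lemma error_infidelity_le (ℓ : Loss) {N : ℕ} (E : Estimator d N) (π : Measure ℝ) :
    E.error c .infidelity π ≤ ENNReal.ofReal (max 1 c.energyVariance) * E.error c ℓ π := by
  -- For an estimator that never succeeds both errors are `∞`, and a zero constant would turn the
  -- right side into `0`. The maximum with `1` prevents this and also serves the infidelity loss.
  have hpos : ENNReal.ofReal (max 1 c.energyVariance) ≠ 0 := by
    rw [Ne, ENNReal.ofReal_eq_zero, not_le]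
    exact lt_max_of_lt_left one_pos
  have hc : ∀ s t, Loss.infidelity.cost c s t ≤
      ENNReal.ofReal (max 1 c.energyVariance) * ℓ.cost c s t := by
    intro s t
    cases ℓ
    · exact le_mul_of_one_le_left' (by simp)
    · exact (c.cost_infidelity_le s t).trans
        (mul_le_mul_left (ENNReal.ofReal_le_ofReal (le_max_right _ _)) _)
  by_cases h : E.success c π = 0
  · simp [error, h]
  · rw [error, error, if_neg h, if_neg h, ← mul_div_assoc]
    refine ENNReal.div_le_div_right ?_ _
    rw [← lintegral_const_mul' _ _ ENNReal.ofReal_ne_top]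
    refine lintegral_mono fun t => ?_
    rw [← lintegral_const_mul' _ _ ENNReal.ofReal_ne_top]
    exact lintegral_mono fun s => hc s t

lemma success_ne_zero_of_error {ℓ : Loss} {N : ℕ} {E : Estimator d N} {π : Measure ℝ}
    (h : E.error c ℓ π ≠ ∞) : E.success c π ≠ 0 := fun h0 => h (by rw [error, if_pos h0])

/-- Any scaling of the error bounds the mean infidelity. -/
lemma bounded_of_errorScaling {a : Aggregate} {ℓ : Loss} {β : ℝ} {E : ∀ N, Estimator d N}
    (h : ErrorScaling (fun N => a.ofError ((E N).error c ℓ)) β) :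
    ∃ K : ℝ, ∀ᶠ N : ℕ in atTop,
      a.Bounded ((E N).error c .infidelity) (ENNReal.ofReal (K / (N : ℝ) ^ β)) := by
  obtain ⟨C, hC⟩ := h
  -- Enlarging `C` to `|C| + 1` gives the strict inequality that a bound on the limsup requires.
  refine ⟨max 1 c.energyVariance * (|C| + 1), ?_⟩
  filter_upwards [hC, eventually_gt_atTop 0] with N hN hN0
  have hN0 : (0 : ℝ) < N := by exact_mod_cast hN0
  have hlt : a.ofError ((E N).error c ℓ) < ENNReal.ofReal ((|C| + 1) / (N : ℝ) ^ β) := by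
    refine hN.trans_lt ((ENNReal.ofReal_lt_ofReal_iff (by positivity)).mpr ?_)
    exact div_lt_div_of_pos_right (by linarith [le_abs_self C]) (by positivity)
  refine (Aggregate.bounded_of_ofError_lt hlt).mono fun π hπ => ?_
  refine ((E N).error_infidelity_le c ℓ π).trans ?_
  rw [mul_div_assoc, ENNReal.ofReal_mul (le_max_of_le_left zero_le_one)]
  exact mul_le_mul_right hπ _

/-- A finite error bound excludes vanishing success for each prior involved, because by convention
the error would then be `∞`; Jensen and Bernoulli apply prior by prior. -/
lemma exists_measurePrepare_fidelity {a : Aggregate} {ℓ : Loss} {β : ℝ} {E : ∀ N, Estimator d N}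
    (h : ErrorScaling (fun N => a.ofError ((E N).error c ℓ)) β) (M : ℕ → ℕ) :
    ∃ K : ℝ, ∀ᶠ N : ℕ in atTop, 1 - ENNReal.ofReal (K * (M N / (N : ℝ) ^ β)) ≤
      a.ofFidelity (((E N).measurePrepare c (M N)).fidelity c) := by
  obtain ⟨K, hK⟩ := bounded_of_errorScaling c h
  refine ⟨K, hK.mono fun N hN => Aggregate.le_ofFidelity hN fun π _ hπ => ?_⟩
  have hs := success_ne_zero_of_error c (hπ.trans_lt ENNReal.ofReal_lt_top).ne
  refine le_trans ?_ ((E N).one_sub_error_pow_le c (M N) π hs)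
  refine le_trans ?_ (one_sub_mul_le_pow _ _)
  refine tsub_le_tsub_left ?_ _
  have : K * ((M N : ℝ) / (N : ℝ) ^ β) = (M N : ℝ) * (K / (N : ℝ) ^ β) := by ring
  rw [this, ENNReal.ofReal_mul (by positivity), ENNReal.ofReal_natCast]
  exact mul_le_mul_right hπ _

end Estimator

lemma posSemidef_one_sub_proj {n : Type} [Fintype n] [DecidableEq n] {v : n → ℂ}
    (hv : star v ⬝ᵥ v = 1) : (1 - proj v).PosSemidef := by
  have hh : (1 - proj v)ᴴ = 1 - proj v := by
    rw [conjTranspose_sub, conjTranspose_one, (posSemidef_proj v).1.eq]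
  have : 1 - proj v = (1 - proj v) * (1 - proj v)ᴴ := by
    have hp : proj v * proj v = proj v := by
      rw [proj, vecMulVec_mul_vecMulVec, hv, one_smul]
    rw [hh, mul_sub, sub_mul, sub_mul, hp]
    simp
  rw [this]
  exact posSemidef_self_mul_conjTranspose _

lemma trace_proj_mul_le {n : Type} [Fintype n] [DecidableEq n] {v : n → ℂ}
    (hv : star v ⬝ᵥ v = 1) {σ : Matrix n n ℂ} (hσ : σ.PosSemidef) :
    (proj v * σ).trace.re ≤ σ.trace.re := by
  have h := (Complex.nonneg_iff.mp (trace_mul_nonneg (posSemidef_one_sub_proj hv) hσ)).1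
  rw [Matrix.sub_mul, trace_sub, one_mul, Complex.sub_re] at h
  exact sub_nonneg.mp h

lemma Cloner.fidelity_le_one {d N M : ℕ} (c : ClockFamily d) (C : Cloner d N M) (π : Measure ℝ) :
    C.fidelity c π ≤ 1 := by
  refine ENNReal.div_le_of_le_mul ?_
  rw [one_mul]
  refine lintegral_mono fun t => ENNReal.ofReal_le_ofReal ?_
  refine trace_proj_mul_le ?_ (C.posSemidef_map (c.posSemidef_copies N t))
  rw [ClockFamily.star_tensorPow_dotProduct, c.state_unit, one_pow]

namespace Estimator

variable {d : ℕ} (c : ClockFamily d)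

/-- Measuring and preparing at a rate below the exponent of the estimation error. -/
lemma tendsto_fidelity_measurePrepare {a : Aggregate} {ℓ : Loss} {r β : ℝ} (hr : 0 < r)
    (hβ : r < β) {E : ∀ N, Estimator d N}
    (h : ErrorScaling (fun N => a.ofError ((E N).error c ℓ)) β) :
    Tendsto (fun N : ℕ => a.ofFidelity
      (((E N).measurePrepare c ⌈(N : ℝ) ^ r⌉₊).fidelity c)) atTop (𝓝 1) := by
  obtain ⟨K, hK⟩ := exists_measurePrepare_fidelity c h fun N => ⌈(N : ℝ) ^ r⌉₊
  exact tendsto_of_tendsto_of_tendsto_of_le_of_le' (tendsto_one_sub_ofReal_ceil_rpow K hr hβ)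
    tendsto_const_nhds hK
    (.of_forall fun N => Aggregate.ofFidelity_le fun π => Cloner.fidelity_le_one c _ π)

end Estimator

/-! ### The standard quantum limit -/

section TwoPoint

variable {n : Type} [Fintype n]

/-- Cauchy–Schwarz for the semi-inner product of `Q`, reduced to finite sums by writing `Q` as a sum
of rank-one operators. -/
lemma norm_star_dotProduct_mulVec_sq_le {Q : Matrix n n ℂ} (hQ : Q.PosSemidef) (v w : n → ℂ) :
    ‖star v ⬝ᵥ Q *ᵥ w‖ ^ 2 ≤ (star v ⬝ᵥ Q *ᵥ v).re * (star w ⬝ᵥ Q *ᵥ w).re := by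
  obtain ⟨r, q, rfl⟩ := posSemidef_iff_eq_sum_vecMulVec.mp hQ
  have e : ∀ v w : n → ℂ, star v ⬝ᵥ (∑ i, vecMulVec (q i) (star (q i))) *ᵥ w =
      ∑ i, star (star (q i) ⬝ᵥ v) * (star (q i) ⬝ᵥ w) := by
    intro v w
    rw [sum_mulVec, dotProduct_sum]
    refine Finset.sum_congr rfl fun i _ => ?_
    rw [vecMulVec_mulVec, dotProduct_smul, MulOpposite.smul_eq_mul_unop, MulOpposite.unop_op,
      star_dotProduct]
  have e' : ∀ v : n → ℂ, (star v ⬝ᵥ (∑ i, vecMulVec (q i) (star (q i))) *ᵥ v).re =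
      ∑ i, ‖star (q i) ⬝ᵥ v‖ ^ 2 := by
    intro v
    rw [e, Complex.re_sum]
    refine Finset.sum_congr rfl fun i _ => ?_
    rw [← starRingEnd_apply, Complex.conj_mul', ← Complex.ofReal_pow, Complex.ofReal_re]
  rw [e', e', e]
  refine le_trans ?_ (Finset.sum_mul_sq_le_sq_mul_sq _ _ _)
  refine pow_le_pow_left₀ (norm_nonneg _) ((norm_sum_le _ _).trans_eq ?_) 2
  exact Finset.sum_congr rfl fun i _ => by rw [norm_mul, norm_star]

/-- A test that distinguishes two states is limited by their overlap. -/
lemma norm_star_dotProduct_sq_le [DecidableEq n] {Q R : Matrix n n ℂ} (hQ : Q.PosSemidef)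
    (hR : R.PosSemidef) (h : Q + R = 1) {v w : n → ℂ} (hv : star v ⬝ᵥ v = 1)
    (hw : star w ⬝ᵥ w = 1) :
    ‖star v ⬝ᵥ w‖ ^ 2 ≤ 2 * ((star v ⬝ᵥ Q *ᵥ v).re + (star w ⬝ᵥ R *ᵥ w).re) := by
  have e : ∀ v w : n → ℂ, star v ⬝ᵥ w = star v ⬝ᵥ Q *ᵥ w + star v ⬝ᵥ R *ᵥ w := fun v w => by
    rw [← dotProduct_add, ← add_mulVec, h, one_mulVec]
  have hn : ∀ {A : Matrix n n ℂ}, A.PosSemidef → ∀ u : n → ℂ, 0 ≤ (star u ⬝ᵥ A *ᵥ u).re :=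
    fun hA u => (Complex.nonneg_iff.mp (hA.dotProduct_mulVec_nonneg u)).1
  have h1 := congrArg Complex.re ((e v v).symm.trans hv)
  have h2 := congrArg Complex.re ((e w w).symm.trans hw)
  rw [Complex.add_re, Complex.one_re] at h1 h2
  have c1 := norm_star_dotProduct_mulVec_sq_le hQ v w
  have c2 := norm_star_dotProduct_mulVec_sq_le hR v w
  -- The overlap splits as `⟨v|Q|w⟩ + ⟨v|R|w⟩`. In each part Cauchy–Schwarz keeps the error
  -- probability and bounds the other factor by one; the factor `2` is `(x + y)² ≤ 2 (x² + y²)`.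
  have b1 : ‖star v ⬝ᵥ Q *ᵥ w‖ ^ 2 ≤ (star v ⬝ᵥ Q *ᵥ v).re :=
    c1.trans (mul_le_of_le_one_right (hn hQ v) (by linarith [hn hR w]))
  have b2 : ‖star v ⬝ᵥ R *ᵥ w‖ ^ 2 ≤ (star w ⬝ᵥ R *ᵥ w).re :=
    c2.trans (mul_le_of_le_one_left (hn hR w) (by linarith [hn hQ v]))
  have tri := norm_add_le (star v ⬝ᵥ Q *ᵥ w) (star v ⬝ᵥ R *ᵥ w)
  rw [← e] at tri
  have := pow_le_pow_left₀ (norm_nonneg _) tri 2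
  nlinarith [sq_nonneg (‖star v ⬝ᵥ Q *ᵥ w‖ - ‖star v ⬝ᵥ R *ᵥ w‖)]

end TwoPoint

/-! ### Effects of sets of outcomes -/

section Effect

variable {Ω : Type} [MeasurableSpace Ω] {n : Type} [Fintype n] [DecidableEq n]

/-- The effect of the outcomes in `A`. -/
def Povm.effect (E : Povm Ω n) (A : Set Ω) : Matrix n n ℂ :=
  Matrix.of fun i j => ∫ s in A, E.P s i j ∂E.base

lemma Povm.posSemidef_effect (E : Povm Ω n) (A : Set Ω) : (E.effect A).PosSemidef :=
  posSemidef_integral E.posSemidef_P fun i j => (E.integrable_P i j).restrict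

lemma Povm.effect_add_compl (E : Povm Ω n) {A : Set Ω} (hA : MeasurableSet A) :
    E.effect A + E.effect Aᶜ = E.total := by
  ext i j
  exact integral_add_compl hA (E.integrable_P i j)

lemma Povm.law_apply (E : Povm Ω n) {ρ : Matrix n n ℂ} (hρ : ρ.PosSemidef) {A : Set Ω}
    (hA : MeasurableSet A) : E.law ρ A = ENNReal.ofReal (E.effect A * ρ).trace.re := by
  rw [Povm.law_eq, withDensity_apply _ hA]
  have hi := (E.integrable_trace ρ).restrict (s := A)
  refine (ofReal_integral_eq_lintegral_ofReal hi.re (.of_forall fun s =>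
      (Complex.nonneg_iff.mp (trace_mul_nonneg (E.posSemidef_P s) hρ)).1)).symm.trans ?_
  congr 1
  refine (integral_re hi).trans (congrArg Complex.re ?_)
  simp only [trace_mul_eq_sum]
  have hi' : ∀ i j, Integrable (fun s => E.P s i j * ρ j i) (E.base.restrict A) := fun i j =>
    (E.integrable_P i j).restrict.mul_const _
  rw [integral_finsetSum _ fun i _ => integrable_finsetSum _ fun j _ => hi' i j]
  refine Finset.sum_congr rfl fun i _ => ?_
  rw [integral_finsetSum _ fun j _ => hi' i j]
  simp_rw [integral_mul_const]
  rfl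

end Effect

/-! ### The two-point bound for deterministic estimators -/

namespace Estimator

variable {d : ℕ} (c : ClockFamily d)

lemma measurable_cost_infidelity :
    Measurable (Function.uncurry fun t s : ℝ => Loss.infidelity.cost c s t) := by
  simp only [c.cost_infidelity]
  exact (measurable_infidelity c).ennreal_ofReal

/-- The mean infidelity of a deterministic estimator for a fixed parameter. -/
def risk {N : ℕ} (E : Estimator d N) (t : ℝ) : ℝ≥0∞ :=
  ∫⁻ s, Loss.infidelity.cost c s t ∂E.law (c.copies N t)

lemma measurable_risk {N : ℕ} (E : Estimator d N) : Measurable (E.risk c) :=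
  Povm.measurable_lintegral_law E (c.measurable_copies N) (measurable_cost_infidelity c)

lemma measurable_law_univ {N : ℕ} (E : Estimator d N) :
    Measurable fun t => E.law (c.copies N t) Set.univ := by
  simpa using Povm.measurable_lintegral_law E (c.measurable_copies N) (f := fun _ _ => 1)
    measurable_const

/-- Brings both aggregates to one form: a worst-case bound is integrated over `[-T, T]`, a
time-average bound is already of this kind. Stating it without division keeps the success weight
explicit. -/
lemma eventually_lintegral_risk_le {a : Aggregate} {N : ℕ} {E : Estimator d N} {e : ℝ}
    (h : a.Bounded (E.error c .infidelity) (ENNReal.ofReal e)) : ∀ᶠ T : ℝ in atTop,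
      E.success c (volume.restrict (Set.Icc (-T) T)) ≠ 0 ∧
      ∫⁻ t in Set.Icc (-T) T, E.risk c t ≤
        ENNReal.ofReal e * E.success c (volume.restrict (Set.Icc (-T) T)) := by
  cases a
  · have hb : ∀ t, E.law (c.copies N t) Set.univ ≠ 0 ∧
        E.risk c t ≤ ENNReal.ofReal e * E.law (c.copies N t) Set.univ := by
      intro t
      have ht : E.error c .infidelity (Measure.dirac t) ≤ ENNReal.ofReal e := h t
      have hs := success_ne_zero_of_error c (ht.trans_lt ENNReal.ofReal_lt_top).ne
      have hr : ∫⁻ t, ∫⁻ s, Loss.infidelity.cost c s t ∂E.law (c.copies N t) ∂Measure.dirac t =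
        E.risk c t := lintegral_dirac' _ (E.measurable_risk c)
      rw [error, if_neg hs, success, lintegral_dirac' _ (E.measurable_law_univ c), hr] at ht
      rw [success, lintegral_dirac' _ (E.measurable_law_univ c)] at hs
      refine ⟨hs, (ENNReal.div_le_iff hs ?_).mp ht⟩
      exact ((E.law_univ_le_one c t).trans_lt ENNReal.one_lt_top).ne
    filter_upwards [eventually_gt_atTop 0] with T hT
    constructor
    · rw [success, Ne, lintegral_eq_zero_iff (E.measurable_law_univ c)]
      intro h0
      have hu : volume.restrict (Set.Icc (-T) T) Set.univ = 0 := by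
        refine measure_mono_null (fun t _ => ?_) (ae_iff.mp h0)
        exact (hb t).1
      rw [Measure.restrict_apply_univ, Real.volume_Icc, ENNReal.ofReal_eq_zero] at hu
      linarith
    · rw [success, ← lintegral_const_mul' _ _ ENNReal.ofReal_ne_top]
      exact lintegral_mono fun t => (hb t).2
  · refine Eventually.mono h fun T hT => ?_
    have hs := success_ne_zero_of_error c (hT.trans_lt ENNReal.ofReal_lt_top).ne
    refine ⟨hs, ?_⟩
    rw [error, if_neg hs] at hT
    refine (ENNReal.div_le_iff hs ?_).mp hT
    refine ((E.success_le c _).trans_lt ?_).ne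
    simp

/-- Le Cam's two-point method. The estimate is turned into a test between `t` and `t'`; a wrong
verdict costs at least a quarter of their infidelity, and the overlap of the `N` copies bounds the
error probabilities of the test from below. -/
lemma le_risk_add_risk {N : ℕ} {E : Estimator d N} (hE : E.IsComplete) (t t' : ℝ) :
    ENNReal.ofReal (c.infidelity (t - t') / 8 * (1 - c.infidelity (t - t')) ^ N) ≤
      E.risk c t + E.risk c t' := by
  set κ := c.infidelity (t - t') with hκ
  -- An estimate outside `A` is close to `t`, hence by `infidelity_add_le` at infidelity at least `κ
  -- / 2 - κ / 4` from `t'`.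
  set A : Set ℝ := {s | κ / 4 ≤ c.infidelity (s - t)}
  have hA : MeasurableSet A := measurableSet_le measurable_const
    (c.continuous_infidelity.measurable.comp (measurable_id.sub_const t))
  have hAc : ∀ s ∈ Aᶜ, κ / 4 ≤ c.infidelity (s - t') := by
    intro s hs
    have hs : c.infidelity (s - t) < κ / 4 := not_le.mp hs
    have h := c.infidelity_add_le (t - s) (s - t')
    rw [sub_add_sub_cancel, ← hκ, ← neg_sub s t, c.infidelity_neg] at h
    linarith
  have hlow : ∀ (B : Set ℝ) (u : ℝ), MeasurableSet B → (∀ s ∈ B, κ / 4 ≤ c.infidelity (s - u)) →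
      ENNReal.ofReal (κ / 4) * E.law (c.copies N u) B ≤ E.risk c u := by
    intro B u hB h
    rw [← setLIntegral_const]
    refine (setLIntegral_mono' hB fun s hs => ?_).trans (setLIntegral_le_lintegral B _)
    rw [c.cost_infidelity]
    exact ENNReal.ofReal_le_ofReal (h s hs)
  have h1 := hlow A t hA fun s hs => hs
  have h2 := hlow Aᶜ t' hA.compl hAc
  have hsum : E.effect A + E.effect Aᶜ = 1 := (Povm.effect_add_compl E hA).trans hE
  have hunit : ∀ u, star (tensorPow N (c.state u)) ⬝ᵥ tensorPow N (c.state u) = 1 := fun u => by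
    rw [ClockFamily.star_tensorPow_dotProduct, c.state_unit, one_pow]
  have key := norm_star_dotProduct_sq_le (Povm.posSemidef_effect E A)
    (Povm.posSemidef_effect E Aᶜ) hsum (hunit t) (hunit t')
  rw [ClockFamily.star_tensorPow_dotProduct, norm_pow, ← pow_mul, mul_comm N 2, pow_mul,
    c.norm_overlap_sq, ← hκ, ← trace_mul_proj, ← trace_mul_proj] at key
  have hn : ∀ (B : Set ℝ) u, 0 ≤ (E.effect B * c.copies N u).trace.re := fun B u =>
    (Complex.nonneg_iff.mp (trace_mul_nonneg (Povm.posSemidef_effect E B)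
      (c.posSemidef_copies N u))).1
  have hκ0 : 0 ≤ κ := c.infidelity_nonneg _
  refine le_trans ?_ (add_le_add h1 h2)
  rw [Povm.law_apply E (c.posSemidef_copies N t) hA,
    Povm.law_apply E (c.posSemidef_copies N t') hA.compl, ← mul_add,
    ← ENNReal.ofReal_add (hn _ _) (hn _ _), ← ENNReal.ofReal_mul (by positivity)]
  refine ENNReal.ofReal_le_ofReal ?_
  have := mul_le_mul_of_nonneg_left key (show 0 ≤ κ / 8 by positivity)
  refine this.trans_eq ?_
  simp only [ClockFamily.copies]
  ring

lemma success_of_isComplete {N : ℕ} {E : Estimator d N} (hE : E.IsComplete) (T : ℝ) :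
    E.success c (volume.restrict (Set.Icc (-T) T)) = ENNReal.ofReal (2 * T) := by
  have : ∀ t, E.law (c.copies N t) Set.univ = 1 := fun t => by
    rw [hE.law_univ (c.posSemidef_copies N t), c.trace_copies]
    simp
  rw [success]
  simp only [this, lintegral_const, one_mul, Measure.restrict_apply_univ, Real.volume_Icc]
  congr 1
  ring

/-- A deterministic estimator has mean infidelity of order at least `1/N`. -/
lemma le_of_bounded_of_isComplete : ∀ᶠ N : ℕ in atTop, ∀ (a : Aggregate) (E : Estimator d N)
    (e : ℝ), E.IsComplete → a.Bounded (E.error c .infidelity) (ENNReal.ofReal e) →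
      1 / 96 / (N : ℝ) ≤ e := by
  obtain ⟨κ, ω, hκ, hω, hle⟩ := c.exists_le_infidelity
  have hbig : ∀ᶠ N : ℕ in atTop, 1 / (2 * (N : ℝ)) ≤ 2 * κ := by
    have : Tendsto (fun N : ℕ => 1 / (2 * (N : ℝ))) atTop (𝓝 0) :=
      (tendsto_natCast_atTop_atTop.const_mul_atTop two_pos).const_div_atTop 1
    exact this.eventually_le_const (by positivity)
  filter_upwards [hbig, eventually_gt_atTop 0] with N hN hN0 a E e hE h
  have hN0' : (0 : ℝ) < N := by exact_mod_cast hN0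
  have hN1 : (1 : ℝ) ≤ N := by exact_mod_cast hN0
  -- Intermediate value theorem: the infidelity is `0` at `0` and at least `2 κ` at `π / ω`. With
  -- one-copy infidelity `1 / (2 N)`, Bernoulli leaves at least `1 / 2` of the `N`-copy squared
  -- overlap, so the risks sum to at least `1 / (2 N) / 8 / 2 = 1 / (32 N)`.
  obtain ⟨δ, hδ⟩ : 1 / (2 * (N : ℝ)) ∈ Set.range c.infidelity := by
    refine mem_range_of_exists_le_of_exists_ge c.continuous_infidelity
      ⟨0, by rw [c.infidelity_zero]; positivity⟩ ⟨Real.pi / ω, hN.trans ?_⟩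
    have := hle (Real.pi / ω)
    rw [mul_div_cancel₀ _ hω.ne', Real.cos_pi] at this
    linarith
  have hpt : ∀ t, ENNReal.ofReal (1 / (32 * (N : ℝ))) ≤ E.risk c t + E.risk c (t + δ) := by
    intro t
    refine le_trans (ENNReal.ofReal_le_ofReal ?_) (le_risk_add_risk c hE t (t + δ))
    rw [sub_add_cancel_left, c.infidelity_neg, hδ]
    have hb := one_add_mul_le_pow (a := -(1 / (2 * (N : ℝ)))) (by
      have : 1 / (2 * (N : ℝ)) ≤ 1 := by
        rw [div_le_one (by positivity)]
        linarith
      linarith) N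
    have : 1 + (N : ℝ) * -(1 / (2 * (N : ℝ))) = 1 / 2 := by
      field_simp
      norm_num
    rw [this, ← sub_eq_add_neg] at hb
    refine le_trans (le_of_eq ?_) (mul_le_mul_of_nonneg_left hb (by positivity))
    field_simp
    norm_num
  have hev := eventually_lintegral_risk_le c h
  have hev2 := (tendsto_id.const_mul_atTop (two_pos : (0 : ℝ) < 2)).eventually hev
  -- The error bound is used on `[-T, T]` and on `[-2T, 2T]`, which contains the translate of the
  -- former by `δ` once `T ≥ |δ|`. The lengths `2 T` and `4 T` add up to `6 T`, which accounts for
  -- the factor `3` between `32` and `96`.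
  obtain ⟨T, ⟨-, h1⟩, ⟨-, h2⟩, hT, hT0⟩ := (hev.and (hev2.and
    ((eventually_ge_atTop |δ|).and (eventually_gt_atTop 0)))).exists
  rw [success_of_isComplete c hE] at h1 h2
  have hshift : ∫⁻ t in Set.Icc (-T) T, E.risk c (t + δ) ≤
      ∫⁻ t in Set.Icc (-(2 * T)) (2 * T), E.risk c t := by
    rw [← lintegral_indicator measurableSet_Icc, ← lintegral_indicator measurableSet_Icc,
      ← lintegral_add_right_eq_self (Set.indicator (Set.Icc (-(2 * T)) (2 * T)) _) δ]
    refine lintegral_mono fun t => ?_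
    by_cases ht : t ∈ Set.Icc (-T) T
    · have ht' : t + δ ∈ Set.Icc (-(2 * T)) (2 * T) :=
        ⟨by linarith [ht.1, neg_abs_le δ], by linarith [ht.2, le_abs_self δ]⟩
      rw [Set.indicator_of_mem ht, Set.indicator_of_mem ht']
    · rw [Set.indicator_of_notMem ht]
      exact zero_le
  have hint : ENNReal.ofReal (1 / (32 * (N : ℝ))) * ENNReal.ofReal (2 * T) ≤
      ENNReal.ofReal e * ENNReal.ofReal (2 * T) +
        ENNReal.ofReal e * ENNReal.ofReal (2 * (2 * T)) := by
    refine le_trans ?_ (add_le_add h1 (hshift.trans h2))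
    rw [← lintegral_add_left (E.measurable_risk c)]
    calc ENNReal.ofReal (1 / (32 * (N : ℝ))) * ENNReal.ofReal (2 * T)
        = ∫⁻ t in Set.Icc (-T) T, ENNReal.ofReal (1 / (32 * (N : ℝ))) := by
          rw [setLIntegral_const, Real.volume_Icc]
          congr 2
          ring
      _ ≤ _ := lintegral_mono fun t => hpt t
  have he : 0 ≤ e := by
    by_contra! he
    rw [ENNReal.ofReal_of_nonpos he.le, zero_mul, zero_mul, zero_add,
      ← ENNReal.ofReal_mul (by positivity), nonpos_iff_eq_zero, ENNReal.ofReal_eq_zero] at hint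
    exact absurd hint (not_le.mpr (by positivity))
  rw [← ENNReal.ofReal_mul (by positivity), ← ENNReal.ofReal_mul he, ← ENNReal.ofReal_mul he,
    ← ENNReal.ofReal_add (by positivity) (by positivity),
    ENNReal.ofReal_le_ofReal_iff (by positivity)] at hint
  have hfin : 1 / (32 * (N : ℝ)) ≤ 3 * e := by
    by_contra! hlt
    nlinarith
  have : 1 / 96 / (N : ℝ) = 1 / (32 * (N : ℝ)) / 3 := by
    field_simp
    norm_num
  rw [this]
  linarith

lemma not_errorScaling_of_isComplete {a : Aggregate} {ℓ : Loss} {ε : ℝ} (hε : 0 < ε)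
    {E : ∀ N, Estimator d N} (hE : ∀ N, (E N).IsComplete) :
    ¬ ErrorScaling (fun N => a.ofError ((E N).error c ℓ)) (1 + ε) := by
  intro h
  obtain ⟨K, hK⟩ := bounded_of_errorScaling c h
  refine not_eventually_div_rpow_le (κ := 1 / 96) (K := K) (α := 1) (β := 1 + ε)
    (by norm_num) (by linarith) ?_
  filter_upwards [hK, le_of_bounded_of_isComplete c] with N h1 h2
  rw [Real.rpow_one]
  exact h2 a (E N) _ (hE N) h1

end Estimator

/-! ### Trigonometric polynomials -/

/-- The trigonometric polynomials with frequencies in `F`. -/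
def trigSpan (F : Set ℝ) : Submodule ℂ (ℝ → ℂ) :=
  Submodule.span ℂ ((fun ν t : ℝ => Complex.exp (Complex.I * ((ν * t : ℝ) : ℂ))) '' F)

lemma exp_mem_trigSpan {F : Set ℝ} {ν : ℝ} (h : ν ∈ F) :
    (fun t : ℝ => Complex.exp (Complex.I * ((ν * t : ℝ) : ℂ))) ∈ trigSpan F :=
  Submodule.subset_span ⟨ν, h, rfl⟩

lemma const_mem_trigSpan {F : Set ℝ} (h : (0 : ℝ) ∈ F) (z : ℂ) : (fun _ : ℝ => z) ∈ trigSpan F := by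
  have := (trigSpan F).smul_mem z (exp_mem_trigSpan h)
  simpa [Pi.smul_def] using this

lemma trigSpan_mono {F G : Set ℝ} (h : F ⊆ G) : trigSpan F ≤ trigSpan G :=
  Submodule.span_mono (Set.image_mono h)

/-- Frequencies add under multiplication, and it is enough to check this on generators. -/
lemma mul_mem_trigSpan {F G L : Set ℝ} (h : ∀ x ∈ F, ∀ y ∈ G, x + y ∈ L) {f g : ℝ → ℂ}
    (hf : f ∈ trigSpan F) (hg : g ∈ trigSpan G) : (fun t => f t * g t) ∈ trigSpan L := by
  have : f * g ∈ trigSpan F * trigSpan G := Submodule.mul_mem_mul hf hg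
  rw [trigSpan, trigSpan, Submodule.span_mul_span] at this
  refine Submodule.span_le.mpr ?_ this
  rintro _ ⟨_, ⟨x, hx, rfl⟩, _, ⟨y, hy, rfl⟩, rfl⟩
  refine Submodule.subset_span ⟨x + y, h x hx y hy, ?_⟩
  funext t
  simp only [Pi.mul_apply, ← Complex.exp_add]
  push_cast
  ring_nf

lemma sum_mem_trigSpan {F : Set ℝ} {ι : Type} (s : Finset ι) {f : ι → ℝ → ℂ}
    (h : ∀ i ∈ s, f i ∈ trigSpan F) : (fun t => ∑ i ∈ s, f i t) ∈ trigSpan F := by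
  have := (trigSpan F).sum_mem h
  rwa [show (∑ i ∈ s, f i) = fun t => ∑ i ∈ s, f i t from by ext t; simp] at this

lemma const_mul_mem_trigSpan {F : Set ℝ} {f : ℝ → ℂ} (z : ℂ) (h : f ∈ trigSpan F) :
    (fun t => z * f t) ∈ trigSpan F := (trigSpan F).smul_mem z h

lemma star_mem_trigSpan {F G : Set ℝ} (h : ∀ x ∈ F, -x ∈ G) {f : ℝ → ℂ} (hf : f ∈ trigSpan F) :
    (fun t => star (f t)) ∈ trigSpan G := by
  refine Submodule.span_induction (p := fun f _ => (fun t => star (f t)) ∈ trigSpan G)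
    ?_ ?_ ?_ ?_ hf
  · rintro _ ⟨ν, hν, rfl⟩
    have := exp_mem_trigSpan (h ν hν)
    convert this using 2 with t
    rw [← starRingEnd_apply, ← Complex.exp_conj]
    congr 1
    simp
  · simp only [Pi.zero_apply, star_zero]
    exact (trigSpan G).zero_mem
  · intro f g _ _ hf hg
    simpa [Pi.add_def] using (trigSpan G).add_mem hf hg
  · intro z f _ hf
    simpa [Pi.smul_def, mul_comm] using (trigSpan G).smul_mem (star z) hf

lemma continuous_of_mem_trigSpan {F : Set ℝ} {f : ℝ → ℂ} (hf : f ∈ trigSpan F) : Continuous f := by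
  refine Submodule.span_induction (p := fun f _ => Continuous f) ?_ ?_ ?_ ?_ hf
  · rintro _ ⟨ν, -, rfl⟩
    fun_prop
  · exact continuous_zero
  · exact fun f g _ _ hf hg => hf.add hg
  · exact fun z f _ hf => hf.const_smul z

/-- Away from frequency zero, integrals over `[-T, T]` stay bounded. -/
lemma exists_norm_integral_exp_mul_le {F : Set ℝ} {f : ℝ → ℂ} (hf : f ∈ trigSpan F) {Ω : ℝ}
    (hΩ : -Ω ∉ F) : ∃ K : ℝ, ∀ T : ℝ,
      ‖∫ t in (-T)..T, Complex.exp (Complex.I * ((Ω * t : ℝ) : ℂ)) * f t‖ ≤ K := by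
  refine Submodule.span_induction (p := fun f _ => ∃ K : ℝ, ∀ T : ℝ,
      ‖∫ t in (-T)..T, Complex.exp (Complex.I * ((Ω * t : ℝ) : ℂ)) * f t‖ ≤ K) ?_ ?_ ?_ ?_ hf
  · rintro _ ⟨ν, hν, rfl⟩
    have hne : Ω + ν ≠ 0 := fun h => hΩ ((neg_eq_of_add_eq_zero_right h).symm ▸ hν)
    -- The primitive of `exp (i (Ω + ν) t)` has modulus `1 / |Ω + ν|` at both end points.
    refine ⟨2 / |Ω + ν|, fun T => ?_⟩
    have e : ∀ t : ℝ, Complex.exp (Complex.I * ((Ω * t : ℝ) : ℂ)) *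
        Complex.exp (Complex.I * ((ν * t : ℝ) : ℂ)) =
          Complex.exp (((Ω + ν : ℝ) : ℂ) * Complex.I * (t : ℂ)) := fun t => by
      rw [← Complex.exp_add]
      push_cast
      ring_nf
    have hc : ((Ω + ν : ℝ) : ℂ) * Complex.I ≠ 0 :=
      mul_ne_zero (by exact_mod_cast hne) Complex.I_ne_zero
    simp only [e]
    rw [integral_exp_mul_complex hc, norm_div, norm_mul, Complex.norm_I, mul_one,
      Complex.norm_real, Real.norm_eq_abs]
    refine div_le_div_of_nonneg_right ?_ (abs_nonneg _)
    refine (norm_sub_le _ _).trans_eq ?_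
    have hn : ∀ x : ℝ, ‖Complex.exp (((Ω + ν : ℝ) : ℂ) * Complex.I * (x : ℂ))‖ = 1 := fun x => by
      rw [mul_right_comm, ← Complex.ofReal_mul, Complex.norm_exp_ofReal_mul_I]
    rw [hn, hn]
    norm_num
  · exact ⟨0, fun T => by simp⟩
  · rintro f g hf hg ⟨K, hK⟩ ⟨K', hK'⟩
    have hf := continuous_of_mem_trigSpan hf
    have hg := continuous_of_mem_trigSpan hg
    refine ⟨K + K', fun T => ?_⟩
    simp only [Pi.add_apply, mul_add]
    rw [intervalIntegral.integral_add (by apply Continuous.intervalIntegrable; fun_prop)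
      (by apply Continuous.intervalIntegrable; fun_prop)]
    exact (norm_add_le _ _).trans (add_le_add (hK T) (hK' T))
  · rintro z f - ⟨K, hK⟩
    refine ⟨‖z‖ * K, fun T => ?_⟩
    simp only [Pi.smul_apply, smul_eq_mul, mul_left_comm _ z]
    rw [intervalIntegral.integral_const_mul, norm_mul]
    exact mul_le_mul_of_nonneg_left (hK T) (norm_nonneg z)

/-- An integrable trigonometric polynomial vanishes. -/
lemma eq_zero_of_integral_norm_le {f : ℝ → ℂ} (hf : f ∈ trigSpan Set.univ) {K : ℝ}
    (hK : ∀ T : ℝ, 0 ≤ T → ∫ t in (-T)..T, ‖f t‖ ≤ K) : f = 0 := by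
  set v : ℝ → ℝ → ℂ := fun ν t => Complex.exp (Complex.I * ((ν * t : ℝ) : ℂ))
  obtain ⟨l, -, hl⟩ := (Finsupp.mem_span_image_iff_linearCombination ℂ).mp hf
  have hl0 : l = 0 := by
    by_contra hne
    obtain ⟨ν, hν⟩ := Finsupp.support_nonempty_iff.mpr hne
    -- Demodulating by `exp (-i ν t)` makes the term of frequency `ν` constant, with integral `2 T *
    -- l ν`, while the remaining frequencies contribute a bounded amount. Bounded `∫ ‖f‖` is then
    -- incompatible with `l ν ≠ 0`.
    have hsum : f = (∑ μ ∈ l.support.erase ν, l μ • v μ) + l ν • v ν := by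
      rw [Finset.sum_erase_add _ _ hν, ← hl]
      rfl
    set g := ∑ μ ∈ l.support.erase ν, l μ • v μ with hg
    have hgm : g ∈ trigSpan {μ | μ ≠ ν} := Submodule.sum_mem _ fun μ hμ =>
      Submodule.smul_mem _ _ (exp_mem_trigSpan (Finset.ne_of_mem_erase hμ))
    obtain ⟨K', hK'⟩ := exists_norm_integral_exp_mul_le hgm (Ω := -ν) (by simp)
    have hfc := continuous_of_mem_trigSpan hf
    have hgc := continuous_of_mem_trigSpan hgm
    have hbound : ∀ T : ℝ, 0 ≤ T → 2 * T * ‖l ν‖ ≤ K + K' := by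
      intro T hT
      have e : ∀ t : ℝ, l ν = Complex.exp (Complex.I * ((-ν * t : ℝ) : ℂ)) * f t -
          Complex.exp (Complex.I * ((-ν * t : ℝ) : ℂ)) * g t := by
        intro t
        rw [← mul_sub, hsum]
        simp only [Pi.add_apply, Pi.smul_apply, add_sub_cancel_left, smul_eq_mul, v]
        rw [mul_left_comm, ← Complex.exp_add]
        simp
      have hI : ((2 * T : ℝ) : ℂ) * l ν =
          (∫ t in (-T)..T, Complex.exp (Complex.I * ((-ν * t : ℝ) : ℂ)) * f t) -
          ∫ t in (-T)..T, Complex.exp (Complex.I * ((-ν * t : ℝ) : ℂ)) * g t := by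
        rw [← intervalIntegral.integral_sub (by apply Continuous.intervalIntegrable; fun_prop)
          (by apply Continuous.intervalIntegrable; fun_prop),
          ← intervalIntegral.integral_congr (fun t _ => e t), intervalIntegral.integral_const]
        rw [Complex.real_smul]
        push_cast
        ring
      have hn : ‖∫ t in (-T)..T, Complex.exp (Complex.I * ((-ν * t : ℝ) : ℂ)) * f t‖ ≤ K := by
        refine (intervalIntegral.norm_integral_le_integral_norm (by linarith)).trans ?_
        refine le_of_eq_of_le (intervalIntegral.integral_congr fun t _ => ?_) (hK T hT)
        simp only [norm_mul]
        rw [mul_comm Complex.I, Complex.norm_exp_ofReal_mul_I, one_mul]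
      have := congrArg norm hI
      rw [norm_mul, Complex.norm_real, Real.norm_of_nonneg (by positivity)] at this
      rw [this]
      exact (norm_sub_le _ _).trans (add_le_add hn (hK' T))
    have hpos : 0 < ‖l ν‖ := norm_pos_iff.mpr (Finsupp.mem_support_iff.mp hν)
    have hKK : 0 ≤ K + K' := by simpa using hbound 0 le_rfl
    have := hbound ((K + K' + 1) / ‖l ν‖) (by positivity)
    rw [mul_assoc, div_mul_cancel₀ _ hpos.ne'] at this
    linarith
  rw [← hl, hl0]
  simp

lemma abs_sin_natCast_mul_le (n : ℕ) (x : ℝ) : |Real.sin (n * x)| ≤ n * |Real.sin x| := by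
  induction n with
  | zero => simp
  | succ n ih =>
    rw [Nat.cast_succ, add_mul, one_mul, Real.sin_add]
    refine (abs_add_le _ _).trans ?_
    rw [abs_mul, abs_mul, add_mul, one_mul]
    exact add_le_add ((mul_le_of_le_one_right (abs_nonneg _) (Real.abs_cos_le_one _)).trans ih)
      (mul_le_of_le_one_left (abs_nonneg _) (Real.abs_cos_le_one _))

/-- The bound `|sin (n x)| ≤ n |sin x|` at half angle, squared. It is the price `L ^ 2` for passing
from the base frequency to a harmonic beyond the bandwidth. -/
lemma one_sub_cos_natCast_mul_le (n : ℕ) (x : ℝ) :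
    1 - Real.cos (n * x) ≤ (n : ℝ) ^ 2 * (1 - Real.cos x) := by
  have h : ∀ y : ℝ, 1 - Real.cos y = 2 * |Real.sin (y / 2)| ^ 2 := fun y => by
    rw [sq_abs, Real.sin_sq_eq_half_sub, mul_div_cancel₀ _ (two_ne_zero' ℝ)]
    ring
  rw [h, h, mul_div_assoc]
  have := pow_le_pow_left₀ (abs_nonneg _) (abs_sin_natCast_mul_le n (x / 2)) 2
  rw [mul_pow] at this
  linarith

/-! ### The Heisenberg limit for clock states -/

lemma prod_mem_trigSpan {ι : Type} (s : Finset ι) {R : ℝ} {f : ι → ℝ → ℂ}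
    (h : ∀ k ∈ s, f k ∈ trigSpan (Set.Icc (-R) R)) :
    (fun t => ∏ k ∈ s, f k t) ∈ trigSpan (Set.Icc (-(s.card * R)) (s.card * R)) := by
  classical
  induction s using Finset.induction_on with
  | empty => simpa using const_mem_trigSpan (F := {0}) rfl 1
  | insert a s ha ih =>
    simp only [Finset.prod_insert ha, Finset.card_insert_of_notMem ha]
    refine mul_mem_trigSpan ?_ (h a (Finset.mem_insert_self a s))
      (ih fun k hk => h k (Finset.mem_insert_of_mem hk))
    intro x hx y hy
    push_cast
    constructor <;> linarith [hx.1, hx.2, hy.1, hy.2]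

/-- No sign is assumed: passing to the positive part only increases the integral. -/
lemma ofReal_integral_le_lintegral {Y : Type} [MeasurableSpace Y] {μ : Measure Y} {f : Y → ℝ}
    (hf : Integrable f μ) : ENNReal.ofReal (∫ y, f y ∂μ) ≤ ∫⁻ y, ENNReal.ofReal (f y) ∂μ := by
  have h : ∫ y, f y ∂μ ≤ ∫ y, max (f y) 0 ∂μ :=
    integral_mono hf hf.pos_part fun y => le_max_left _ _
  refine (ENNReal.ofReal_le_ofReal h).trans ?_
  rw [ofReal_integral_eq_lintegral_ofReal hf.pos_part (.of_forall fun y => le_max_right _ _)]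
  exact lintegral_mono fun y => by simp

namespace ClockFamily

variable {d : ℕ} (c : ClockFamily d)

/-- A bound for the energy levels. -/
def energyBound : ℝ := ∑ i, |c.energy i|

lemma energyBound_nonneg : 0 ≤ c.energyBound := Finset.sum_nonneg fun _ _ => abs_nonneg _

lemma neg_energy_mem (i : Fin d) : -c.energy i ∈ Set.Icc (-c.energyBound) c.energyBound := by
  rw [Set.mem_Icc, ← abs_le, abs_neg]
  exact Finset.single_le_sum (f := fun i => |c.energy i|) (fun i _ => abs_nonneg _)
    (Finset.mem_univ i)

lemma state_mem_trigSpan (a : Fin d) :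
    (fun t => c.state t a) ∈ trigSpan (Set.Icc (-c.energyBound) c.energyBound) := by
  simp only [c.state_eq, mulVec, dotProduct]
  refine sum_mem_trigSpan _ fun i _ => const_mul_mem_trigSpan _ ?_
  have := const_mul_mem_trigSpan (c.amplitude i) (exp_mem_trigSpan (c.neg_energy_mem i))
  convert this using 2 with t
  rw [mul_comm]
  congr 2
  push_cast
  ring

/-- Each of the `N` kets and `N` bras contributes one `energyBound` to the bandwidth. -/
lemma copies_mem_trigSpan (N : ℕ) (i j : Fin N → Fin d) :
    (fun t => c.copies N t i j) ∈
      trigSpan (Set.Icc (-(2 * N * c.energyBound)) (2 * N * c.energyBound)) := by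
  have h : ∀ i : Fin N → Fin d, (fun t => tensorPow N (c.state t) i) ∈
      trigSpan (Set.Icc (-(N * c.energyBound)) (N * c.energyBound)) := by
    intro i
    have := prod_mem_trigSpan (Finset.univ : Finset (Fin N)) (f := fun k t => c.state t (i k))
      (fun k _ => c.state_mem_trigSpan (i k))
    rw [Finset.card_univ, Fintype.card_fin] at this
    exact this
  have h' := star_mem_trigSpan (G := Set.Icc (-(N * c.energyBound)) (N * c.energyBound))
    (fun x hx => ⟨by linarith [hx.2], by linarith [hx.1]⟩) (h j)
  refine mul_mem_trigSpan ?_ (h i) h'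
  intro x hx y hy
  constructor <;> linarith [hx.1, hx.2, hy.1, hy.2]

lemma trace_mul_copies_mem_trigSpan {N : ℕ} (A : Matrix (Fin N → Fin d) (Fin N → Fin d) ℂ) :
    (fun t => (A * c.copies N t).trace) ∈
      trigSpan (Set.Icc (-(2 * N * c.energyBound)) (2 * N * c.energyBound)) := by
  simp only [trace_mul_eq_sum]
  exact sum_mem_trigSpan _ fun i _ => sum_mem_trigSpan _ fun j _ =>
    const_mul_mem_trigSpan _ (c.copies_mem_trigSpan N j i)

end ClockFamily

namespace Estimator

variable {d : ℕ} (c : ClockFamily d) {N : ℕ} (E : Estimator d N)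

/-- The probability of success for the parameter `t`. -/
def successAt (t : ℝ) : ℝ := (E.total * c.copies N t).trace.re

lemma successAt_eq (t : ℝ) : (E.total * c.copies N t).trace = (E.successAt c t : ℂ) :=
  trace_mul_eq_ofReal (Povm.posSemidef_total E) (c.posSemidef_copies N t)

lemma successAt_nonneg (t : ℝ) : 0 ≤ E.successAt c t :=
  (Complex.nonneg_iff.mp (trace_mul_nonneg (Povm.posSemidef_total E) (c.posSemidef_copies N t))).1

lemma continuous_successAt : Continuous (E.successAt c) :=
  Complex.continuous_re.comp (continuous_of_mem_trigSpan (c.trace_mul_copies_mem_trigSpan E.total))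

lemma success_eq {T : ℝ} (hT : 0 ≤ T) : E.success c (volume.restrict (Set.Icc (-T) T)) =
    ENNReal.ofReal (∫ t in (-T)..T, E.successAt c t) := by
  rw [intervalIntegral.integral_of_le (by linarith), ← integral_Icc_eq_integral_Ioc,
    ofReal_integral_eq_lintegral_ofReal (E.continuous_successAt c).continuousOn.integrableOn_Icc
      (.of_forall (E.successAt_nonneg c)), success]
  exact lintegral_congr fun t => Povm.law_univ E (c.posSemidef_copies N t)

/-- A probability of success that does not vanish identically does not fade away. -/
lemma exists_lt_integral_successAt (h : ∃ T, E.success c (volume.restrict (Set.Icc (-T) T)) ≠ 0)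
    (K : ℝ) : ∃ T₀, ∀ T ≥ T₀, K < ∫ t in (-T)..T, E.successAt c t := by
  have hc := E.continuous_successAt c
  have hmono : ∀ T T', 0 ≤ T → T ≤ T' →
      ∫ t in (-T)..T, E.successAt c t ≤ ∫ t in (-T')..T', E.successAt c t := fun T T' hT hTT' =>
    intervalIntegral.integral_mono_interval (by linarith) (by linarith) hTT'
      (.of_forall (E.successAt_nonneg c)) (hc.intervalIntegrable _ _)
  by_contra! hcon
  -- By monotonicity in `T`, a bound for arbitrarily large `T` is a bound for all `T`. The
  -- probability of success would then be an integrable trigonometric polynomial, hence zero.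
  have hle : ∀ T, 0 ≤ T → ∫ t in (-T)..T, ‖(E.total * c.copies N t).trace‖ ≤ K := by
    intro T hT
    obtain ⟨T', hT', hK⟩ := hcon T
    refine le_trans (le_of_eq ?_) ((hmono T T' hT hT').trans hK)
    refine intervalIntegral.integral_congr fun t _ => ?_
    simp only [successAt_eq, Complex.norm_real, Real.norm_of_nonneg (E.successAt_nonneg c t)]
  have h0 := eq_zero_of_integral_norm_le
    (trigSpan_mono (Set.subset_univ _) (c.trace_mul_copies_mem_trigSpan E.total)) hle
  obtain ⟨T, hT⟩ := h
  refine hT ?_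
  have : ∀ t, E.law (c.copies N t) Set.univ = 0 := fun t => by
    rw [Povm.law_univ E (c.posSemidef_copies N t)]
    have h0t : (E.total * c.copies N t).trace = 0 := congrFun h0 t
    rw [h0t]
    simp
  simp [success, this]

/-- Beyond the bandwidth of the clock, the estimate does not follow the phase. -/
lemma exists_integral_successAt_le {Ω : ℝ} (hΩ : 2 * N * c.energyBound < Ω) :
    ∃ K : ℝ, ∀ T : ℝ, 0 ≤ T → ENNReal.ofReal ((∫ t in (-T)..T, E.successAt c t) - K) ≤
      ∫⁻ t in Set.Icc (-T) T, ∫⁻ s, ENNReal.ofReal (1 - Real.cos (Ω * (s - t)))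
        ∂E.law (c.copies N t) := by
  -- The Fourier coefficient of the measurement at frequency `-Ω`. The mean of `cos (Ω (s - t))`
  -- over the estimates is the real part of `exp (i Ω t) Tr[Q ρ_t]`, and `Tr[Q ρ_t]` is band-limited
  -- below `Ω`, so its integral over `[-T, T]` is bounded in `T`.
  set Q : Matrix (Fin N → Fin d) (Fin N → Fin d) ℂ := Matrix.of fun i j =>
    ∫ s, E.P s i j * Complex.exp (Complex.I * ((-Ω * s : ℝ) : ℂ)) ∂E.base with hQ
  have hexp : ∀ x : ℝ, ‖Complex.exp (Complex.I * (x : ℂ))‖ = 1 := fun x => by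
    rw [mul_comm, Complex.norm_exp_ofReal_mul_I]
  have hi : ∀ i j, Integrable
      (fun s => E.P s i j * Complex.exp (Complex.I * ((-Ω * s : ℝ) : ℂ))) E.base := fun i j =>
    (E.integrable_P i j).mul_bdd (c := 1) (Continuous.aestronglyMeasurable (by fun_prop))
      (.of_forall fun s => (hexp _).le)
  have hf := c.trace_mul_copies_mem_trigSpan Q
  obtain ⟨K, hK⟩ := exists_norm_integral_exp_mul_le hf (Ω := Ω) (fun h => by linarith [h.1])
  refine ⟨K, fun T hT => ?_⟩
  set f : ℝ → ℂ := fun t => Complex.exp (Complex.I * ((Ω * t : ℝ) : ℂ)) *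
    (Q * c.copies N t).trace with hfdef
  have hfc : Continuous f := by
    have := continuous_of_mem_trigSpan hf
    fun_prop
  have hpt : ∀ t, ENNReal.ofReal (E.successAt c t - (f t).re) ≤
      ∫⁻ s, ENNReal.ofReal (1 - Real.cos (Ω * (s - t))) ∂E.law (c.copies N t) := by
    intro t
    have := E.isFiniteMeasure_law c t
    have hρ := c.posSemidef_copies N t
    have hb : Integrable (fun s => Real.cos (Ω * (s - t))) (E.law (c.copies N t)) :=
      Integrable.of_bound (C := 1) (by fun_prop) (.of_forall fun s => Real.abs_cos_le_one _)
    have hcos : ∫ s, Real.cos (Ω * (s - t)) ∂E.law (c.copies N t) = (f t).re := by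
      have e : ∫ s, Complex.exp (Complex.I * ((Ω * (t - s) : ℝ) : ℂ)) ∂E.law (c.copies N t) =
          f t := by
        rw [E.integral_law hρ, hfdef]
        simp only [trace_mul_eq_sum, hQ, of_apply, Finset.mul_sum, Finset.sum_mul]
        have e1 : ∀ i j s, E.P s i j * c.copies N t j i *
            Complex.exp (Complex.I * ((Ω * (t - s) : ℝ) : ℂ)) =
            (Complex.exp (Complex.I * ((Ω * t : ℝ) : ℂ)) * c.copies N t j i) *
            (E.P s i j * Complex.exp (Complex.I * ((-Ω * s : ℝ) : ℂ))) := fun i j s => by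
          have : Complex.exp (Complex.I * ((Ω * (t - s) : ℝ) : ℂ)) =
              Complex.exp (Complex.I * ((Ω * t : ℝ) : ℂ)) *
                Complex.exp (Complex.I * ((-Ω * s : ℝ) : ℂ)) := by
            rw [← Complex.exp_add]
            push_cast
            ring_nf
          rw [this]
          ring
        simp only [e1]
        rw [integral_finsetSum _ fun i _ => integrable_finsetSum _ fun j _ =>
          (hi i j).const_mul _]
        refine Finset.sum_congr rfl fun i _ => ?_
        rw [integral_finsetSum _ fun j _ => (hi i j).const_mul _]
        refine Finset.sum_congr rfl fun j _ => ?_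
        rw [integral_const_mul]
        ring
      rw [← e]
      have hint : Integrable (fun s => Complex.exp (Complex.I * ((Ω * (t - s) : ℝ) : ℂ)))
          (E.law (c.copies N t)) :=
        Integrable.of_bound (C := 1) (Continuous.aestronglyMeasurable (by fun_prop))
          (.of_forall fun s => (hexp _).le)
      refine Eq.trans (integral_congr_ae (.of_forall fun s => ?_)) (integral_re hint)
      simp only [RCLike.re_to_complex, mul_comm Complex.I, Complex.exp_ofReal_mul_I_re]
      rw [← Real.cos_neg]
      congr 1
      ring
    have hmass : (E.law (c.copies N t)).real Set.univ = E.successAt c t := by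
      rw [measureReal_def, Povm.law_univ E hρ]
      exact ENNReal.toReal_ofReal (E.successAt_nonneg c t)
    have hI : Integrable (fun s => 1 - Real.cos (Ω * (s - t))) (E.law (c.copies N t)) :=
      (integrable_const 1).sub hb
    rw [← ofReal_integral_eq_lintegral_ofReal hI
      (.of_forall fun s => sub_nonneg.mpr (Real.cos_le_one _)), integral_sub (integrable_const 1) hb,
      hcos, integral_const, hmass, smul_eq_mul, mul_one]
  have hcont : Continuous fun t => E.successAt c t - (f t).re := by
    have := E.continuous_successAt c
    fun_prop
  calc ENNReal.ofReal ((∫ t in (-T)..T, E.successAt c t) - K)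
      ≤ ENNReal.ofReal (∫ t in (-T)..T, (E.successAt c t - (f t).re)) := by
        refine ENNReal.ofReal_le_ofReal ?_
        have hre : Continuous fun t => (f t).re := Complex.continuous_re.comp hfc
        rw [intervalIntegral.integral_sub ((E.continuous_successAt c).intervalIntegrable _ _)
          (hre.intervalIntegrable _ _)]
        have : ∫ t in (-T)..T, (f t).re = (∫ t in (-T)..T, f t).re := by
          rw [intervalIntegral.integral_of_le (by linarith),
            intervalIntegral.integral_of_le (by linarith)]
          have hIcc : IntegrableOn f (Set.Icc (-T) T) := hfc.continuousOn.integrableOn_Icc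
          exact integral_re (𝕜 := ℂ) (hIcc.mono_set Set.Ioc_subset_Icc_self)
        rw [this]
        exact sub_le_sub_left ((Complex.re_le_norm _).trans (hK T)) _
    _ ≤ ∫⁻ t in Set.Icc (-T) T, ENNReal.ofReal (E.successAt c t - (f t).re) := by
        rw [intervalIntegral.integral_of_le (by linarith), ← integral_Icc_eq_integral_Ioc]
        exact ofReal_integral_le_lintegral hcont.continuousOn.integrableOn_Icc
    _ ≤ _ := lintegral_mono fun t => hpt t

/-- The mean infidelity of a probabilistic estimator is of order at least `1/N²`. -/
lemma exists_le_of_bounded : ∃ κ : ℝ, 0 < κ ∧ ∀ N : ℕ, 0 < N → ∀ (a : Aggregate)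
    (E : Estimator d N) (e : ℝ), a.Bounded (E.error c .infidelity) (ENNReal.ofReal e) →
      κ / (N : ℝ) ^ 2 ≤ e := by
  obtain ⟨κ, ω, hκ, hω, hle⟩ := c.exists_le_infidelity
  -- Chosen so that the harmonic `L` below satisfies `L ≤ B * N`; the summand `1` absorbs the
  -- rounding, as `N ≥ 1`.
  set B := 2 * c.energyBound / ω + 1 with hB
  have hB0 : 0 < B := by
    have := c.energyBound_nonneg
    positivity
  refine ⟨κ / B ^ 2, by positivity, fun N hN a E e h => ?_⟩
  have hN1 : (1 : ℝ) ≤ N := by exact_mod_cast hN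
  -- The first harmonic of `ω` strictly beyond the bandwidth.
  set L := ⌊2 * N * c.energyBound / ω⌋₊ + 1 with hL
  have hR := c.energyBound_nonneg
  have hx : 0 ≤ 2 * N * c.energyBound / ω := by positivity
  have hL1 : 2 * N * c.energyBound < L * ω := by
    rw [← div_lt_iff₀ hω, hL]
    push_cast
    exact Nat.lt_floor_add_one _
  have hL2 : (L : ℝ) ≤ B * N := by
    rw [hL, hB]
    push_cast
    have := Nat.floor_le hx
    have e : (2 * c.energyBound / ω + 1) * N = 2 * N * c.energyBound / ω + N := by ring
    rw [e]
    linarith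
  obtain ⟨K, hK⟩ := E.exists_integral_successAt_le c hL1
  have hcost : ∀ s t, ENNReal.ofReal (1 - Real.cos (L * ω * (s - t))) ≤
      ENNReal.ofReal ((L : ℝ) ^ 2 / κ) * Loss.infidelity.cost c s t := by
    intro s t
    rw [c.cost_infidelity, ← ENNReal.ofReal_mul (by positivity)]
    refine ENNReal.ofReal_le_ofReal ?_
    rw [mul_assoc]
    refine (one_sub_cos_natCast_mul_le L _).trans ?_
    rw [div_mul_eq_mul_div, mul_div_assoc]
    refine mul_le_mul_of_nonneg_left ?_ (by positivity)
    rw [le_div_iff₀ hκ, mul_comm]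
    exact hle _
  have hev := eventually_lintegral_risk_le c h
  have hmain : ∀ᶠ T : ℝ in atTop, ENNReal.ofReal ((∫ t in (-T)..T, E.successAt c t) - K) ≤
      ENNReal.ofReal ((L : ℝ) ^ 2 / κ) *
        (ENNReal.ofReal e * ENNReal.ofReal (∫ t in (-T)..T, E.successAt c t)) := by
    filter_upwards [hev, eventually_ge_atTop 0] with T hT hT0
    refine (hK T hT0).trans ?_
    rw [← E.success_eq c hT0]
    refine le_trans ?_ (mul_le_mul_right hT.2 _)
    rw [← lintegral_const_mul' _ _ ENNReal.ofReal_ne_top]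
    refine lintegral_mono fun t => ?_
    rw [risk, ← lintegral_const_mul' _ _ ENNReal.ofReal_ne_top]
    exact lintegral_mono fun s => hcost s t
  have hex : ∃ T, E.success c (volume.restrict (Set.Icc (-T) T)) ≠ 0 := by
    obtain ⟨T, hT⟩ := hev.exists
    exact ⟨T, hT.1⟩
  have hunb := E.exists_lt_integral_successAt c hex
  by_contra! hlt
  -- The assumption `e < κ / (B N) ^ 2` makes this product `q` less than one; the maximum covers
  -- negative `e`, for which `ENNReal.ofReal e` is `0`.
  have he' : (L : ℝ) ^ 2 / κ * max e 0 < 1 := by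
    rcases le_total e 0 with he | he
    · simp [max_eq_right he]
    · rw [max_eq_left he, div_mul_eq_mul_div, div_lt_one hκ]
      rw [div_div, lt_div_iff₀ (by positivity), ← mul_pow] at hlt
      refine lt_of_le_of_lt ?_ hlt
      rw [mul_comm]
      exact mul_le_mul_of_nonneg_left (pow_le_pow_left₀ (by positivity) hL2 2) he
  set q := (L : ℝ) ^ 2 / κ * max e 0 with hq
  -- The bound reads `S - K ≤ q * S` for the integrated success `S`, which fails once `S` exceeds
  -- `|K| / (1 - q)`.
  obtain ⟨T₀, hT₀⟩ := hunb (|K| / (1 - q))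
  obtain ⟨T, hT, hTT⟩ := (hmain.and (eventually_ge_atTop T₀)).exists
  have hS := hT₀ T hTT
  set S := ∫ t in (-T)..T, E.successAt c t
  have hmax : ENNReal.ofReal e = ENNReal.ofReal (max e 0) := by
    rcases le_total e 0 with he | he
    · simp [max_eq_right he, ENNReal.ofReal_of_nonpos he]
    · rw [max_eq_left he]
  have hS0 : 0 ≤ S := le_trans (by have := sub_pos.mpr he'; positivity) hS.le
  rw [hmax, ← ENNReal.ofReal_mul (le_max_right _ _), ← ENNReal.ofReal_mul (by positivity),
    ENNReal.ofReal_le_ofReal_iff (by positivity), ← mul_assoc, ← hq] at hT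
  rw [div_lt_iff₀ (sub_pos.mpr he')] at hS
  nlinarith [le_abs_self K]

lemma not_errorScaling {a : Aggregate} {ℓ : Loss} {ε : ℝ} (hε : 0 < ε)
    (E : ∀ N, Estimator d N) : ¬ ErrorScaling (fun N => a.ofError ((E N).error c ℓ)) (2 + ε) := by
  intro h
  obtain ⟨K, hK⟩ := bounded_of_errorScaling c h
  obtain ⟨κ, hκ, hle⟩ := exists_le_of_bounded c
  refine not_eventually_div_rpow_le (κ := κ) (K := K) (α := 2) (β := 2 + ε) hκ (by linarith) ?_
  filter_upwards [hK, eventually_gt_atTop 0] with N h1 h2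
  have := hle N h2 a (E N) _ h1
  exact_mod_cast this

end Estimator

/-! ### Moments of the uniform pure state -/

section Haar

variable {ι : Type} [Fintype ι] [DecidableEq ι]

instance : SecondCountableTopology (Gate ι) :=
  TopologicalSpace.Subtype.secondCountableTopology (Matrix.unitaryGroup ι ℂ : Set (Matrix ι ι ℂ))

instance : (haar ι).IsHaarMeasure := by
  unfold haar
  infer_instance

instance : IsProbabilityMeasure (haar ι) :=
  ⟨Measure.haarMeasure_self (K₀ := (⊤ : TopologicalSpace.PositiveCompacts (Gate ι)))⟩

lemma integrable_haar {f : Gate ι → ℂ} (hf : Continuous f) : Integrable f (haar ι) :=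
  hf.integrable_of_hasCompactSupport (HasCompactSupport.of_compactSpace f)

lemma continuous_gate_apply (i j : ι) : Continuous fun V : Gate ι => (V : Matrix ι ι ℂ) i j :=
  continuous_subtype_val.matrix_elem i j

lemma star_mulVec_dotProduct_of_mem {U : Matrix ι ι ℂ} (hU : Uᴴ * U = 1) (v w : ι → ℂ) :
    star (U *ᵥ v) ⬝ᵥ U *ᵥ w = star v ⬝ᵥ w := by
  rw [star_mulVec, dotProduct_mulVec, vecMul_vecMul, hU, vecMul_one]

lemma conjTranspose_mul_gate (U : Gate ι) :
    (U : Matrix ι ι ℂ)ᴴ * (U : Matrix ι ι ℂ) = 1 := Unitary.coe_star_mul_self U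

variable [Nonempty ι]

/-- The uniformly distributed pure state. -/
def pureState (V : Gate ι) : ι → ℂ := (V : Matrix ι ι ℂ) *ᵥ Pi.single (Classical.arbitrary ι) 1

lemma pureState_apply (V : Gate ι) (i : ι) :
    pureState V i = (V : Matrix ι ι ℂ) i (Classical.arbitrary ι) := by
  simp [pureState]

lemma pureState_mul (U V : Gate ι) : pureState (U * V) = (U : Matrix ι ι ℂ) *ᵥ pureState V := by
  rw [pureState, pureState, mulVec_mulVec]
  rfl

lemma continuous_pureState_apply (i : ι) : Continuous fun V : Gate ι => pureState V i := by
  simp only [pureState_apply]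
  exact continuous_gate_apply i _

lemma continuous_pureState : Continuous fun V : Gate ι => pureState V :=
  continuous_pi continuous_pureState_apply

lemma pureState_unit (V : Gate ι) : star (pureState V) ⬝ᵥ pureState V = 1 := by
  rw [pureState, star_mulVec_dotProduct_of_mem (conjTranspose_mul_gate V)]
  simp

/-- The second moments of the uniform pure state. -/
def moment (a b c e : ι) : ℂ :=
  ∫ V : Gate ι, star (pureState V a) * pureState V b * pureState V c * star (pureState V e) ∂haar ι

lemma integrable_moment (a b c e : ι) : Integrable (fun V : Gate ι =>
    star (pureState V a) * pureState V b * pureState V c * star (pureState V e)) (haar ι) := by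
  have := continuous_pureState_apply (ι := ι)
  refine integrable_haar ?_
  fun_prop

/-- Left invariance of the Haar measure: applying `U` to the random state does not change its
moments. -/
lemma moment_eq_sum (U : Gate ι) (a b c e : ι) : moment a b c e =
    ∑ i, ∑ j, ∑ k, ∑ l, (star ((U : Matrix ι ι ℂ) a i) * (U : Matrix ι ι ℂ) b j *
      (U : Matrix ι ι ℂ) c k * star ((U : Matrix ι ι ℂ) e l)) * moment i j k l := by
  have h := integral_mul_left_eq_self (μ := haar ι) (fun V : Gate ι =>
    star (pureState V a) * pureState V b * pureState V c * star (pureState V e)) U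
  rw [moment, ← h]
  have e1 : ∀ V : Gate ι, star (pureState (U * V) a) * pureState (U * V) b *
      pureState (U * V) c * star (pureState (U * V) e) =
      ∑ i, ∑ j, ∑ k, ∑ l, (star ((U : Matrix ι ι ℂ) a i) * (U : Matrix ι ι ℂ) b j *
        (U : Matrix ι ι ℂ) c k * star ((U : Matrix ι ι ℂ) e l)) *
        (star (pureState V i) * pureState V j * pureState V k * star (pureState V l)) := by
    intro V
    simp only [pureState_mul, mulVec, dotProduct, star_sum]
    rw [Finset.sum_mul_sum, Finset.sum_mul, Finset.sum_mul]
    refine Finset.sum_congr rfl fun i _ => ?_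
    rw [Finset.sum_mul, Finset.sum_mul]
    refine Finset.sum_congr rfl fun j _ => ?_
    rw [mul_assoc, Finset.sum_mul_sum, Finset.mul_sum]
    refine Finset.sum_congr rfl fun k _ => ?_
    rw [Finset.mul_sum]
    refine Finset.sum_congr rfl fun l _ => ?_
    rw [star_mul', star_mul']
    ring
  have hi : ∀ i j k l, Integrable (fun V : Gate ι => (star ((U : Matrix ι ι ℂ) a i) *
      (U : Matrix ι ι ℂ) b j * (U : Matrix ι ι ℂ) c k * star ((U : Matrix ι ι ℂ) e l)) *
        (star (pureState V i) * pureState V j * pureState V k * star (pureState V l))) (haar ι) :=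
    fun i j k l => (integrable_moment i j k l).const_mul _
  simp only [e1]
  rw [integral_finsetSum _ fun i _ => integrable_finsetSum _ fun j _ => integrable_finsetSum _
    fun k _ => integrable_finsetSum _ fun l _ => hi i j k l]
  refine Finset.sum_congr rfl fun i _ => ?_
  rw [integral_finsetSum _ fun j _ => integrable_finsetSum _
    fun k _ => integrable_finsetSum _ fun l _ => hi i j k l]
  refine Finset.sum_congr rfl fun j _ => ?_
  rw [integral_finsetSum _ fun k _ => integrable_finsetSum _ fun l _ => hi i j k l]
  refine Finset.sum_congr rfl fun k _ => ?_
  rw [integral_finsetSum _ fun l _ => hi i j k l]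
  refine Finset.sum_congr rfl fun l _ => ?_
  rw [integral_const_mul, moment]

/-- The gate that multiplies one amplitude by `i`. -/
def quarterPhase (x : ι) : Gate ι :=
  ⟨diagonal fun i => if i = x then Complex.I else 1, by
    rw [Matrix.mem_unitaryGroup_iff, Matrix.star_eq_conjTranspose, Matrix.diagonal_conjTranspose,
      Matrix.diagonal_mul_diagonal, ← Matrix.diagonal_one]
    congr 1
    funext i
    by_cases h : i = x <;> simp [h]⟩

lemma moment_eq_quarterPhase_mul (x a b c e : ι) : moment a b c e =
    (star (if a = x then Complex.I else 1) * (if b = x then Complex.I else 1) *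
      (if c = x then Complex.I else 1) * star (if e = x then Complex.I else 1)) *
      moment a b c e := by
  have h := integral_mul_left_eq_self (μ := haar ι) (fun V : Gate ι =>
    star (pureState V a) * pureState V b * pureState V c * star (pureState V e)) (quarterPhase x)
  conv_lhs => rw [moment, ← h]
  rw [moment, ← integral_const_mul]
  refine integral_congr_ae (.of_forall fun V => ?_)
  simp only [pureState_mul, quarterPhase, mulVec_diagonal, star_mul']
  ring

/-- Invariance under `quarterPhase x` multiplies the moment by `i` to the difference between the
numbers of unconjugated and conjugated indices equal to `x`. This difference lies between `-2` and
`2`, and the phase `i`, unlike `-1`, detects each nonzero value. -/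
lemma moment_eq_zero {a b c e : ι} (h : ¬ (a = b ∧ c = e)) (h' : ¬ (a = c ∧ b = e)) :
    moment a b c e = 0 := by
  have key : ∀ x z, (star (if a = x then Complex.I else 1) * (if b = x then Complex.I else 1) *
      (if c = x then Complex.I else 1) * star (if e = x then Complex.I else 1)) = z → z ≠ 1 →
      moment a b c e = 0 := by
    intro x z hz hz1
    have := moment_eq_quarterPhase_mul x a b c e
    rw [hz] at this
    have h0 : (z - 1) * moment a b c e = 0 := by rw [sub_mul, one_mul, ← this, sub_self]
    exact (mul_eq_zero.mp h0).resolve_left (sub_ne_zero.mpr hz1)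
  have hI : Complex.I ≠ 1 := fun h => by simpa using congrArg Complex.re h
  have hI' : -Complex.I ≠ 1 := fun h => by simpa using congrArg Complex.re h
  have hI2 : (-1 : ℂ) ≠ 1 := by norm_num
  by_cases hab : a = b
  · subst hab
    have hce : e ≠ c := fun he => h ⟨rfl, he.symm⟩
    refine key c Complex.I ?_ hI
    by_cases hac : a = c <;> simp [hac, hce]
  · by_cases hac : a = c
    · subst hac
      have hbe : e ≠ b := fun he => h' ⟨rfl, he.symm⟩
      refine key b Complex.I ?_ hI
      simp [hab, hbe]
    · have hba : ¬ b = a := fun h => hab h.symm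
      have hca : ¬ c = a := fun h => hac h.symm
      by_cases hea : e = a
      · exact key a (-1) (by simp [hba, hca, hea]) hI2
      · exact key a (-Complex.I) (by simp [hba, hca, hea]) hI'

/-- `E |ψ_a|² |ψ_b|²`. -/
def popMoment (a b : ι) : ℂ := moment a a b b

lemma popMoment_comm (a b : ι) : popMoment a b = popMoment b a := by
  refine integral_congr_ae (.of_forall fun V => ?_)
  simp only
  ring

/-- Inclusion–exclusion over the two pairings of conjugated with unconjugated indices; they coincide
when all four indices agree. -/
lemma moment_eq (a b c e : ι) : moment a b c e =
    (if a = b ∧ c = e then popMoment a c else 0) +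
      (if a = c ∧ b = e then popMoment a b else 0) -
        (if a = b ∧ c = e ∧ a = c then popMoment a a else 0) := by
  by_cases h1 : a = b ∧ c = e
  · obtain ⟨rfl, rfl⟩ := h1
    by_cases h : a = c
    · subst h
      simp [popMoment]
    · simp [popMoment, h]
  · by_cases h2 : a = c ∧ b = e
    · obtain ⟨rfl, rfl⟩ := h2
      have hab : a ≠ b := fun h => h1 ⟨h, h⟩
      simp only [hab, false_and, if_false, and_self, if_true, zero_add, sub_zero]
      refine integral_congr_ae (.of_forall fun V => ?_)
      simp only
      ring
    · rw [moment_eq_zero h1 h2, if_neg h1, if_neg h2, if_neg fun h => h1 ⟨h.1, h.2.1⟩]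
      simp

lemma popMoment_self_eq_sum (U : Gate ι) (a : ι) : popMoment a a =
    2 * (∑ i, ∑ j, (star ((U : Matrix ι ι ℂ) a i) * (U : Matrix ι ι ℂ) a i) *
      (star ((U : Matrix ι ι ℂ) a j) * (U : Matrix ι ι ℂ) a j) * popMoment i j) -
    ∑ i, (star ((U : Matrix ι ι ℂ) a i) * (U : Matrix ι ι ℂ) a i) ^ 2 * popMoment i i := by
  rw [popMoment, moment_eq_sum U]
  simp only [moment_eq, mul_add, mul_sub, Finset.sum_add_distrib, Finset.sum_sub_distrib, ite_and,
    mul_ite, mul_zero, Finset.sum_ite_eq, Finset.mem_univ, if_true, Finset.sum_ite_irrel,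
    Finset.sum_const_zero, two_mul]
  congr 1
  · congr 1
    · refine Finset.sum_congr rfl fun i _ => Finset.sum_congr rfl fun j _ => ?_
      ring
    · refine Finset.sum_congr rfl fun i _ => Finset.sum_congr rfl fun j _ => ?_
      ring
  · refine Finset.sum_congr rfl fun i _ => ?_
    ring

/-- The reflection in the vector `e_a + 2 e_b`. -/
def reflection {a b : ι} (hab : a ≠ b) : Gate ι :=
  ⟨1 - (2 / 5 : ℂ) • vecMulVec (Pi.single a 1 + Pi.single b 2) (Pi.single a 1 + Pi.single b 2), by
    set w : ι → ℂ := Pi.single a 1 + Pi.single b 2 with hw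
    have hs : star w = w := by
      rw [hw, star_add, Pi.star_single, Pi.star_single]
      simp
    have hww : w ⬝ᵥ w = 5 := by
      simp [hw, dotProduct_add, hab, hab.symm]
      norm_num
    rw [Matrix.mem_unitaryGroup_iff, Matrix.star_eq_conjTranspose, conjTranspose_sub,
      conjTranspose_one, conjTranspose_smul, conjTranspose_vecMulVec, hs]
    have h25 : star (2 / 5 : ℂ) = 2 / 5 := by simp
    have hA : vecMulVec w w * vecMulVec w w = (5 : ℂ) • vecMulVec w w := by
      rw [vecMulVec_mul_vecMulVec, hww]
      ext i j
      simp [vecMulVec_apply]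
      ring
    rw [h25, mul_sub, sub_mul, sub_mul, Matrix.mul_one, Matrix.mul_one, Matrix.one_mul,
      Matrix.smul_mul, Matrix.mul_smul, hA]
    module⟩

/-- Row `a` of the reflection is `(3/5, -4/5)` on the two indices; the Pythagorean triple keeps
every coefficient rational. -/
lemma reflection_apply {a b : ι} (hab : a ≠ b) (i : ι) :
    star ((reflection hab : Matrix ι ι ℂ) a i) * (reflection hab : Matrix ι ι ℂ) a i =
      (if i = a then 9 / 25 else 0) + if i = b then 16 / 25 else 0 := by
  have e : (reflection hab : Matrix ι ι ℂ) a i =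
      (if i = a then 3 / 5 else 0) - if i = b then 4 / 5 else 0 := by
    simp only [reflection, Matrix.sub_apply, one_apply, Matrix.smul_apply, vecMulVec_apply, Pi.add_apply,
      Pi.single_eq_same, Pi.single_eq_of_ne hab, Pi.single_apply, smul_eq_mul]
    by_cases hia : i = a
    · subst hia
      simp [hab]
      norm_num
    · by_cases hib : i = b
      · subst hib
        simp [hab, hab.symm]
        norm_num
      · simp [hia, hib, Ne.symm hia]
  rw [e]
  by_cases hia : i = a
  · subst hia
    simp [hab]
    norm_num
  · by_cases hib : i = b
    · subst hib
      simp [hab.symm]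
      norm_num
    · simp [hia, hib]

/-- Invariance under the reflection, multiplied by `25 ^ 2`: `81 = 9²`, `256 = 16²`, and `576 = 4 ·
9 · 16` from both pairings and both orders. -/
lemma popMoment_relation {a b : ι} (hab : a ≠ b) : 625 * popMoment a a =
    81 * popMoment a a + 256 * popMoment b b + 576 * popMoment a b := by
  have h := popMoment_self_eq_sum (reflection hab) a
  simp only [reflection_apply, add_mul, mul_add, add_sq, Finset.sum_add_distrib, ite_mul, mul_ite,
    zero_mul, mul_zero, Finset.sum_ite_eq', Finset.mem_univ, if_true, ite_pow,
    if_neg hab.symm, popMoment_comm b a] at h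
  norm_num at h
  linear_combination 625 * h

/-- The relation and its mirror image determine the three moments of a pair up to scale. -/
lemma popMoment_self {a b : ι} (hab : a ≠ b) :
    popMoment a a = popMoment b b ∧ popMoment a a = 2 * popMoment a b := by
  have h1 := popMoment_relation hab
  have h2 := popMoment_relation hab.symm
  rw [popMoment_comm b a] at h2
  constructor
  · linear_combination (1 / 800) * h1 - (1 / 800) * h2
  · linear_combination (1 / 288) * h1 - (1 / 900) * (h1 - h2)

lemma sum_popMoment : ∑ a : ι, ∑ b : ι, popMoment a b = 1 := by
  have e : ∀ V : Gate ι, ∑ a : ι, ∑ b : ι,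
      star (pureState V a) * pureState V a * pureState V b * star (pureState V b) = 1 := by
    intro V
    have h := pureState_unit V
    rw [dotProduct] at h
    calc _ = (∑ a : ι, star (pureState V a) * pureState V a) *
          ∑ b : ι, star (pureState V b) * pureState V b := by
          rw [Finset.sum_mul_sum]
          exact Finset.sum_congr rfl fun a _ => Finset.sum_congr rfl fun b _ => by ring
      _ = 1 := by
          simp only [Pi.star_apply] at h
          rw [h, one_mul]
  have hI : ∫ V : Gate ι, (∑ a : ι, ∑ b : ι, star (pureState V a) * pureState V a *
      pureState V b * star (pureState V b)) ∂haar ι = 1 := by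
    simp only [e]
    simp
  rw [integral_finsetSum _ fun a _ => integrable_finsetSum _ fun b _ =>
    integrable_moment a a b b] at hI
  rw [← hI]
  refine Finset.sum_congr rfl fun a _ => ?_
  rw [integral_finsetSum _ fun b _ => integrable_moment a a b b]
  rfl

/-- All diagonal moments agree and are twice the off-diagonal ones; normalization fixes the scale.
In dimension one only the normalization is used. -/
lemma popMoment_eq (a b : ι) : popMoment a b =
    (1 + if a = b then 1 else 0) / ((Fintype.card ι : ℂ) * (Fintype.card ι + 1)) := by
  set A := popMoment (Classical.arbitrary ι) (Classical.arbitrary ι) with hA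
  have hself : ∀ a : ι, popMoment a a = A := fun a => by
    by_cases h : a = Classical.arbitrary ι
    · rw [h]
    · exact (popMoment_self h).1
  have hab : ∀ a b : ι, popMoment a b = A / 2 * (1 + if a = b then 1 else 0) := by
    intro a b
    by_cases h : a = b
    · subst h
      rw [hself, if_pos rfl]
      ring
    · have := (popMoment_self h).2
      rw [hself] at this
      rw [if_neg h, this]
      ring
  have hs := sum_popMoment (ι := ι)
  simp only [hab, mul_add, mul_ite, mul_zero, mul_one, Finset.sum_add_distrib, Finset.sum_ite_eq,
    Finset.mem_univ, if_true, Finset.sum_const, Finset.card_univ, nsmul_eq_mul] at hs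
  have hD : (Fintype.card ι : ℂ) * (Fintype.card ι + 1) ≠ 0 := by
    have : (Fintype.card ι : ℂ) ≠ 0 := by exact_mod_cast Fintype.card_ne_zero
    exact mul_ne_zero this (by exact_mod_cast Nat.succ_ne_zero (Fintype.card ι))
  rw [hab, eq_div_iff hD]
  linear_combination (1 + if a = b then (1 : ℂ) else 0) * hs

lemma moment_eq_card (a b c e : ι) : moment a b c e =
    ((if a = b ∧ c = e then 1 else 0) + if a = c ∧ b = e then 1 else 0) /
      ((Fintype.card ι : ℂ) * (Fintype.card ι + 1)) := by
  rw [moment_eq]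
  by_cases h1 : a = b ∧ c = e
  · obtain ⟨rfl, rfl⟩ := h1
    by_cases h : a = c
    · subst h
      simp [popMoment_eq]
    · simp [popMoment_eq, h]
  · have h3 : ¬ (a = b ∧ c = e ∧ a = c) := fun h => h1 ⟨h.1, h.2.1⟩
    rw [if_neg h1, if_neg h1, if_neg h3]
    by_cases h2 : a = c ∧ b = e
    · obtain ⟨rfl, rfl⟩ := h2
      have hab : a ≠ b := fun h => h1 ⟨h, h⟩
      simp [popMoment_eq, hab]
    · simp [h2]

/-- The average of `|⟨ψ|W|ψ⟩|²` over uniform pure states. -/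
lemma integral_norm_sq_pureState (W : Matrix ι ι ℂ) :
    ((∫ V : Gate ι, ‖star (pureState V) ⬝ᵥ W *ᵥ pureState V‖ ^ 2 ∂haar ι : ℝ) : ℂ) =
      (((‖W.trace‖ ^ 2 + ∑ i, ∑ j, ‖W i j‖ ^ 2) /
        ((Fintype.card ι : ℝ) * (Fintype.card ι + 1)) : ℝ) : ℂ) := by
  rw [← integral_complex_ofReal]
  have e : ∀ V : Gate ι, ((‖star (pureState V) ⬝ᵥ W *ᵥ pureState V‖ ^ 2 : ℝ) : ℂ) =
      ∑ a, ∑ b, ∑ c, ∑ e, (W a b * star (W c e)) *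
        (star (pureState V a) * pureState V b * pureState V c * star (pureState V e)) := by
    intro V
    rw [Complex.ofReal_pow, ← Complex.mul_conj', starRingEnd_apply]
    have hz : star (pureState V) ⬝ᵥ W *ᵥ pureState V =
        ∑ a, ∑ b, star (pureState V a) * (W a b * pureState V b) := by
      simp only [dotProduct, mulVec, Pi.star_apply, Finset.mul_sum]
    rw [hz, star_sum, Finset.sum_mul]
    refine Finset.sum_congr rfl fun a _ => ?_
    rw [Finset.sum_mul]
    refine Finset.sum_congr rfl fun b _ => ?_
    rw [Finset.mul_sum]
    refine Finset.sum_congr rfl fun c _ => ?_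
    rw [star_sum, Finset.mul_sum]
    refine Finset.sum_congr rfl fun e _ => ?_
    rw [star_mul', star_mul', star_star]
    ring
  have hi : ∀ a b c e, Integrable (fun V : Gate ι => (W a b * star (W c e)) *
        (star (pureState V a) * pureState V b * pureState V c * star (pureState V e))) (haar ι) :=
    fun a b c e => (integrable_moment a b c e).const_mul _
  simp only [e]
  have hsum : ∫ V : Gate ι, (∑ a, ∑ b, ∑ c, ∑ e, (W a b * star (W c e)) *
        (star (pureState V a) * pureState V b * pureState V c * star (pureState V e))) ∂haar ι =
      ∑ a, ∑ b, ∑ c, ∑ e, (W a b * star (W c e)) * moment a b c e := by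
    rw [integral_finsetSum _ fun i _ => integrable_finsetSum _ fun j _ => integrable_finsetSum _
      fun k _ => integrable_finsetSum _ fun l _ => hi i j k l]
    refine Finset.sum_congr rfl fun i _ => ?_
    rw [integral_finsetSum _ fun j _ => integrable_finsetSum _
      fun k _ => integrable_finsetSum _ fun l _ => hi i j k l]
    refine Finset.sum_congr rfl fun j _ => ?_
    rw [integral_finsetSum _ fun k _ => integrable_finsetSum _ fun l _ => hi i j k l]
    refine Finset.sum_congr rfl fun k _ => ?_
    rw [integral_finsetSum _ fun l _ => hi i j k l]
    refine Finset.sum_congr rfl fun l _ => ?_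
    rw [integral_const_mul, moment]
  rw [hsum]
  simp only [moment_eq_card, mul_div_assoc', ← Finset.sum_div, mul_add, Finset.sum_add_distrib,
    ite_and, mul_ite, mul_zero, mul_one, Finset.sum_ite_eq, Finset.mem_univ, if_true,
    Finset.sum_ite_irrel, Finset.sum_const_zero]
  push_cast
  congr 2
  · rw [← Complex.mul_conj', starRingEnd_apply, Matrix.trace, star_sum, Finset.sum_mul_sum]
    rfl
  · refine Finset.sum_congr rfl fun a _ => Finset.sum_congr rfl fun b _ => ?_
    rw [← Complex.mul_conj']
    rfl

/-- This is the trace of `Wᴴ * W`. -/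
lemma sum_norm_sq_of_unitary {W : Matrix ι ι ℂ} (hW : Wᴴ * W = 1) :
    ∑ i, ∑ j, ‖W i j‖ ^ 2 = Fintype.card ι := by
  have h := congrArg Matrix.trace hW
  rw [trace_one, trace_mul_eq_sum] at h
  have : ((∑ i, ∑ j, ‖W i j‖ ^ 2 : ℝ) : ℂ) = (Fintype.card ι : ℂ) := by
    rw [← h, Finset.sum_comm]
    push_cast
    refine Finset.sum_congr rfl fun a _ => Finset.sum_congr rfl fun b _ => ?_
    rw [← Complex.conj_mul', conjTranspose_apply]
    rfl
  exact_mod_cast this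

/-- The average gate fidelity in terms of the entanglement fidelity. -/
lemma gateFidelity_eq {U V : Matrix ι ι ℂ} (hW : (Uᴴ * V)ᴴ * (Uᴴ * V) = 1) :
    gateFidelity V U = ENNReal.ofReal ((‖(Uᴴ * V).trace‖ ^ 2 + Fintype.card ι) /
        ((Fintype.card ι : ℝ) * (Fintype.card ι + 1))) := by
  rw [gateFidelity, pureStateAverage]
  have h := integral_norm_sq_pureState (Uᴴ * V)
  rw [sum_norm_sq_of_unitary hW, Complex.ofReal_inj] at h
  rw [← h, ofReal_integral_eq_lintegral_ofReal _ (.of_forall fun V => sq_nonneg _)]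
  · rfl
  · refine Continuous.integrable_of_hasCompactSupport ?_ (HasCompactSupport.of_compactSpace _)
    have := continuous_pureState (ι := ι)
    fun_prop

end Haar

/-! ### The measure-and-prepare network -/

/-! ### Tensor powers of gates -/

section GatePow

variable {d : ℕ} (M : ℕ)

lemma gatePow_mul (A B : Matrix (Fin d) (Fin d) ℂ) :
    gatePow M (A * B) = gatePow M A * gatePow M B := by
  ext i j
  simp only [gatePow, of_apply, Matrix.mul_apply, ← Finset.prod_mul_distrib]
  exact Fintype.prod_sum fun k a => A (i k) a * B a (j k)

lemma gatePow_conjTranspose (A : Matrix (Fin d) (Fin d) ℂ) :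
    gatePow M Aᴴ = (gatePow M A)ᴴ := by
  ext i j
  simp [gatePow, conjTranspose_apply]

lemma gatePow_one : gatePow M (1 : Matrix (Fin d) (Fin d) ℂ) = 1 := by
  ext i j
  simp only [gatePow, of_apply, Matrix.one_apply, Finset.prod_ite_zero, Finset.prod_const_one,
    Finset.mem_univ, true_implies, funext_iff]

lemma trace_gatePow (A : Matrix (Fin d) (Fin d) ℂ) : (gatePow M A).trace = A.trace ^ M := by
  simp only [Matrix.trace, diag_apply, gatePow, of_apply]
  rw [← Fintype.prod_sum (f := fun (_ : Fin M) a => A a a)]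
  simp

lemma gatePow_conjTranspose_mul (U : Gate (Fin d)) :
    (gatePow M (U : Matrix (Fin d) (Fin d) ℂ))ᴴ * gatePow M (U : Matrix (Fin d) (Fin d) ℂ) = 1 := by
  rw [← gatePow_conjTranspose, ← gatePow_mul, conjTranspose_mul_gate, gatePow_one]

lemma continuous_gatePow_apply (i j : Fin M → Fin d) :
    Continuous fun U : Gate (Fin d) => gatePow M (U : Matrix (Fin d) (Fin d) ℂ) i j := by
  simp only [gatePow, of_apply]
  exact continuous_finsetProd _ fun k _ => continuous_gate_apply _ _

end GatePow

/-! ### Sequential uses of a gate -/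

section Uses

variable {d : ℕ} {A : Type} [Fintype A] [DecidableEq A]

lemma posSemidef_runUses (U : Matrix (Fin d) (Fin d) ℂ) (step : ℕ → QOp (Fin d × A) (Fin d × A))
    {ρ : Matrix (Fin d × A) (Fin d × A) ℂ} (hρ : ρ.PosSemidef) (k : ℕ) :
    (runUses U step k ρ).PosSemidef := by
  induction k with
  | zero => exact hρ
  | succ k ih => exact (step k).posSemidef_map (ih.mul_mul_conjTranspose_same _)

lemma trace_runUses (U : Gate (Fin d)) {step : ℕ → QOp (Fin d × A) (Fin d × A)}
    (hs : ∀ k, (step k).IsChannel) (ρ : Matrix (Fin d × A) (Fin d × A) ℂ) (k : ℕ) :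
    (runUses (U : Matrix (Fin d) (Fin d) ℂ) step k ρ).trace = ρ.trace := by
  induction k with
  | zero => rfl
  | succ k ih =>
    rw [runUses, hs k, ← ih, trace_mul_comm, ← Matrix.mul_assoc, conjTranspose_kronecker,
      ← mul_kronecker_mul, conjTranspose_mul_gate, conjTranspose_one, Matrix.one_mul,
      one_kronecker_one, Matrix.one_mul]

lemma continuous_runUses (step : ℕ → QOp (Fin d × A) (Fin d × A))
    (ρ : Matrix (Fin d × A) (Fin d × A) ℂ) (k : ℕ) :
    Continuous fun U : Gate (Fin d) => runUses (U : Matrix (Fin d) (Fin d) ℂ) step k ρ := by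
  induction k with
  | zero => exact continuous_const
  | succ k ih =>
    have hU : Continuous fun U : Gate (Fin d) =>
        (U : Matrix (Fin d) (Fin d) ℂ) ⊗ₖ (1 : Matrix A A ℂ) :=
      continuous_matrix fun i j => (continuous_gate_apply _ _).mul continuous_const
    exact (LinearMap.continuous_of_finiteDimensional (step k).map).comp
      ((hU.mul ih).mul hU.matrix_conjTranspose)

end Uses

/-! ### Running an estimation next to a stored input -/

section Network

variable {d : ℕ} {A κ : Type} [Fintype A] [DecidableEq A] [Fintype κ] [DecidableEq κ]

/-- The product of a state of system and ancilla with a state of the stored system. -/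
def joinState (σ : Matrix (Fin d × A) (Fin d × A) ℂ) (ρ : Matrix κ κ ℂ) :
    Matrix (Fin d × (A × κ)) (Fin d × (A × κ)) ℂ :=
  Matrix.of fun x y => σ (x.1, x.2.1) (y.1, y.2.1) * ρ x.2.2 y.2.2

lemma sum_prod_assoc {B C D : Type} [Fintype B] [Fintype C] [Fintype D] (f : B × (C × D) → ℂ) :
    ∑ x, f x = ∑ p : B × C, ∑ b : D, f (p.1, (p.2, b)) := by
  rw [Fintype.sum_prod_type, Fintype.sum_prod_type]
  exact Finset.sum_congr rfl fun a _ => Fintype.sum_prod_type _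

lemma trace_joinState (σ : Matrix (Fin d × A) (Fin d × A) ℂ) (ρ : Matrix κ κ ℂ) :
    (joinState σ ρ).trace = σ.trace * ρ.trace := by
  rw [Matrix.trace, sum_prod_assoc, Matrix.trace, Matrix.trace, Finset.sum_mul_sum]
  rfl

/-- Preparing `σ` next to the input. -/
def storeMap (σ : Matrix (Fin d × A) (Fin d × A) ℂ) :
    Matrix κ κ ℂ →ₗ[ℂ] Matrix (Fin d × (A × κ)) (Fin d × (A × κ)) ℂ where
  toFun := joinState σ
  map_add' ρ ρ' := by
    ext x y
    simp [joinState, mul_add]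
  map_smul' z ρ := by
    ext x y
    simp [joinState, mul_left_comm]

/-- The Kraus operators are `v_k ⊗ 1`, for a decomposition of `σ` into vectors `v_k`. -/
lemma isCP_storeMap {σ : Matrix (Fin d × A) (Fin d × A) ℂ} (hσ : σ.PosSemidef) :
    IsCP (storeMap (κ := κ) σ) := by
  obtain ⟨r, v, rfl⟩ := posSemidef_iff_eq_sum_vecMulVec.mp hσ
  refine isCP_of_kraus (fun k => Matrix.of fun x i => v k (x.1, x.2.1) *
    (1 : Matrix κ κ ℂ) x.2.2 i) fun X => ?_
  ext x y
  simp only [storeMap, LinearMap.coe_mk, AddHom.coe_mk, joinState, of_apply, Matrix.sum_apply,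
    vecMulVec_apply, Finset.sum_mul, Pi.star_apply]
  refine Finset.sum_congr rfl fun k _ => ?_
  simp [Matrix.mul_apply, Matrix.one_apply, apply_ite (starRingEnd ℂ)]
  ring

/-- The operation `Φ` next to an idle system. -/
def idleMap (Φ : Matrix (Fin d × A) (Fin d × A) ℂ →ₗ[ℂ] Matrix (Fin d × A) (Fin d × A) ℂ) :
    Matrix (Fin d × (A × κ)) (Fin d × (A × κ)) ℂ →ₗ[ℂ]
      Matrix (Fin d × (A × κ)) (Fin d × (A × κ)) ℂ where
  toFun X := Matrix.of fun x y =>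
    Φ (Matrix.of fun p q => X (p.1, (p.2, x.2.2)) (q.1, (q.2, y.2.2))) (x.1, x.2.1) (y.1, y.2.1)
  map_add' X Y := by
    ext x y
    exact congrFun (congrFun (Φ.map_add
      (Matrix.of fun p q => X (p.1, (p.2, x.2.2)) (q.1, (q.2, y.2.2)))
      (Matrix.of fun p q => Y (p.1, (p.2, x.2.2)) (q.1, (q.2, y.2.2)))) _) _
  map_smul' z X := by
    ext x y
    exact congrFun (congrFun (Φ.map_smul z
      (Matrix.of fun p q => X (p.1, (p.2, x.2.2)) (q.1, (q.2, y.2.2)))) _) _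

/-- The idle system is counted as part of the auxiliary system in the definition of complete
positivity. -/
lemma isCP_idleMap {Φ : Matrix (Fin d × A) (Fin d × A) ℂ →ₗ[ℂ] Matrix (Fin d × A) (Fin d × A) ℂ}
    (hΦ : IsCP Φ) : IsCP (idleMap (κ := κ) Φ) := by
  intro k X hX
  exact (hΦ.posSemidef_of (K := Fin k × κ) (hX.submatrix
    fun u : (Fin k × κ) × (Fin d × A) => (u.1.1, (u.2.1, (u.2.2, u.1.2))))).submatrix
    fun u : Fin k × (Fin d × (A × κ)) => ((u.1, u.2.2.2), (u.2.1, u.2.2.1))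

lemma trace_idleMap {Φ : Matrix (Fin d × A) (Fin d × A) ℂ →ₗ[ℂ] Matrix (Fin d × A) (Fin d × A) ℂ}
    (hΦ : ∀ X, (Φ X).trace = X.trace) (X : Matrix (Fin d × (A × κ)) (Fin d × (A × κ)) ℂ) :
    (idleMap Φ X).trace = X.trace := by
  rw [Matrix.trace, Matrix.trace, sum_prod_assoc, sum_prod_assoc, Finset.sum_comm,
    Finset.sum_comm (s := (Finset.univ : Finset (Fin d × A)))]
  exact Finset.sum_congr rfl fun b _ =>
    hΦ (Matrix.of fun p q => X (p.1, (p.2, b)) (q.1, (q.2, b)))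

lemma idleMap_joinState (Φ : Matrix (Fin d × A) (Fin d × A) ℂ →ₗ[ℂ]
    Matrix (Fin d × A) (Fin d × A) ℂ) (σ : Matrix (Fin d × A) (Fin d × A) ℂ) (ρ : Matrix κ κ ℂ) :
    idleMap Φ (joinState σ ρ) = joinState (Φ σ) ρ := by
  ext x y
  have e : (Matrix.of fun p q : Fin d × A => joinState σ ρ (p.1, (p.2, x.2.2)) (q.1, (q.2, y.2.2))) =
      ρ x.2.2 y.2.2 • σ := by
    ext p q
    simp [joinState, mul_comm]
  simp only [idleMap, LinearMap.coe_mk, AddHom.coe_mk, of_apply]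
  rw [e, map_smul]
  simp [joinState, mul_comm]

lemma conj_joinState (U : Matrix (Fin d) (Fin d) ℂ) (σ : Matrix (Fin d × A) (Fin d × A) ℂ)
    (ρ : Matrix κ κ ℂ) :
    (U ⊗ₖ (1 : Matrix (A × κ) (A × κ) ℂ)) * joinState σ ρ *
      (U ⊗ₖ (1 : Matrix (A × κ) (A × κ) ℂ))ᴴ =
    joinState ((U ⊗ₖ (1 : Matrix A A ℂ)) * σ * (U ⊗ₖ (1 : Matrix A A ℂ))ᴴ) ρ := by
  have hj : ∀ τ : Matrix (Fin d × A) (Fin d × A) ℂ, joinState τ ρ =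
      (τ ⊗ₖ ρ).submatrix (Equiv.prodAssoc _ _ _).symm (Equiv.prodAssoc _ _ _).symm := fun τ => rfl
  have hU : U ⊗ₖ (1 : Matrix (A × κ) (A × κ) ℂ) =
      ((U ⊗ₖ (1 : Matrix A A ℂ)) ⊗ₖ (1 : Matrix κ κ ℂ)).submatrix
        (Equiv.prodAssoc _ _ _).symm (Equiv.prodAssoc _ _ _).symm := by
    ext ⟨a, b, e⟩ ⟨a', b', e'⟩
    by_cases h : b = b' <;> simp [Matrix.one_apply, h]
  rw [hj, hj, hU, conjTranspose_submatrix, submatrix_mul_equiv, submatrix_mul_equiv,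
    conjTranspose_kronecker (U ⊗ₖ (1 : Matrix A A ℂ)), conjTranspose_one, ← mul_kronecker_mul,
    ← mul_kronecker_mul, Matrix.one_mul, Matrix.mul_one]

/-- Neither the gate nor the steps touch the stored system, so the product form with `ρ` is
preserved throughout. -/
lemma runUses_idle (U : Matrix (Fin d) (Fin d) ℂ) {step : ℕ → QOp (Fin d × A) (Fin d × A)}
    {step' : ℕ → QOp (Fin d × (A × κ)) (Fin d × (A × κ))}
    (h : ∀ k, (step' k).map = idleMap (step k).map) (σ : Matrix (Fin d × A) (Fin d × A) ℂ)
    (ρ : Matrix κ κ ℂ) (k : ℕ) :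
    runUses U step' k (joinState σ ρ) = joinState (runUses U step k σ) ρ := by
  induction k with
  | zero => rfl
  | succ k ih => rw [runUses, runUses, ih, conj_joinState, h, idleMap_joinState]

end Network

/-! ### Measuring and applying the estimated gate -/

section Decode

variable {d M : ℕ} {A : Type} [Fintype A] [DecidableEq A] (E : Povm (Gate (Fin d)) (Fin d × A))

lemma Povm.integrable_P_mul (a b : Fin d × A) {f : Gate (Fin d) → ℂ} (hf : Continuous f) :
    Integrable (fun V => E.P V a b * f V) E.base := by
  obtain ⟨C, hC⟩ := isCompact_univ.exists_bound_of_continuousOn hf.continuousOn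
  exact (E.integrable_P a b).mul_bdd (c := C) hf.aestronglyMeasurable
    (.of_forall fun V => hC V (Set.mem_univ V))

/-- Applying `V^{⊗ M}` to the stored system, for the outcome `V` of the measurement. -/
def actMap (V : Gate (Fin d)) :
    Matrix (Fin d × (A × (Fin M → Fin d))) (Fin d × (A × (Fin M → Fin d))) ℂ →ₗ[ℂ]
      Matrix (Fin M → Fin d) (Fin M → Fin d) ℂ where
  toFun X := Matrix.of fun i j => ∑ x, ∑ y, E.P V (y.1, y.2.1) (x.1, x.2.1) *
    (gatePow M (V : Matrix (Fin d) (Fin d) ℂ) i x.2.2 *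
      star (gatePow M (V : Matrix (Fin d) (Fin d) ℂ) j y.2.2) * X x y)
  map_add' X Y := by
    ext i j
    simp [mul_add, Finset.sum_add_distrib]
  map_smul' z X := by
    ext i j
    simp [mul_left_comm _ z, Finset.mul_sum]

/-- The Kraus operators are `⟨v_k| ⊗ V^{⊗ M}`, for a decomposition of the effect into vectors `v_k`.
-/
lemma isCP_actMap (V : Gate (Fin d)) : IsCP (actMap (M := M) E V) := by
  obtain ⟨r, v, hv⟩ := posSemidef_iff_eq_sum_vecMulVec.mp (E.posSemidef_P V)
  refine isCP_of_kraus (fun k => Matrix.of fun i x =>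
    gatePow M (V : Matrix (Fin d) (Fin d) ℂ) i x.2.2 * star (v k (x.1, x.2.1))) fun X => ?_
  ext i j
  simp only [actMap, LinearMap.coe_mk, AddHom.coe_mk, of_apply, hv, Matrix.sum_apply,
    vecMulVec_apply, Finset.sum_mul, Pi.star_apply, Matrix.mul_apply, conjTranspose_apply]
  rw [Finset.sum_comm, Finset.sum_comm (s := (Finset.univ : Finset (Fin r)))]
  refine Finset.sum_congr rfl fun y _ => ?_
  rw [Finset.sum_comm]
  rw [Finset.sum_comm (s := (Finset.univ : Finset (Fin r)))]
  rw [Finset.sum_comm]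
  refine Finset.sum_congr rfl fun x _ => Finset.sum_congr rfl fun k _ => ?_
  rw [star_mul', star_star]
  ring

lemma actMap_joinState (V : Gate (Fin d)) (σ : Matrix (Fin d × A) (Fin d × A) ℂ)
    (ρ : Matrix (Fin M → Fin d) (Fin M → Fin d) ℂ) (i j : Fin M → Fin d) :
    actMap E V (joinState σ ρ) i j = (E.P V * σ).trace *
      (gatePow M (V : Matrix (Fin d) (Fin d) ℂ) * ρ *
        (gatePow M (V : Matrix (Fin d) (Fin d) ℂ))ᴴ) i j := by
  have hR : (gatePow M (V : Matrix (Fin d) (Fin d) ℂ) * ρ *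
        (gatePow M (V : Matrix (Fin d) (Fin d) ℂ))ᴴ) i j =
      ∑ b, ∑ b', gatePow M (V : Matrix (Fin d) (Fin d) ℂ) i b *
        star (gatePow M (V : Matrix (Fin d) (Fin d) ℂ) j b') * ρ b b' := by
    simp only [Matrix.mul_apply, conjTranspose_apply, Finset.sum_mul]
    rw [Finset.sum_comm]
    exact Finset.sum_congr rfl fun b _ => Finset.sum_congr rfl fun b' _ => by ring
  simp only [actMap, LinearMap.coe_mk, AddHom.coe_mk, of_apply, joinState, sum_prod_assoc]
  rw [hR, trace_mul_comm, trace_mul_eq_sum, Finset.sum_mul]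
  refine Finset.sum_congr rfl fun p _ => Finset.sum_comm.trans ?_
  rw [Finset.sum_mul]
  refine Finset.sum_congr rfl fun q _ => ?_
  rw [Finset.mul_sum]
  refine Finset.sum_congr rfl fun b _ => ?_
  rw [Finset.mul_sum]
  refine Finset.sum_congr rfl fun b' _ => ?_
  ring

lemma integrable_actMap (X : Matrix (Fin d × (A × (Fin M → Fin d))) (Fin d × (A × (Fin M → Fin d))) ℂ)
    (i j : Fin M → Fin d) : Integrable (fun V => actMap E V X i j) E.base := by
  refine integrable_finsetSum _ fun x _ => integrable_finsetSum _ fun y _ =>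
    E.integrable_P_mul _ _ ?_
  exact ((continuous_gatePow_apply M i _).mul (continuous_gatePow_apply M j _).star).mul
    continuous_const

/-- Measuring, and applying `V^{⊗ M}` to the stored system for the outcome `V`. -/
def decodeMap : Matrix (Fin d × (A × (Fin M → Fin d))) (Fin d × (A × (Fin M → Fin d))) ℂ →ₗ[ℂ]
    Matrix (Fin M → Fin d) (Fin M → Fin d) ℂ :=
  integralMap E.base (actMap E) (integrable_actMap E)

variable {E} in
-- Unitarity of `V^{⊗ M}` removes `V` from the stored system, and completeness of the measurement
-- then sums the effects to the identity.
lemma trace_decodeMap (hE : E.IsComplete)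
    (X : Matrix (Fin d × (A × (Fin M → Fin d))) (Fin d × (A × (Fin M → Fin d))) ℂ) :
    (decodeMap E X).trace = X.trace := by
  have hI : (decodeMap E X).trace = ∫ V, (actMap E V X).trace ∂E.base :=
    (integral_finsetSum _ fun i _ => integrable_actMap E X i i).symm
  have hg : ∀ (V : Gate (Fin d)) (a b : Fin M → Fin d),
      ∑ i, gatePow M (V : Matrix (Fin d) (Fin d) ℂ) i a *
        star (gatePow M (V : Matrix (Fin d) (Fin d) ℂ) i b) = if b = a then 1 else 0 := by
    intro V a b
    rw [← Matrix.one_apply, ← gatePow_conjTranspose_mul M V, Matrix.mul_apply]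
    exact Finset.sum_congr rfl fun i _ => mul_comm _ _
  have hV : ∀ V, (actMap E V X).trace = ∑ x, ∑ y, E.P V (y.1, y.2.1) (x.1, x.2.1) *
      ((if y.2.2 = x.2.2 then 1 else 0) * X x y) := by
    intro V
    simp only [Matrix.trace, diag_apply, actMap, LinearMap.coe_mk, AddHom.coe_mk, of_apply]
    rw [Finset.sum_comm]
    refine Finset.sum_congr rfl fun x _ => ?_
    rw [Finset.sum_comm]
    refine Finset.sum_congr rfl fun y _ => ?_
    rw [← hg V, ← Finset.mul_sum, ← Finset.sum_mul]
  have htot : ∀ a b, ∫ V, E.P V a b ∂E.base = if a = b then 1 else 0 := fun a b => by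
    have := congrFun (congrFun hE a) b
    rwa [Matrix.one_apply] at this
  rw [hI]
  simp only [hV]
  rw [integral_finsetSum _ fun x _ => integrable_finsetSum _ fun y _ =>
    (E.integrable_P _ _).mul_const _, Matrix.trace]
  refine Finset.sum_congr rfl fun x _ => ?_
  rw [integral_finsetSum _ fun y _ => (E.integrable_P _ _).mul_const _]
  simp only [integral_mul_const, htot]
  rw [Finset.sum_eq_single x]
  · simp
  · intro y _ hy
    by_cases h1 : (y.1, y.2.1) = (x.1, x.2.1)
    · have h2 : y.2.2 ≠ x.2.2 := fun h2 => hy (by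
        obtain ⟨e1, e2⟩ := Prod.ext_iff.mp h1
        exact Prod.ext e1 (Prod.ext e2 h2))
      simp [h2]
    · rw [if_neg h1, zero_mul]
  · simp

end Decode

/-! ### The network and its action -/

section MeasureAct

variable {d N : ℕ} (E : GateEstimator d N) (M : ℕ)

/-- The network that estimates the gate and applies the estimate to the input. -/
def GateEstimator.network : GateNetwork d N (Fin M → Fin d) where
  A := E.A × (Fin M → Fin d)
  encode := channelOf (storeMap E.init) (isCP_storeMap E.init_posSemidef) fun ρ =>
    (trace_joinState _ _).trans (by rw [E.init_trace, one_mul])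
  step k := channelOf (idleMap (E.step k).map) (isCP_idleMap (E.step k).completelyPositive)
    (trace_idleMap (E.step_isChannel k))
  decode := channelOf (decodeMap E.povm) (isCP_integralMap _ (isCP_actMap E.povm))
    (trace_decodeMap E.povm_isComplete)

lemma GateEstimator.isDeterministic_network : (E.network M).IsDeterministic :=
  ⟨fun ρ => (trace_joinState _ _).trans (by rw [E.init_trace, one_mul]),
    fun k => trace_idleMap (E.step_isChannel k), trace_decodeMap E.povm_isComplete⟩

/-- The state before the measurement. -/
def GateEstimator.final (U : Gate (Fin d)) : Matrix (Fin d × E.A) (Fin d × E.A) ℂ :=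
  runUses (U : Matrix (Fin d) (Fin d) ℂ) E.step N E.init

lemma GateEstimator.posSemidef_final (U : Gate (Fin d)) : (E.final U).PosSemidef :=
  posSemidef_runUses _ _ E.init_posSemidef _

lemma GateEstimator.trace_final (U : Gate (Fin d)) : (E.final U).trace = 1 :=
  (trace_runUses U E.step_isChannel _ _).trans E.init_trace

lemma GateEstimator.measurable_final (i j : Fin d × E.A) : Measurable fun U => E.final U i j :=
  ((continuous_runUses E.step E.init N).matrix_elem i j).measurable

lemma GateEstimator.law_univ (U : Gate (Fin d)) : E.law U Set.univ = 1 := by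
  refine (E.povm_isComplete.law_univ (E.posSemidef_final U)).trans ?_
  rw [E.trace_final]
  simp

instance (U : Gate (Fin d)) : IsProbabilityMeasure (E.law U) := ⟨E.law_univ U⟩

/-- The input stays in a product with the probe until decoding, so the estimate is distributed as
without it. -/
lemma GateEstimator.run_network (U : Gate (Fin d))
    (ρ : Matrix (Fin M → Fin d) (Fin M → Fin d) ℂ) (i j : Fin M → Fin d) :
    (E.network M).run (U : Matrix (Fin d) (Fin d) ℂ) ρ i j = ∫ V : Gate (Fin d),
      (gatePow M (V : Matrix (Fin d) (Fin d) ℂ) * ρ *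
        (gatePow M (V : Matrix (Fin d) (Fin d) ℂ))ᴴ) i j ∂E.law U := by
  have h : (E.network M).run (U : Matrix (Fin d) (Fin d) ℂ) ρ =
      decodeMap E.povm (joinState (E.final U) ρ) :=
    congrArg (decodeMap E.povm) (runUses_idle (U : Matrix (Fin d) (Fin d) ℂ) (fun _ => rfl) _ _ _)
  rw [h]
  refine Eq.trans ?_ (Povm.integral_law E.povm (E.posSemidef_final U) _).symm
  exact integral_congr_ae (.of_forall fun V => actMap_joinState E.povm V _ _ i j)

lemma GateNetwork.IsDeterministic.trace_run {ι : Type} [Fintype ι] {W : GateNetwork d N ι}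
    (h : W.IsDeterministic) (U : Gate (Fin d)) (ρ : Matrix ι ι ℂ) :
    (W.run (U : Matrix (Fin d) (Fin d) ℂ) ρ).trace = ρ.trace := by
  rw [GateNetwork.run, h.2.2, trace_runUses U h.2.1, h.1]

lemma GateNetwork.posSemidef_run {ι : Type} [Fintype ι] (W : GateNetwork d N ι)
    (U : Matrix (Fin d) (Fin d) ℂ) {ρ : Matrix ι ι ℂ} (hρ : ρ.PosSemidef) :
    (W.run U ρ).PosSemidef :=
  W.decode.posSemidef_map (posSemidef_runUses _ _ (W.encode.posSemidef_map hρ) _)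

end MeasureAct

/-! ### The fidelity of the measure-and-prepare network -/

section EntanglementFidelity

variable {d : ℕ} [NeZero d]

/-- The entanglement fidelity of two gates. -/
def entanglementFidelity (V U : Gate (Fin d)) : ℝ :=
  ‖((U : Matrix (Fin d) (Fin d) ℂ)ᴴ * (V : Matrix (Fin d) (Fin d) ℂ)).trace‖ ^ 2 / (d : ℝ) ^ 2

lemma entanglementFidelity_nonneg (V U : Gate (Fin d)) : 0 ≤ entanglementFidelity V U := by
  unfold entanglementFidelity
  positivity

lemma entanglementFidelity_le_one (V U : Gate (Fin d)) : entanglementFidelity V U ≤ 1 := by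
  have hd : (0 : ℝ) < d := by exact_mod_cast NeZero.pos d
  have hW : ((U : Matrix (Fin d) (Fin d) ℂ)ᴴ * (V : Matrix (Fin d) (Fin d) ℂ)) ∈
      Matrix.unitaryGroup (Fin d) ℂ := (star U * V).2
  rw [entanglementFidelity, div_le_one (by positivity)]
  refine pow_le_pow_left₀ (norm_nonneg _) ((norm_sum_le _ _).trans ?_) 2
  refine (Finset.sum_le_sum fun i _ => entry_norm_bound_of_unitary hW i i).trans ?_
  simp

lemma continuous_entanglementFidelity {X : Type} [TopologicalSpace X] {V U : X → Gate (Fin d)}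
    (hV : Continuous V) (hU : Continuous U) : Continuous fun x => entanglementFidelity (V x) (U x) := by
  unfold entanglementFidelity
  have h1 : Continuous fun x => (U x : Matrix (Fin d) (Fin d) ℂ) := continuous_subtype_val.comp hU
  have h2 : Continuous fun x => (V x : Matrix (Fin d) (Fin d) ℂ) := continuous_subtype_val.comp hV
  exact ((h1.matrix_conjTranspose.matrix_mul h2).matrix_trace.norm.pow 2).div_const _

lemma gateFidelity_gate (V U : Gate (Fin d)) :
    gateFidelity (V : Matrix (Fin d) (Fin d) ℂ) (U : Matrix (Fin d) (Fin d) ℂ) =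
      ENNReal.ofReal ((1 + d * entanglementFidelity V U) / (d + 1)) := by
  have hd : (0 : ℝ) < d := by exact_mod_cast NeZero.pos d
  rw [gateFidelity_eq (conjTranspose_mul_gate (star U * V)), Fintype.card_fin,
    entanglementFidelity]
  congr 1
  field_simp
  ring

/-- The trace is multiplicative, so the entanglement fidelity of the tensor powers is `F ^ M`. The
average fidelity `(1 + D F ^ M) / (D + 1)` is at least `F ^ M`, since `F ≤ 1`. -/
lemma pow_le_gateFidelity_gatePow (M : ℕ) (V U : Gate (Fin d)) :
    ENNReal.ofReal (entanglementFidelity V U ^ M) ≤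
      gateFidelity (gatePow M (V : Matrix (Fin d) (Fin d) ℂ))
        (gatePow M (U : Matrix (Fin d) (Fin d) ℂ)) := by
  have hd : (0 : ℝ) < d := by exact_mod_cast NeZero.pos d
  have hW : (gatePow M (U : Matrix (Fin d) (Fin d) ℂ))ᴴ *
      gatePow M (V : Matrix (Fin d) (Fin d) ℂ) =
      gatePow M ((U : Matrix (Fin d) (Fin d) ℂ)ᴴ * (V : Matrix (Fin d) (Fin d) ℂ)) := by
    rw [gatePow_mul, gatePow_conjTranspose]
  rw [gateFidelity_eq (by rw [hW]; exact gatePow_conjTranspose_mul M (star U * V)), hW,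
    trace_gatePow, Fintype.card_fun, Fintype.card_fin, Fintype.card_fin]
  refine ENNReal.ofReal_le_ofReal ?_
  have h1 := pow_le_one₀ (n := M) (entanglementFidelity_nonneg V U)
    (entanglementFidelity_le_one V U)
  have e : ‖((U : Matrix (Fin d) (Fin d) ℂ)ᴴ * (V : Matrix (Fin d) (Fin d) ℂ)).trace ^ M‖ ^ 2 =
      entanglementFidelity V U ^ M * ((d : ℝ) ^ M) ^ 2 := by
    rw [entanglementFidelity, div_pow, norm_pow, ← pow_mul, ← pow_mul, ← pow_mul, ← pow_mul,
      mul_comm 2 M, div_mul_cancel₀ _ (by positivity)]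
  rw [e]
  push_cast
  set D : ℝ := (d : ℝ) ^ M
  have hD : 0 < D := by positivity
  rw [le_div_iff₀ (by positivity)]
  nlinarith

lemma measurable_gateFidelity : Measurable (Function.uncurry fun U V : Gate (Fin d) =>
    gateFidelity (V : Matrix (Fin d) (Fin d) ℂ) (U : Matrix (Fin d) (Fin d) ℂ)) := by
  simp only [gateFidelity_gate]
  have h : Continuous fun p : Gate (Fin d) × Gate (Fin d) => entanglementFidelity p.2 p.1 :=
    continuous_entanglementFidelity continuous_snd continuous_fst
  have h' : Continuous fun p : Gate (Fin d) × Gate (Fin d) =>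
      (1 + d * entanglementFidelity p.2 p.1) / ((d : ℝ) + 1) := by fun_prop
  exact h'.measurable.ennreal_ofReal

lemma measurable_gateFidelity_left (U : Gate (Fin d)) : Measurable fun V : Gate (Fin d) =>
    gateFidelity (V : Matrix (Fin d) (Fin d) ℂ) (U : Matrix (Fin d) (Fin d) ℂ) := by
  simp only [gateFidelity_gate]
  have h : Continuous fun V => entanglementFidelity V U :=
    continuous_entanglementFidelity continuous_id continuous_const
  have h' : Continuous fun V => (1 + d * entanglementFidelity V U) / ((d : ℝ) + 1) := by fun_prop
  exact h'.measurable.ennreal_ofReal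

lemma gateFidelity_le_one (V U : Gate (Fin d)) :
    gateFidelity (V : Matrix (Fin d) (Fin d) ℂ) (U : Matrix (Fin d) (Fin d) ℂ) ≤ 1 := by
  rw [gateFidelity_gate, ← ENNReal.ofReal_one]
  refine ENNReal.ofReal_le_ofReal ?_
  rw [div_le_one (by positivity)]
  nlinarith [entanglementFidelity_le_one V U, (Nat.cast_nonneg d : (0 : ℝ) ≤ d)]

/-- The origin of the factor `(d + 1) / d`: average infidelity is `d / (d + 1)` times entanglement
infidelity. -/
lemma one_sub_gateFidelity (V U : Gate (Fin d)) :
    ENNReal.ofReal (1 - entanglementFidelity V U) = ENNReal.ofReal ((d + 1) / d) *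
      (1 - gateFidelity (V : Matrix (Fin d) (Fin d) ℂ) (U : Matrix (Fin d) (Fin d) ℂ)) := by
  have hd : (0 : ℝ) < d := by exact_mod_cast NeZero.pos d
  have h0 := entanglementFidelity_nonneg V U
  rw [gateFidelity_gate, ← ENNReal.ofReal_one, ← ENNReal.ofReal_sub _ (by positivity),
    ← ENNReal.ofReal_mul (by positivity)]
  congr 1
  field_simp
  ring

/-- Bernoulli for the entanglement fidelity, written additively so that it can be integrated without
truncated subtraction. -/
lemma one_le_gateFidelity_gatePow_add (M : ℕ) (V U : Gate (Fin d)) :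
    1 ≤ gateFidelity (gatePow M (V : Matrix (Fin d) (Fin d) ℂ))
        (gatePow M (U : Matrix (Fin d) (Fin d) ℂ)) + ENNReal.ofReal ((d + 1) / d) * M *
      (1 - gateFidelity (V : Matrix (Fin d) (Fin d) ℂ) (U : Matrix (Fin d) (Fin d) ℂ)) := by
  have h0 := entanglementFidelity_nonneg V U
  have h1 := entanglementFidelity_le_one V U
  refine le_trans ?_ (add_le_add_left (pow_le_gateFidelity_gatePow M V U) _)
  rw [mul_right_comm, ← one_sub_gateFidelity, mul_comm, ← tsub_le_iff_right]
  refine (one_sub_mul_le_pow _ M).trans_eq ?_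
  rw [← ENNReal.ofReal_one, ← ENNReal.ofReal_sub _ (sub_nonneg.mpr h1), sub_sub_cancel,
    ENNReal.ofReal_pow h0]

end EntanglementFidelity

section NetworkFidelity

variable {d N : ℕ} [NeZero d] (E : GateEstimator d N) (M : ℕ)

lemma ofReal_overlap_run_network (U : Gate (Fin d)) (Ψ : (Fin M → Fin d) → ℂ) :
    ENNReal.ofReal (star (gatePow M (U : Matrix (Fin d) (Fin d) ℂ) *ᵥ Ψ) ⬝ᵥ
      (E.network M).run (U : Matrix (Fin d) (Fin d) ℂ) (proj Ψ) *ᵥ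
        (gatePow M (U : Matrix (Fin d) (Fin d) ℂ) *ᵥ Ψ)).re =
    ∫⁻ V : Gate (Fin d), ENNReal.ofReal (‖star Ψ ⬝ᵥ
      ((gatePow M (U : Matrix (Fin d) (Fin d) ℂ))ᴴ * gatePow M (V : Matrix (Fin d) (Fin d) ℂ)) *ᵥ
        Ψ‖ ^ 2) ∂E.law U := by
  set w := gatePow M (U : Matrix (Fin d) (Fin d) ℂ) *ᵥ Ψ with hw
  have hGc : Continuous fun V : Gate (Fin d) => gatePow M (V : Matrix (Fin d) (Fin d) ℂ) :=
    continuous_matrix (continuous_gatePow_apply M)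
  have hi : ∀ {f : Gate (Fin d) → ℂ}, Continuous f → Integrable f (E.law U) := fun hf =>
    hf.integrable_of_hasCompactSupport (HasCompactSupport.of_compactSpace _)
  have hentry : ∀ i j, Continuous fun V : Gate (Fin d) =>
      (gatePow M (V : Matrix (Fin d) (Fin d) ℂ) * proj Ψ *
        (gatePow M (V : Matrix (Fin d) (Fin d) ℂ))ᴴ) i j := fun i j =>
    ((hGc.matrix_mul continuous_const).matrix_mul hGc.matrix_conjTranspose).matrix_elem i j
  have h1 : star w ⬝ᵥ (E.network M).run (U : Matrix (Fin d) (Fin d) ℂ) (proj Ψ) *ᵥ w =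
      ∫ V : Gate (Fin d), star w ⬝ᵥ (gatePow M (V : Matrix (Fin d) (Fin d) ℂ) * proj Ψ *
        (gatePow M (V : Matrix (Fin d) (Fin d) ℂ))ᴴ) *ᵥ w ∂E.law U := by
    simp only [dotProduct, mulVec, E.run_network]
    rw [integral_finsetSum _ fun i _ => (integrable_finsetSum _ fun j _ =>
      (hi (hentry i j)).mul_const _).const_mul _]
    refine Finset.sum_congr rfl fun i _ => ?_
    rw [integral_const_mul, integral_finsetSum _ fun j _ => (hi (hentry i j)).mul_const _]
    simp_rw [integral_mul_const]
  have h2 : ∀ V : Gate (Fin d), star w ⬝ᵥ (gatePow M (V : Matrix (Fin d) (Fin d) ℂ) * proj Ψ *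
        (gatePow M (V : Matrix (Fin d) (Fin d) ℂ))ᴴ) *ᵥ w =
      ((‖star Ψ ⬝ᵥ ((gatePow M (U : Matrix (Fin d) (Fin d) ℂ))ᴴ *
        gatePow M (V : Matrix (Fin d) (Fin d) ℂ)) *ᵥ Ψ‖ ^ 2 : ℝ) : ℂ) := by
    intro V
    have hp : gatePow M (V : Matrix (Fin d) (Fin d) ℂ) * proj Ψ *
        (gatePow M (V : Matrix (Fin d) (Fin d) ℂ))ᴴ =
        proj (gatePow M (V : Matrix (Fin d) (Fin d) ℂ) *ᵥ Ψ) := by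
      rw [proj, mul_vecMulVec, vecMulVec_mul, proj, star_mulVec]
    have hs : star Ψ ⬝ᵥ ((gatePow M (U : Matrix (Fin d) (Fin d) ℂ))ᴴ *
        gatePow M (V : Matrix (Fin d) (Fin d) ℂ)) *ᵥ Ψ =
        star (star (gatePow M (V : Matrix (Fin d) (Fin d) ℂ) *ᵥ Ψ) ⬝ᵥ w) := by
      rw [hw, ← star_dotProduct, star_mulVec, ← mulVec_mulVec, dotProduct_mulVec]
    rw [hp, star_dotProduct_proj_mulVec, hs, norm_star]
  rw [h1, integral_congr_ae (.of_forall h2), integral_complex_ofReal, Complex.ofReal_re,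
    ofReal_integral_eq_lintegral_ofReal _ (.of_forall fun V => sq_nonneg _)]
  refine Continuous.integrable_of_hasCompactSupport ?_ (HasCompactSupport.of_compactSpace _)
  have : Continuous fun V : Gate (Fin d) => ((gatePow M (U : Matrix (Fin d) (Fin d) ℂ))ᴴ *
        gatePow M (V : Matrix (Fin d) (Fin d) ℂ)) := continuous_const.matrix_mul hGc
  fun_prop

lemma pureStateAverage_trace_run {W : GateNetwork d N (Fin M → Fin d)} (hW : W.IsDeterministic)
    (U : Gate (Fin d)) : pureStateAverage (fun Ψ : (Fin M → Fin d) → ℂ => ENNReal.ofReal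
      (W.run (U : Matrix (Fin d) (Fin d) ℂ) (proj Ψ)).trace.re) = 1 := by
  have h : ∀ V : Gate (Fin M → Fin d), ENNReal.ofReal
      (W.run (U : Matrix (Fin d) (Fin d) ℂ) (proj (pureState V))).trace.re = 1 := fun V => by
    rw [hW.trace_run, trace_proj, pureState_unit]
    simp
  exact (lintegral_congr h).trans (by simp)

/-- A deterministic network succeeds surely, so the denominator is the mass of `ν`; in the numerator
the averages over the input state and over the estimate are exchanged by Tonelli. -/
lemma fidelity_network (ν : Measure (Gate (Fin d))) :
    (E.network M).fidelity ν = (∫⁻ U, ∫⁻ V, gateFidelity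
      (gatePow M (V : Matrix (Fin d) (Fin d) ℂ)) (gatePow M (U : Matrix (Fin d) (Fin d) ℂ))
        ∂E.law U ∂ν) / ν Set.univ := by
  have hnum : ∀ U : Gate (Fin d), pureStateAverage (fun Ψ : (Fin M → Fin d) → ℂ =>
      ENNReal.ofReal (star (gatePow M (U : Matrix (Fin d) (Fin d) ℂ) *ᵥ Ψ) ⬝ᵥ
        (E.network M).run (U : Matrix (Fin d) (Fin d) ℂ) (proj Ψ) *ᵥ
          (gatePow M (U : Matrix (Fin d) (Fin d) ℂ) *ᵥ Ψ)).re) =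
      ∫⁻ V, gateFidelity (gatePow M (V : Matrix (Fin d) (Fin d) ℂ))
        (gatePow M (U : Matrix (Fin d) (Fin d) ℂ)) ∂E.law U := by
    intro U
    simp only [ofReal_overlap_run_network]
    refine lintegral_lintegral_swap (Measurable.aemeasurable ?_)
    have h1 : Continuous fun p : Gate (Fin M → Fin d) × Gate (Fin d) => pureState p.1 :=
      continuous_pureState.comp continuous_fst
    have h2 : Continuous fun p : Gate (Fin M → Fin d) × Gate (Fin d) =>
        (gatePow M (U : Matrix (Fin d) (Fin d) ℂ))ᴴ *
          gatePow M (p.2 : Matrix (Fin d) (Fin d) ℂ) := by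
      have hG : Continuous fun V : Gate (Fin d) => gatePow M (V : Matrix (Fin d) (Fin d) ℂ) :=
        continuous_matrix (continuous_gatePow_apply M)
      exact continuous_const.matrix_mul (hG.comp continuous_snd)
    have h3 : Continuous fun p : Gate (Fin M → Fin d) × Gate (Fin d) =>
        ‖star (pureState p.1) ⬝ᵥ ((gatePow M (U : Matrix (Fin d) (Fin d) ℂ))ᴴ *
          gatePow M (p.2 : Matrix (Fin d) (Fin d) ℂ)) *ᵥ pureState p.1‖ ^ 2 := by
      fun_prop
    exact h3.measurable.ennreal_ofReal
  rw [GateNetwork.fidelity]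
  simp only [hnum, pureStateAverage_trace_run M (E.isDeterministic_network M)]
  simp

/-- The mean of the gate fidelity of the estimate. -/
def GateEstimator.fidelityAt (U : Gate (Fin d)) : ℝ≥0∞ :=
  ∫⁻ V, gateFidelity (V : Matrix (Fin d) (Fin d) ℂ) (U : Matrix (Fin d) (Fin d) ℂ) ∂E.law U

lemma GateEstimator.measurable_fidelityAt : Measurable E.fidelityAt :=
  Povm.measurable_lintegral_law E.povm E.measurable_final measurable_gateFidelity

lemma GateEstimator.fidelityAt_le_one (U : Gate (Fin d)) : E.fidelityAt U ≤ 1 :=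
  (lintegral_mono fun V => gateFidelity_le_one V U).trans (by simp)

lemma GateEstimator.lintegral_one_sub_gateFidelity (U : Gate (Fin d)) :
    ∫⁻ V, (1 - gateFidelity (V : Matrix (Fin d) (Fin d) ℂ) (U : Matrix (Fin d) (Fin d) ℂ))
      ∂E.law U = 1 - E.fidelityAt U := by
  rw [lintegral_sub (measurable_gateFidelity_left U) ((E.fidelityAt_le_one U).trans_lt ENNReal.one_lt_top).ne
    (.of_forall fun V => gateFidelity_le_one V U)]
  simp [fidelityAt]

/-- Replication by estimation, for gates with an arbitrary distribution. -/
lemma one_sub_le_fidelity_network (ν : Measure (Gate (Fin d))) [IsFiniteMeasure ν]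
    (hν : ν Set.univ ≠ 0) {F : ℝ≥0∞} (hF : F * ν Set.univ ≤ ∫⁻ U, E.fidelityAt U ∂ν) :
    1 - ENNReal.ofReal ((d + 1) / d) * M * (1 - F) ≤ (E.network M).fidelity ν := by
  have hν' : ν Set.univ ≠ ∞ := by finiteness
  have hc : ENNReal.ofReal (((d : ℝ) + 1) / d) * M ≠ ∞ := by finiteness
  have hU : ∀ U : Gate (Fin d), 1 ≤ (∫⁻ V, gateFidelity
      (gatePow M (V : Matrix (Fin d) (Fin d) ℂ)) (gatePow M (U : Matrix (Fin d) (Fin d) ℂ))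
        ∂E.law U) + ENNReal.ofReal ((d + 1) / d) * M * (1 - E.fidelityAt U) := by
    intro U
    rw [← E.lintegral_one_sub_gateFidelity, ← lintegral_const_mul' _ _ hc, ← lintegral_add_right]
    · calc (1 : ℝ≥0∞) = ∫⁻ _ : Gate (Fin d), 1 ∂E.law U := by simp
        _ ≤ _ := lintegral_mono fun V => one_le_gateFidelity_gatePow_add M V U
    · exact (measurable_const.sub (measurable_gateFidelity_left U)).const_mul _
  have hsub : ∫⁻ U, (1 - E.fidelityAt U) ∂ν ≤ ν Set.univ - F * ν Set.univ := by
    have hfin : ∫⁻ U, E.fidelityAt U ∂ν ≠ ∞ := by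
      refine ((lintegral_mono E.fidelityAt_le_one).trans_lt ?_).ne
      simp [hν'.lt_top]
    rw [lintegral_sub E.measurable_fidelityAt hfin (.of_forall E.fidelityAt_le_one)]
    simp only [lintegral_one]
    exact tsub_le_tsub_left hF _
  have hint : ν Set.univ ≤ (∫⁻ U, ∫⁻ V, gateFidelity
      (gatePow M (V : Matrix (Fin d) (Fin d) ℂ)) (gatePow M (U : Matrix (Fin d) (Fin d) ℂ))
        ∂E.law U ∂ν) + ENNReal.ofReal ((d + 1) / d) * M * (ν Set.univ - F * ν Set.univ) := by
    calc ν Set.univ = ∫⁻ _ : Gate (Fin d), 1 ∂ν := by simp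
      _ ≤ ∫⁻ U, ((∫⁻ V, gateFidelity (gatePow M (V : Matrix (Fin d) (Fin d) ℂ))
            (gatePow M (U : Matrix (Fin d) (Fin d) ℂ)) ∂E.law U) +
          ENNReal.ofReal ((d + 1) / d) * M * (1 - E.fidelityAt U)) ∂ν := lintegral_mono hU
      _ = _ := lintegral_add_right _
          ((measurable_const.sub E.measurable_fidelityAt).const_mul _)
      _ ≤ _ := by
        rw [lintegral_const_mul' _ _ hc]
        exact add_le_add_right (mul_le_mul_right hsub _) _
  rw [fidelity_network, tsub_le_iff_right]
  have hdiv := ENNReal.div_le_div_right hint (ν Set.univ)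
  rw [ENNReal.div_self hν hν', ENNReal.add_div, mul_div_assoc] at hdiv
  refine hdiv.trans (add_le_add_right (mul_le_mul_right ?_ _) _)
  refine ENNReal.div_le_of_le_mul (tsub_le_iff_right.mpr ?_)
  rw [← add_mul]
  exact le_mul_of_one_le_left zero_le le_tsub_add

end NetworkFidelity

/-! ### Estimating a fixed gate followed by the unknown one -/

section Haar

variable {ι : Type} [Fintype ι] [DecidableEq ι]

/-- A right translate of the Haar measure is again a Haar probability measure, and that is unique.
-/
lemma map_mul_right_haar (g : Gate ι) : (haar ι).map (· * g) = haar ι := by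
  have : IsProbabilityMeasure ((haar ι).map (· * g)) :=
    Measure.isProbabilityMeasure_map (measurable_mul_const g).aemeasurable
  exact Measure.isHaarMeasure_eq_of_isProbabilityMeasure _ _

lemma lintegral_haar_mul_right {f : Gate ι → ℝ≥0∞} (hf : Measurable f) (g : Gate ι) :
    ∫⁻ U, f (U * g) ∂haar ι = ∫⁻ U, f U ∂haar ι := by
  conv_rhs => rw [← map_mul_right_haar g, lintegral_map hf (measurable_mul_const g)]

lemma measurable_gate_mul : Measurable fun p : Gate ι × Gate ι => p.1 * p.2 :=
  continuous_mul.measurable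

lemma continuous_phaseGate (d : ℕ) : Continuous (phaseGate d) := by
  refine Continuous.subtype_mk ?_ _
  exact Continuous.matrix_diagonal (continuous_pi fun n => by fun_prop)

instance (d : ℕ) : IsFiniteMeasure (phaseGates d) := by
  unfold phaseGates
  infer_instance

lemma phaseGates_univ (d : ℕ) : phaseGates d Set.univ = ENNReal.ofReal (2 * Real.pi) := by
  rw [phaseGates, Measure.map_apply (continuous_phaseGate d).measurable MeasurableSet.univ]
  simp

end Haar

/-! ### Twisted estimators and phase gates -/

section Twist

lemma IsCP.comp {l m n : Type} {Φ : Matrix m m ℂ →ₗ[ℂ] Matrix n n ℂ}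
    {Ψ : Matrix l l ℂ →ₗ[ℂ] Matrix m m ℂ} (hΦ : IsCP Φ) (hΨ : IsCP Ψ) : IsCP (Φ ∘ₗ Ψ) :=
  fun k X hX => hΦ k _ (hΨ k X hX)

/-- Conjugation by a matrix. -/
def conjMap {m : Type} [Fintype m] (L : Matrix m m ℂ) : Matrix m m ℂ →ₗ[ℂ] Matrix m m ℂ where
  toFun X := L * X * Lᴴ
  map_add' X Y := by rw [Matrix.mul_add, Matrix.add_mul]
  map_smul' z X := by rw [Matrix.mul_smul, Matrix.smul_mul, RingHom.id_apply]

lemma isCP_conjMap {m : Type} [Fintype m] (L : Matrix m m ℂ) : IsCP (conjMap L) :=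
  isCP_of_kraus (fun _ : Fin 1 => L) fun X => by simp [conjMap]

lemma trace_conjMap {d : ℕ} {A : Type} [Fintype A] [DecidableEq A] (g : Gate (Fin d))
    (X : Matrix (Fin d × A) (Fin d × A) ℂ) :
    (conjMap ((g : Matrix (Fin d) (Fin d) ℂ) ⊗ₖ (1 : Matrix A A ℂ)) X).trace = X.trace := by
  rw [conjMap, LinearMap.coe_mk, AddHom.coe_mk, trace_mul_comm, ← Matrix.mul_assoc,
    conjTranspose_kronecker, ← mul_kronecker_mul, conjTranspose_mul_gate, conjTranspose_one,
    Matrix.one_mul, one_kronecker_one, Matrix.one_mul]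

lemma conjMap_mul {d : ℕ} {A : Type} [Fintype A] [DecidableEq A] (g U : Matrix (Fin d) (Fin d) ℂ)
    (X : Matrix (Fin d × A) (Fin d × A) ℂ) :
    conjMap (g ⊗ₖ (1 : Matrix A A ℂ))
        ((U ⊗ₖ (1 : Matrix A A ℂ)) * X * (U ⊗ₖ (1 : Matrix A A ℂ))ᴴ) =
      ((g * U) ⊗ₖ (1 : Matrix A A ℂ)) * X * ((g * U) ⊗ₖ (1 : Matrix A A ℂ))ᴴ := by
  conv_rhs => rw [← Matrix.one_mul (1 : Matrix A A ℂ), mul_kronecker_mul, conjTranspose_mul]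
  simp only [conjMap, LinearMap.coe_mk, AddHom.coe_mk, Matrix.mul_assoc]

variable {d N : ℕ}

/-- The measurement whose outcomes are multiplied by `g⁻¹`. -/
def Povm.translate {n : Type} [Fintype n] [DecidableEq n] (E : Povm (Gate (Fin d)) n)
    (g : Gate (Fin d)) : Povm (Gate (Fin d)) n where
  -- The base measure is moved by `g⁻¹` and the density read at `g * s`, so every integral of
  -- effects is unchanged.
  base := E.base.map (g⁻¹ * ·)
  finite_base := by
    have := E.finite_base
    infer_instance
  P s := E.P (g * s)
  measurable_P i j := (E.measurable_P i j).comp (measurable_const_mul g)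
  posSemidef_P s := E.posSemidef_P _
  integrable_P i j := by
    refine (integrable_map_measure
      ((E.measurable_P i j).comp (measurable_const_mul g)).aestronglyMeasurable
      (measurable_const_mul g⁻¹).aemeasurable).mpr ?_
    simpa [Function.comp_def] using E.integrable_P i j
  failure_posSemidef := by
    convert E.failure_posSemidef using 5 with i j
    refine (integral_map (measurable_const_mul g⁻¹).aemeasurable
      ((E.measurable_P i j).comp (measurable_const_mul g)).aestronglyMeasurable).trans ?_
    simp

lemma Povm.lintegral_translate {n : Type} [Fintype n] [DecidableEq n] (E : Povm (Gate (Fin d)) n)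
    (g : Gate (Fin d)) (ρ : Matrix n n ℂ) {f : Gate (Fin d) → ℝ≥0∞} (hf : Measurable f) :
    ∫⁻ V, f V ∂(E.translate g).law ρ = ∫⁻ V, f (g⁻¹ * V) ∂E.law ρ := by
  rw [Povm.lintegral_law _ _ hf]
  refine Eq.trans ?_ (Povm.lintegral_law E ρ (hf.comp (measurable_const_mul g⁻¹))).symm
  refine (lintegral_map (((E.translate g).measurable_density ρ).mul hf)
    (measurable_const_mul _)).trans ?_
  simp [Povm.density, Povm.translate]

lemma Povm.IsComplete.translate {n : Type} [Fintype n] [DecidableEq n]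
    {E : Povm (Gate (Fin d)) n} (hE : E.IsComplete) (g : Gate (Fin d)) :
    (E.translate g).IsComplete := by
  refine Eq.trans ?_ hE
  ext i j
  refine (integral_map (measurable_const_mul _).aemeasurable
    ((E.measurable_P i j).comp (measurable_const_mul g)).aestronglyMeasurable).trans ?_
  simp

variable (E : GateEstimator d N)

/-- The estimation of `U` by means of an estimation of `g * U`. -/
def GateEstimator.twist (g : Gate (Fin d)) : GateEstimator d N where
  A := E.A
  init := E.init
  init_posSemidef := E.init_posSemidef
  init_trace := E.init_trace
  step k := channelOf ((E.step k).map ∘ₗ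
      conjMap ((g : Matrix (Fin d) (Fin d) ℂ) ⊗ₖ (1 : Matrix E.A E.A ℂ)))
    (IsCP.comp (E.step k).completelyPositive (isCP_conjMap _))
    fun X => (E.step_isChannel k _).trans (trace_conjMap g X)
  step_isChannel k X := (E.step_isChannel k _).trans (trace_conjMap g X)
  povm := E.povm.translate g
  povm_isComplete := E.povm_isComplete.translate g

lemma GateEstimator.final_twist (g U : Gate (Fin d)) : (E.twist g).final U = E.final (g * U) := by
  suffices h : ∀ k, runUses (U : Matrix (Fin d) (Fin d) ℂ) (E.twist g).step k E.init =
      runUses ((g * U : Gate (Fin d)) : Matrix (Fin d) (Fin d) ℂ) E.step k E.init from h N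
  intro k
  induction k with
  | zero => rfl
  | succ k ih =>
    refine congrArg (E.step k).map ?_
    rw [ih]
    exact conjMap_mul (A := E.A) _ _ _

/-- Each use is followed by `g`, so the estimator sees `g * U`; comparing `g⁻¹ * V` with `U` is
comparing `V` with `g * U`. -/
lemma GateEstimator.fidelityAt_twist [NeZero d] (g U : Gate (Fin d)) :
    (E.twist g).fidelityAt U = E.fidelityAt (g * U) := by
  have h : (E.twist g).law U = (E.povm.translate g).law (E.final (g * U)) :=
    congrArg (E.povm.translate g).law (E.final_twist g U)
  rw [fidelityAt, h, Povm.lintegral_translate _ _ _ (measurable_gateFidelity_left U), fidelityAt]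
  refine lintegral_congr fun V => ?_
  rw [gateFidelity_gate, gateFidelity_gate]
  simp [entanglementFidelity, conjTranspose_mul, Matrix.mul_assoc, star_eq_conjTranspose]

/-- For `g` Haar distributed, `g * U` is Haar distributed whatever `U` is. The mean over `g` of the
performance on phase gates is thus the Haar fidelity, and some `g` is at least as good as the mean.
-/
lemma exists_fidelity_le_lintegral_phaseGates [NeZero d] : ∃ g : Gate (Fin d),
    E.fidelity * phaseGates d Set.univ ≤ ∫⁻ U, (E.twist g).fidelityAt U ∂phaseGates d := by
  have hm := E.measurable_fidelityAt
  have h : ∫⁻ g, ∫⁻ U, (E.twist g).fidelityAt U ∂phaseGates d ∂haar (Fin d) =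
      E.fidelity * phaseGates d Set.univ := by
    simp only [E.fidelityAt_twist]
    rw [lintegral_lintegral_swap (f := fun g U => E.fidelityAt (g * U))
      (hm.comp measurable_gate_mul).aemeasurable]
    simp only [lintegral_haar_mul_right hm, lintegral_const]
    rfl
  rw [← h]
  refine exists_lintegral_le ?_
  rw [h]
  refine ENNReal.mul_ne_top (ne_top_of_le_ne_top ENNReal.one_ne_top ?_) (by finiteness)
  exact (lintegral_mono E.fidelityAt_le_one).trans (by simp)

end Twist

/-! ### Replication bounds for Haar distributed and phase gates -/

section Consequences

variable {d : ℕ} [NeZero d]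

lemma one_sub_le_fidelity_haar {N : ℕ} (E : GateEstimator d N) (M : ℕ) :
    1 - ENNReal.ofReal ((d + 1) / d) * M * (1 - E.fidelity) ≤
      (E.network M).fidelity (haar (Fin d)) :=
  one_sub_le_fidelity_network E M _ (by simp) (by simp [GateEstimator.fidelity, GateEstimator.fidelityAt])

lemma exists_one_sub_le_fidelity_phaseGates {N : ℕ} (E : GateEstimator d N) (M : ℕ) :
    ∃ W : GateNetwork d N (Fin M → Fin d), W.IsDeterministic ∧
      1 - ENNReal.ofReal ((d + 1) / d) * M * (1 - E.fidelity) ≤ W.fidelity (phaseGates d) := by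
  obtain ⟨g, hg⟩ := exists_fidelity_le_lintegral_phaseGates E
  refine ⟨(E.twist g).network M, (E.twist g).isDeterministic_network M,
    one_sub_le_fidelity_network (E.twist g) M _ ?_ hg⟩
  rw [phaseGates_univ]
  simp [Real.pi_pos]

lemma GateNetwork.fidelity_le_one {N M : ℕ} (W : GateNetwork d N (Fin M → Fin d))
    (ν : Measure (Gate (Fin d))) : W.fidelity ν ≤ 1 := by
  refine ENNReal.div_le_of_le_mul ?_
  rw [one_mul]
  refine lintegral_mono fun U => lintegral_mono fun V => ENNReal.ofReal_le_ofReal ?_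
  rw [← trace_mul_proj, trace_mul_comm]
  refine trace_proj_mul_le ?_ (W.posSemidef_run _ (posSemidef_proj _))
  rw [star_mulVec_dotProduct_of_mem (gatePow_conjTranspose_mul M U)]
  exact pureState_unit V

lemma one_sub_le_of_errorScaling {β : ℝ} {E : ∀ N, GateEstimator d N}
    (h : ErrorScaling (fun N => 1 - (E N).fidelity) β) : ∃ K : ℝ, ∀ᶠ N : ℕ in atTop,
      ∀ M : ℕ, 1 - ENNReal.ofReal (K * (M / (N : ℝ) ^ β)) ≤
        1 - ENNReal.ofReal ((d + 1) / d) * M * (1 - (E N).fidelity) := by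
  obtain ⟨C, hC⟩ := h
  refine ⟨(d + 1) / d * C, hC.mono fun N hN M => tsub_le_tsub_left ?_ _⟩
  refine (mul_le_mul_right hN _).trans_eq ?_
  rw [← ENNReal.ofReal_natCast M, ← ENNReal.ofReal_mul (by positivity),
    ← ENNReal.ofReal_mul (by positivity)]
  congr 1
  ring

lemma tendsto_fidelity_of_errorScaling {r β : ℝ} (hr : 0 < r) (hβ : r < β)
    {E : ∀ N, GateEstimator d N} (h : ErrorScaling (fun N => 1 - (E N).fidelity) β)
    (ν : Measure (Gate (Fin d))) {W : ∀ N : ℕ, GateNetwork d N (Fin ⌈(N : ℝ) ^ r⌉₊ → Fin d)}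
    (hW : ∀ N : ℕ, 1 - ENNReal.ofReal ((d + 1) / d) * (⌈(N : ℝ) ^ r⌉₊ : ℕ) * (1 - (E N).fidelity) ≤
      (W N).fidelity ν) : Tendsto (fun N => (W N).fidelity ν) atTop (𝓝 1) := by
  obtain ⟨K, hK⟩ := one_sub_le_of_errorScaling h
  exact tendsto_of_tendsto_of_tendsto_of_le_of_le' (tendsto_one_sub_ofReal_ceil_rpow K hr hβ)
    tendsto_const_nhds (hK.mono fun N hN => (hN _).trans (hW N))
    (.of_forall fun N => (W N).fidelity_le_one ν)

end Consequences

/-! ### The Heisenberg limit for gates -/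

/-- The integer frequencies up to `R`. -/
def integerFreq (R : ℕ) : Set ℝ := {ν | ∃ m : ℤ, ν = m ∧ |m| ≤ R}

lemma integerFreq_add {R S : ℕ} {x y : ℝ} (hx : x ∈ integerFreq R) (hy : y ∈ integerFreq S) :
    x + y ∈ integerFreq (R + S) := by
  obtain ⟨a, rfl, ha⟩ := hx
  obtain ⟨b, rfl, hb⟩ := hy
  exact ⟨a + b, by push_cast; rfl, (abs_add_le a b).trans (by push_cast; exact add_le_add ha hb)⟩

lemma integral_exp_int_mul {m : ℤ} (hm : m ≠ 0) :
    ∫ t in (0 : ℝ)..(2 * Real.pi), Complex.exp (((m : ℝ) : ℂ) * Complex.I * (t : ℂ)) = 0 := by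
  have hc : ((m : ℝ) : ℂ) * Complex.I ≠ 0 :=
    mul_ne_zero (by exact_mod_cast hm) Complex.I_ne_zero
  rw [integral_exp_mul_complex hc]
  have e : ((m : ℝ) : ℂ) * Complex.I * ((2 * Real.pi : ℝ) : ℂ) = m * (2 * Real.pi * Complex.I) := by
    push_cast
    ring
  rw [e, Complex.exp_int_mul_two_pi_mul_I]
  simp

/-- Over a full period integer frequencies integrate to exactly zero, so no boundary term appears,
in contrast to clock states. -/
lemma integral_exp_mul_eq_zero {R : ℕ} {f : ℝ → ℂ} (hf : f ∈ trigSpan (integerFreq R)) {L : ℤ}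
    (hL : (R : ℤ) < |L|) :
    ∫ t in (0 : ℝ)..(2 * Real.pi), Complex.exp (Complex.I * ((L * t : ℝ) : ℂ)) * f t = 0 := by
  refine Submodule.span_induction (p := fun f _ => ∫ t in (0 : ℝ)..(2 * Real.pi),
    Complex.exp (Complex.I * ((L * t : ℝ) : ℂ)) * f t = 0) ?_ ?_ ?_ ?_ hf
  · rintro _ ⟨ν, ⟨m, rfl, hm⟩, rfl⟩
    have hne : L + m ≠ 0 := by
      intro h
      rw [eq_neg_of_add_eq_zero_left h, abs_neg] at hL
      exact absurd hm (not_le.mpr hL)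
    rw [← integral_exp_int_mul hne]
    refine intervalIntegral.integral_congr fun t _ => ?_
    simp only [← Complex.exp_add]
    push_cast
    ring_nf
  · simp
  · intro f g hf hg h1 h2
    have hf := continuous_of_mem_trigSpan hf
    have hg := continuous_of_mem_trigSpan hg
    simp only [Pi.add_apply, mul_add]
    rw [intervalIntegral.integral_add (by apply Continuous.intervalIntegrable; fun_prop)
      (by apply Continuous.intervalIntegrable; fun_prop), h1, h2, add_zero]
  · intro z f _ h
    simp only [Pi.smul_apply, smul_eq_mul, mul_left_comm _ z]
    rw [intervalIntegral.integral_const_mul, h, mul_zero]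

/-- A real trigonometric polynomial of degree less than `L` is orthogonal to `cos (L (t - θ))`. -/
lemma integral_cos_mul_eq_zero {R L : ℕ} (hL : R < L) {f : ℝ → ℝ}
    (hf : (fun t => (f t : ℂ)) ∈ trigSpan (integerFreq R)) (θ : ℝ) :
    ∫ t in (0 : ℝ)..(2 * Real.pi), Real.cos (L * (t - θ)) * f t = 0 := by
  have hfc := continuous_of_mem_trigSpan hf
  have h := integral_exp_mul_eq_zero hf (L := L) (by simpa using hL)
  have h' : ∫ t in (0 : ℝ)..(2 * Real.pi), (Complex.exp (-(Complex.I * ((L * θ : ℝ) : ℂ))) *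
      (Complex.exp (Complex.I * (((L : ℤ) * t : ℝ) : ℂ)) * (f t : ℂ))) = 0 := by
    rw [intervalIntegral.integral_const_mul, h, mul_zero]
  have e : ∀ t : ℝ, Real.cos (L * (t - θ)) * f t =
      Complex.reCLM (Complex.exp (-(Complex.I * ((L * θ : ℝ) : ℂ))) *
      (Complex.exp (Complex.I * (((L : ℤ) * t : ℝ) : ℂ)) * (f t : ℂ))) := by
    intro t
    rw [← mul_assoc, ← Complex.exp_add, Complex.reCLM_apply, Complex.re_mul_ofReal,
      ← Complex.exp_ofReal_mul_I_re]
    congr 3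
    push_cast
    ring
  simp only [e]
  rw [ContinuousLinearMap.intervalIntegral_comp_comm, h', map_zero]
  apply Continuous.intervalIntegrable
  fun_prop

/-! ### Bandwidth in the phase -/

section Phase

variable {d : ℕ}

lemma phaseGate_apply_mem_trigSpan (n m : Fin d) :
    (fun t => (phaseGate d t : Matrix (Fin d) (Fin d) ℂ) n m) ∈
      trigSpan {ν | ν = -((n : ℕ) : ℝ)} := by
  by_cases h : n = m
  · subst h
    convert exp_mem_trigSpan (F := {ν | ν = -((n : ℕ) : ℝ)}) rfl using 2 with t
    simp only [phaseGate, diagonal_apply_eq]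
    congr 1
    push_cast
    ring
  · simp only [phaseGate, diagonal_apply_ne _ h]
    exact (trigSpan _).zero_mem

variable {A : Type} [Fintype A] [DecidableEq A]

/-- Conjugation by the fixed `U` does not affect the frequencies; the diagonal phase gate then
multiplies an entry by a phase whose frequency is a difference of two levels, at most `d - 1` in
absolute value. -/
lemma conj_mem_trigSpan {R : ℕ} (U : Gate (Fin d)) {X : ℝ → Matrix (Fin d × A) (Fin d × A) ℂ}
    (hX : ∀ i j, (fun t => X t i j) ∈ trigSpan (integerFreq R)) (i j : Fin d × A) :
    (fun t => (((phaseGate d t * U : Gate (Fin d)) : Matrix (Fin d) (Fin d) ℂ) ⊗ₖ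
        (1 : Matrix A A ℂ) * X t *
      (((phaseGate d t * U : Gate (Fin d)) : Matrix (Fin d) (Fin d) ℂ) ⊗ₖ
        (1 : Matrix A A ℂ))ᴴ) i j) ∈ trigSpan (integerFreq (d - 1 + R)) := by
  set Y : ℝ → Matrix (Fin d × A) (Fin d × A) ℂ := fun t =>
    conjMap ((U : Matrix (Fin d) (Fin d) ℂ) ⊗ₖ (1 : Matrix A A ℂ)) (X t) with hY
  have hYm : ∀ i j, (fun t => Y t i j) ∈ trigSpan (integerFreq R) := by
    intro i j
    simp only [hY, conjMap, LinearMap.coe_mk, AddHom.coe_mk, Matrix.mul_apply, Finset.sum_mul]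
    refine sum_mem_trigSpan _ fun k _ => sum_mem_trigSpan _ fun l _ => ?_
    simp only [mul_right_comm _ _ (conjTranspose _ k j)]
    exact const_mul_mem_trigSpan _ (hX l k)
  have hd : ∀ t a b, ((phaseGate d t : Matrix (Fin d) (Fin d) ℂ) ⊗ₖ (1 : Matrix A A ℂ) * Y t *
      ((phaseGate d t : Matrix (Fin d) (Fin d) ℂ) ⊗ₖ (1 : Matrix A A ℂ))ᴴ) a b =
      (phaseGate d t : Matrix (Fin d) (Fin d) ℂ) a.1 a.1 *
        star ((phaseGate d t : Matrix (Fin d) (Fin d) ℂ) b.1 b.1) * Y t a b := by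
    intro t a b
    have e : (phaseGate d t : Matrix (Fin d) (Fin d) ℂ) ⊗ₖ (1 : Matrix A A ℂ) =
        diagonal fun x : Fin d × A => (phaseGate d t : Matrix (Fin d) (Fin d) ℂ) x.1 x.1 := by
      simp only [phaseGate, ← diagonal_one, diagonal_kronecker_diagonal, diagonal_apply_eq, mul_one]
    rw [e, diagonal_conjTranspose, mul_diagonal, diagonal_mul, Pi.star_apply]
    ring
  have hc : ∀ t, ((phaseGate d t * U : Gate (Fin d)) : Matrix (Fin d) (Fin d) ℂ) ⊗ₖ
        (1 : Matrix A A ℂ) * X t *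
      (((phaseGate d t * U : Gate (Fin d)) : Matrix (Fin d) (Fin d) ℂ) ⊗ₖ
        (1 : Matrix A A ℂ))ᴴ = (phaseGate d t : Matrix (Fin d) (Fin d) ℂ) ⊗ₖ (1 : Matrix A A ℂ) *
        Y t * ((phaseGate d t : Matrix (Fin d) (Fin d) ℂ) ⊗ₖ (1 : Matrix A A ℂ))ᴴ :=
    fun t => (conjMap_mul _ _ _).symm
  simp only [hc, hd]
  refine mul_mem_trigSpan (F := integerFreq (d - 1)) (G := integerFreq R)
    (fun x hx y hy => integerFreq_add hx hy) ?_ (hYm i j)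
  refine mul_mem_trigSpan ?_ (phaseGate_apply_mem_trigSpan i.1 i.1)
    (star_mem_trigSpan (G := {ν | ν = ((j.1 : ℕ) : ℝ)}) (by rintro _ rfl; simp)
      (phaseGate_apply_mem_trigSpan j.1 j.1))
  rintro _ rfl _ rfl
  refine ⟨(j.1 : ℕ) - (i.1 : ℕ), by push_cast; ring, ?_⟩
  have := i.1.2
  have := j.1.2
  rw [abs_le]
  omega

lemma map_mem_trigSpan {F : Set ℝ} {m n : Type} [Fintype m] [DecidableEq m]
    (Φ : Matrix m m ℂ →ₗ[ℂ] Matrix n n ℂ) {X : ℝ → Matrix m m ℂ}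
    (hX : ∀ i j, (fun t => X t i j) ∈ trigSpan F) (i j : n) :
    (fun t => Φ (X t) i j) ∈ trigSpan F := by
  have h : ∀ t, Φ (X t) i j = ∑ a, ∑ b, Φ (Matrix.single a b 1) i j * X t a b := by
    intro t
    conv_lhs => rw [matrix_eq_sum_single (X t)]
    simp only [map_sum, Matrix.sum_apply]
    refine Finset.sum_congr rfl fun a _ => Finset.sum_congr rfl fun b _ => ?_
    rw [← mul_one (X t a b), ← smul_eq_mul, ← smul_single, map_smul]
    simp [mul_comm]
  simp only [h]
  exact sum_mem_trigSpan _ fun a _ => sum_mem_trigSpan _ fun b _ =>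
    const_mul_mem_trigSpan _ (hX a b)

lemma runUses_mem_trigSpan (U : Gate (Fin d)) (step : ℕ → QOp (Fin d × A) (Fin d × A))
    (ρ : Matrix (Fin d × A) (Fin d × A) ℂ) (k : ℕ) (i j : Fin d × A) :
    (fun t => runUses ((phaseGate d t * U : Gate (Fin d)) : Matrix (Fin d) (Fin d) ℂ) step k ρ i j)
      ∈ trigSpan (integerFreq (k * (d - 1))) := by
  induction k generalizing i j with
  | zero => exact const_mem_trigSpan (F := integerFreq (0 * (d - 1))) ⟨0, by simp⟩ _
  | succ k ih =>
    rw [Nat.succ_mul, Nat.add_comm]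
    exact map_mem_trigSpan (step k).map (conj_mem_trigSpan U ih) i j

/-- The infidelity of an estimate of a phase gate, up to another gate, detects the phase. -/
lemma exists_one_sub_cos_le [NeZero d] (hd : 2 ≤ d) (V U : Gate (Fin d)) : ∃ θ : ℝ, ∀ t : ℝ,
    1 - Real.cos (t - θ) ≤ (d : ℝ) ^ 2 * (1 - entanglementFidelity V (phaseGate d t * U)) := by
  have hd0 : (0 : ℝ) < d := by exact_mod_cast NeZero.pos d
  set W : Matrix (Fin d) (Fin d) ℂ := ((V * U⁻¹ : Gate (Fin d)) : Matrix (Fin d) (Fin d) ℂ) with hW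
  have hW1 : ∀ i, ‖W i i‖ ≤ 1 := fun i => entry_norm_bound_of_unitary (V * U⁻¹).2 i i
  obtain ⟨n, rfl⟩ : ∃ n, d = n + 2 := ⟨d - 2, by omega⟩
  set a := W 0 0 with ha
  set b := W 1 1 with hb
  set z := star a * b with hz
  -- The phase is read off from the first two diagonal entries of `V * U⁻¹`: their sum, the second
  -- turned by `exp (i t)`, is longest when `t` compensates their relative phase `z.arg`.
  refine ⟨-z.arg, fun t => ?_⟩
  have htr : (((phaseGate (n + 2) t * U : Gate (Fin (n + 2))) :
      Matrix (Fin (n + 2)) (Fin (n + 2)) ℂ)ᴴ *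
      (V : Matrix (Fin (n + 2)) (Fin (n + 2)) ℂ)).trace =
      ∑ i : Fin (n + 2), Complex.exp (((i : ℕ) * t : ℝ) * Complex.I) * W i i := by
    rw [Submonoid.coe_mul, conjTranspose_mul, Matrix.mul_assoc, trace_mul_comm, Matrix.mul_assoc]
    have : (V : Matrix (Fin (n + 2)) (Fin (n + 2)) ℂ) *
        (U : Matrix (Fin (n + 2)) (Fin (n + 2)) ℂ)ᴴ = W := rfl
    rw [this, phaseGate, diagonal_conjTranspose, Matrix.trace]
    refine Finset.sum_congr rfl fun i _ => ?_
    rw [diag_apply, diagonal_mul, Pi.star_apply, ← starRingEnd_apply, ← Complex.exp_conj]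
    congr 2
    simp
    ring
  set x := ‖a + Complex.exp ((t : ℝ) * Complex.I) * b‖ with hx
  have he : ∀ s : ℝ, ‖Complex.exp ((s : ℂ) * Complex.I)‖ = 1 := Complex.norm_exp_ofReal_mul_I
  -- The other `d - 2` diagonal entries contribute at most one each.
  have hle : ‖∑ i : Fin (n + 2), Complex.exp (((i : ℕ) * t : ℝ) * Complex.I) * W i i‖ ≤ x + n := by
    rw [Fin.sum_univ_succ, Fin.sum_univ_succ, ← add_assoc]
    refine (norm_add_le _ _).trans (add_le_add (le_of_eq ?_) ?_)
    · simp [hx, ha, hb]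
    · refine (norm_sum_le _ _).trans ((Finset.sum_le_sum (g := fun _ => (1 : ℝ)) fun i _ => ?_).trans
        (by simp))
      rw [norm_mul, he, one_mul]
      exact hW1 _
  have hx0 : 0 ≤ x := norm_nonneg _
  have hx2 : x ≤ 2 := by
    refine (norm_add_le _ _).trans ?_
    rw [norm_mul, he, one_mul]
    linarith [hW1 0, hW1 1]
  have hcos : Complex.re (z * Complex.exp ((t : ℝ) * Complex.I)) =
      ‖z‖ * Real.cos (t - -z.arg) := by
    conv_lhs => rw [← Complex.norm_mul_exp_arg_mul_I z]
    rw [mul_assoc, ← Complex.exp_add, Complex.re_ofReal_mul, ← Complex.exp_ofReal_mul_I_re]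
    congr 3
    push_cast
    ring
  have hxs : x ^ 2 = ‖a‖ ^ 2 + ‖b‖ ^ 2 + 2 * (‖z‖ * Real.cos (t - -z.arg)) := by
    rw [hx, ← hcos, ← Complex.normSq_eq_norm_sq, Complex.normSq_add, Complex.normSq_eq_norm_sq,
      Complex.normSq_eq_norm_sq, norm_mul, he, one_mul]
    congr 2
    rw [← Complex.conj_re]
    congr 1
    simp [hz]
    ring
  have hz1 : ‖z‖ ≤ 1 := by
    rw [hz, norm_mul, norm_star]
    exact mul_le_one₀ (hW1 0) (norm_nonneg _) (hW1 1)
  have hz0 : 0 ≤ ‖z‖ := norm_nonneg _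
  have ha1 : ‖a‖ ^ 2 ≤ 1 := pow_le_one₀ (norm_nonneg _) (hW1 0)
  have hb1 : ‖b‖ ^ 2 ≤ 1 := pow_le_one₀ (norm_nonneg _) (hW1 1)
  set C := Real.cos (t - -z.arg)
  have hC1 : C ≤ 1 := Real.cos_le_one _
  have hC0 : -1 ≤ C := Real.neg_one_le_cos _
  -- For `C ≥ 0` use `x ^ 2 ≤ 2 + 2 C`, for `C ≤ 0` use `x ^ 2 ≤ 2`. It remains that `(n + 2)² - (x
  -- + n)²` is at least `4 - x²` because `x ≤ 2`.
  have h4 : 1 - C ≤ 4 - x ^ 2 := by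
    rcases le_total 0 C with h | h
    · nlinarith
    · nlinarith
  refine h4.trans ?_
  rw [entanglementFidelity, htr, mul_sub, mul_one, mul_div_cancel₀ _ (by positivity)]
  have hsq := pow_le_pow_left₀ (norm_nonneg _) hle 2
  rw [Nat.cast_add, Nat.cast_ofNat]
  nlinarith [mul_nonneg (Nat.cast_nonneg n : (0 : ℝ) ≤ n) (sub_nonneg.mpr hx2)]

end Phase

/-! ### The Heisenberg lower bound for gate estimation -/

namespace GateEstimator

variable {d N : ℕ} [NeZero d] (E : GateEstimator d N)

/-- For a fixed outcome `V` the density along the orbit is a nonnegative trigonometric polynomial of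
degree less than `L`, hence orthogonal to `cos (L (t - θ))`. The weighted mean of `1 - cos (L (t -
θ))` is one, and this quantity is at most `L ^ 2 d ^ 2` times the entanglement infidelity. The angle
`θ` may depend on the outcome. -/
lemma integral_density_le {L : ℕ} (hL : N * (d - 1) < L) (hd : 2 ≤ d) (U V : Gate (Fin d)) :
    ENNReal.ofReal (1 / ((d : ℝ) ^ 2 * (L : ℝ) ^ 2)) *
      ∫⁻ t in Set.Ico (0 : ℝ) (2 * Real.pi), E.povm.density (E.final (phaseGate d t * U)) V ≤
    ∫⁻ t in Set.Ico (0 : ℝ) (2 * Real.pi), E.povm.density (E.final (phaseGate d t * U)) V *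
      ENNReal.ofReal (1 - entanglementFidelity V (phaseGate d t * U)) := by
  obtain ⟨θ, hθ⟩ := exists_one_sub_cos_le hd V U
  have hd0 : (0 : ℝ) < d := by exact_mod_cast NeZero.pos d
  have hL0 : (0 : ℝ) < L := by exact_mod_cast (Nat.zero_le _).trans_lt hL
  set g : ℝ → ℝ := fun t => (E.povm.P V * E.final (phaseGate d t * U)).trace.re with hg
  have hg0 : ∀ t, 0 ≤ g t := fun t => (Complex.nonneg_iff.mp
    (trace_mul_nonneg (E.povm.posSemidef_P V) (E.posSemidef_final _))).1
  have hgm : (fun t => (g t : ℂ)) ∈ trigSpan (integerFreq (N * (d - 1))) := by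
    have e : ∀ t, (g t : ℂ) = (E.povm.P V * E.final (phaseGate d t * U)).trace := fun t =>
      (trace_mul_eq_ofReal (E.povm.posSemidef_P V) (E.posSemidef_final _)).symm
    simp only [e, trace_mul_eq_sum]
    exact sum_mem_trigSpan _ fun i _ => sum_mem_trigSpan _ fun j _ =>
      const_mul_mem_trigSpan _ (runUses_mem_trigSpan U E.step E.init N j i)
  have hgc : Continuous g := by
    have h := Complex.continuous_re.comp (continuous_of_mem_trigSpan hgm)
    exact h
  set κ : ℝ := 1 / ((d : ℝ) ^ 2 * (L : ℝ) ^ 2) with hκ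
  have hκ0 : 0 ≤ κ := by positivity
  have hpi : (0 : ℝ) ≤ 2 * Real.pi := by positivity
  have hint : ∀ {f : ℝ → ℝ}, Continuous f → (∀ t, 0 ≤ f t) →
      ∫⁻ t in Set.Ico (0 : ℝ) (2 * Real.pi), ENNReal.ofReal (f t) =
        ENNReal.ofReal (∫ t in (0 : ℝ)..(2 * Real.pi), f t) := by
    intro f hf hf0
    rw [intervalIntegral.integral_of_le hpi, ← integral_Ico_eq_integral_Ioc,
      ofReal_integral_eq_lintegral_ofReal
        (hf.continuousOn.integrableOn_Icc.mono_set Set.Ico_subset_Icc_self) (.of_forall hf0)]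
  have h1 : ∫ t in (0 : ℝ)..(2 * Real.pi), κ * ((1 - Real.cos (L * (t - θ))) * g t) =
      κ * ∫ t in (0 : ℝ)..(2 * Real.pi), g t := by
    rw [intervalIntegral.integral_const_mul]
    simp only [sub_mul, one_mul]
    rw [intervalIntegral.integral_sub (hgc.intervalIntegrable _ _)
      (by apply Continuous.intervalIntegrable; fun_prop), integral_cos_mul_eq_zero hL hgm, sub_zero]
  have hc0 : ∀ t, 0 ≤ κ * ((1 - Real.cos (L * (t - θ))) * g t) := fun t =>
    mul_nonneg hκ0 (mul_nonneg (sub_nonneg.mpr (Real.cos_le_one _)) (hg0 t))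
  have hden : ∀ t, E.povm.density (E.final (phaseGate d t * U)) V = ENNReal.ofReal (g t) :=
    fun _ => rfl
  simp only [hden]
  rw [hint hgc hg0, ← ENNReal.ofReal_mul hκ0, ← h1, ← hint (by fun_prop) hc0]
  refine lintegral_mono fun t => ?_
  rw [← ENNReal.ofReal_mul (hg0 t)]
  refine ENNReal.ofReal_le_ofReal ?_
  rw [mul_comm (g t), ← mul_assoc]
  refine mul_le_mul_of_nonneg_right ?_ (hg0 t)
  rw [hκ, one_div_mul_eq_div, div_le_iff₀ (by positivity)]
  calc 1 - Real.cos (L * (t - θ)) ≤ (L : ℝ) ^ 2 * (1 - Real.cos (t - θ)) :=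
        one_sub_cos_natCast_mul_le L _
    _ ≤ (L : ℝ) ^ 2 * ((d : ℝ) ^ 2 * (1 - entanglementFidelity V (phaseGate d t * U))) :=
        mul_le_mul_of_nonneg_left (hθ t) (by positivity)
    _ = _ := by ring

lemma lintegral_one_sub_entanglementFidelity (U : Gate (Fin d)) :
    ∫⁻ V, ENNReal.ofReal (1 - entanglementFidelity V U) ∂E.law U =
      ENNReal.ofReal ((d + 1) / d) * (1 - E.fidelityAt U) := by
  simp only [one_sub_gateFidelity]
  rw [lintegral_const_mul' _ _ ENNReal.ofReal_ne_top, E.lintegral_one_sub_gateFidelity]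

lemma le_lintegral_one_sub_fidelityAt {L : ℕ} (hL : N * (d - 1) < L) (hd : 2 ≤ d)
    (U : Gate (Fin d)) : ENNReal.ofReal (1 / ((d : ℝ) ^ 2 * (L : ℝ) ^ 2)) *
      ENNReal.ofReal (2 * Real.pi) ≤ ENNReal.ofReal ((d + 1) / d) *
        ∫⁻ t in Set.Ico (0 : ℝ) (2 * Real.pi), (1 - E.fidelityAt (phaseGate d t * U)) := by
  have := E.povm.finite_base
  have hp : Continuous fun t => phaseGate d t * U := (continuous_phaseGate d).mul continuous_const
  have hfm : ∀ i j, Measurable fun t => E.final (phaseGate d t * U) i j := fun i j =>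
    (E.measurable_final i j).comp hp.measurable
  have hm : Measurable fun p : ℝ × Gate (Fin d) =>
      ENNReal.ofReal (1 - entanglementFidelity p.2 (phaseGate d p.1 * U)) :=
    (continuous_const.sub (continuous_entanglementFidelity continuous_snd
      (hp.comp continuous_fst))).measurable.ennreal_ofReal
  have hden := E.povm.measurable_density_prod hfm
  have hmt : ∀ t, Measurable fun V : Gate (Fin d) =>
      ENNReal.ofReal (1 - entanglementFidelity V (phaseGate d t * U)) := fun t =>
    (continuous_const.sub
      (continuous_entanglementFidelity continuous_id continuous_const)).measurable.ennreal_ofReal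
  have hlaw : ∫⁻ V, (∫⁻ t in Set.Ico (0 : ℝ) (2 * Real.pi),
      E.povm.density (E.final (phaseGate d t * U)) V) ∂E.povm.base =
        ENNReal.ofReal (2 * Real.pi) := by
    rw [lintegral_lintegral_swap
      (f := fun V t => E.povm.density (E.final (phaseGate d t * U)) V)
      (hden.comp measurable_swap).aemeasurable]
    have h1 : ∀ t, ∫⁻ V, E.povm.density (E.final (phaseGate d t * U)) V ∂E.povm.base = 1 := by
      intro t
      have := Povm.lintegral_law E.povm (E.final (phaseGate d t * U)) (f := fun _ => 1)
        measurable_const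
      simp only [mul_one] at this
      rw [← this]
      exact lintegral_one.trans (E.law_univ _)
    simp [h1]
  rw [← lintegral_const_mul' _ _ ENNReal.ofReal_ne_top]
  simp only [← E.lintegral_one_sub_entanglementFidelity]
  have hr : ∀ t, ∫⁻ V, ENNReal.ofReal (1 - entanglementFidelity V (phaseGate d t * U))
      ∂E.law (phaseGate d t * U) = ∫⁻ V, E.povm.density (E.final (phaseGate d t * U)) V *
        ENNReal.ofReal (1 - entanglementFidelity V (phaseGate d t * U)) ∂E.povm.base := fun t =>
    Povm.lintegral_law E.povm (E.final (phaseGate d t * U)) (hmt t)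
  simp only [hr]
  rw [lintegral_lintegral_swap (hden.mul hm).aemeasurable, ← hlaw,
    ← lintegral_const_mul' _ _ ENNReal.ofReal_ne_top]
  exact lintegral_mono fun V => E.integral_density_le hL hd U V

/-- The Heisenberg limit for the mean fidelity of gate estimation. -/
lemma le_one_sub_fidelity (hN : 0 < N) (hd : 2 ≤ d) :
    ENNReal.ofReal (1 / (2 * (d : ℝ) ^ 4) / (N : ℝ) ^ 2) ≤ 1 - E.fidelity := by
  have hd0 : (0 : ℝ) < d := by exact_mod_cast NeZero.pos d
  have hN0 : (0 : ℝ) < N := by exact_mod_cast hN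
  -- The choice `L = N * d` lies beyond the degree `N (d - 1)` and makes `d² L²` equal to `d⁴ N²`.
  have hL : N * (d - 1) < N * d := Nat.mul_lt_mul_of_pos_left (by omega) hN
  have hm : Measurable fun U => 1 - E.fidelityAt U := measurable_const.sub E.measurable_fidelityAt
  have hU := lintegral_mono (μ := haar (Fin d)) fun U => E.le_lintegral_one_sub_fidelityAt hL hd U
  -- By left invariance every `phaseGate d t * U` is Haar distributed, so the average over orbits is
  -- the Haar average.
  have hs : ∫⁻ U, (∫⁻ t in Set.Ico (0 : ℝ) (2 * Real.pi), (1 - E.fidelityAt (phaseGate d t * U)))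
      ∂haar (Fin d) = (1 - E.fidelity) * ENNReal.ofReal (2 * Real.pi) := by
    rw [lintegral_lintegral_swap (f := fun U t => 1 - E.fidelityAt (phaseGate d t * U))
      (hm.comp (measurable_gate_mul.comp (((continuous_phaseGate d).measurable.comp
        measurable_snd).prodMk measurable_fst))).aemeasurable]
    simp only [lintegral_mul_left_eq_self (fun U => 1 - E.fidelityAt U)]
    rw [lintegral_sub E.measurable_fidelityAt
      (ne_top_of_le_ne_top ENNReal.one_ne_top
        ((lintegral_mono E.fidelityAt_le_one).trans (by simp))) (.of_forall E.fidelityAt_le_one)]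
    simp [fidelity, fidelityAt]
  rw [lintegral_const, measure_univ, mul_one, lintegral_const_mul' _ _ ENNReal.ofReal_ne_top, hs,
    ← mul_assoc] at hU
  have hpi : ENNReal.ofReal (2 * Real.pi) ≠ 0 := by simp [Real.pi_pos]
  rw [ENNReal.mul_le_mul_iff_left hpi ENNReal.ofReal_ne_top] at hU
  -- This crude bound is the source of the factor `2` in `1 / (2 d⁴)`.
  have h2 : ENNReal.ofReal ((d + 1) / d) ≤ 2 := by
    rw [← ENNReal.ofReal_ofNat]
    refine ENNReal.ofReal_le_ofReal ?_
    rw [div_le_iff₀ hd0]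
    have : (2 : ℝ) ≤ d := by exact_mod_cast hd
    linarith
  have h3 := (hU.trans (mul_le_mul_left h2 _)).trans_eq (mul_comm _ _)
  rw [← ENNReal.div_le_iff_le_mul (by simp) (by simp)] at h3
  refine le_of_eq_of_le ?_ h3
  rw [← ENNReal.ofReal_ofNat, ← ENNReal.ofReal_div_of_pos two_pos]
  congr 1
  push_cast
  field_simp

lemma not_errorScaling (hd : 2 ≤ d) {ε : ℝ} (hε : 0 < ε) (E : ∀ N, GateEstimator d N) :
    ¬ ErrorScaling (fun N => 1 - (E N).fidelity) (2 + ε) := by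
  rintro ⟨C, hC⟩
  have hd0 : (0 : ℝ) < d := by exact_mod_cast NeZero.pos d
  refine not_eventually_div_rpow_le (κ := 1 / (2 * (d : ℝ) ^ 4)) (K := C) (α := 2) (β := 2 + ε)
    (by positivity) (by linarith) ?_
  filter_upwards [hC, eventually_gt_atTop 0] with N h1 h2
  have h := ((E N).le_one_sub_fidelity h2 hd).trans h1
  have hN0 : (0 : ℝ) < N := by exact_mod_cast h2
  rw [ENNReal.ofReal_le_ofReal_iff'] at h
  rcases h with h | h
  · exact_mod_cast h
  · exact absurd h (not_le.mpr (by positivity))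

end GateEstimator

end Replication

end

open Replication in
theorem mainTheorem5 :
    -- Clock states
    (∀ (d : ℕ) (c : ClockFamily d),
      -- The measure-and-prepare cloner built on an estimator, for every number `M` of clones
      -- and every prior
      (∀ (N M : ℕ) (E : Estimator d N), ∃ C : Cloner d N M,
        (∀ ρ : Matrix (Fin N → Fin d) (Fin N → Fin d) ℂ, ρ.PosSemidef → ∀ i j,
          C.map ρ i j = ∫ s, c.copies M s i j ∂E.law ρ) ∧
        (E.IsComplete → C.IsChannel) ∧
        ∀ π : Measure ℝ, IsProbabilityMeasure π → E.success c π ≠ 0 →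
          (1 - E.error c .infidelity π) ^ M ≤ C.fidelity c π) ∧
      -- A squared error is an infidelity up to a constant
      (∀ s t : ℝ, Loss.infidelity.cost c s t ≤
        ENNReal.ofReal c.energyVariance * Loss.squaredDistance.cost c s t) ∧
      (∀ (a : Aggregate) (ℓ : Loss),
        -- Estimation error `O(1/N^β)` gives `M(N)` clones with error `O(M(N)/N^β)`
        (∀ (β : ℝ), 0 < β → ∀ E : ∀ N, Estimator d N,
          ErrorScaling (fun N => a.ofError ((E N).error c ℓ)) β →
          ∀ M : ℕ → ℕ, ∃ C : ∀ N, Cloner d N (M N),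
            (∀ N, (E N).IsComplete → (C N).IsChannel) ∧
            ∃ K : ℝ, ∀ᶠ N : ℕ in atTop,
              1 - ENNReal.ofReal (K * (M N / (N : ℝ) ^ β)) ≤ a.ofFidelity ((C N).fidelity c)) ∧
        ∀ ε : ℝ, 0 < ε →
          -- Beating the standard quantum limit violates the strong converse of no-cloning
          ((∃ E : ∀ N, Estimator d N, (∀ N, (E N).IsComplete) ∧
              ErrorScaling (fun N => a.ofError ((E N).error c ℓ)) (1 + ε)) →
            (∃ (M : ℕ → ℕ) (C : ∀ N, Cloner d N (M N)),
              (fun N : ℕ => (M N : ℝ)) =Θ[atTop] (fun N : ℕ => (N : ℝ) ^ (1 + ε / 2)) ∧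
              replicationRate M = ((1 + ε / 2 : ℝ) : EReal) ∧
              (∀ N, (C N).IsChannel) ∧
              Tendsto (fun N => a.ofFidelity ((C N).fidelity c)) atTop (𝓝 1)) ∧
            ¬ StrongConverseNoCloning c a) ∧
          -- Beating the Heisenberg limit violates the strong converse for superreplication
          ((∃ E : ∀ N, Estimator d N,
              ErrorScaling (fun N => a.ofError ((E N).error c ℓ)) (2 + ε)) →
            (∃ (M : ℕ → ℕ) (C : ∀ N, Cloner d N (M N)),
              (fun N : ℕ => (M N : ℝ)) =Θ[atTop] (fun N : ℕ => (N : ℝ) ^ (2 + ε / 2)) ∧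
              replicationRate M = ((2 + ε / 2 : ℝ) : EReal) ∧
              Tendsto (fun N => a.ofFidelity ((C N).fidelity c)) atTop (𝓝 1)) ∧
            ¬ StrongConverseHeisenberg c a) ∧
          -- The standard quantum limit
          (¬ ∃ E : ∀ N, Estimator d N, (∀ N, (E N).IsComplete) ∧
              ErrorScaling (fun N => a.ofError ((E N).error c ℓ)) (1 + ε)) ∧
          -- The Heisenberg limit of probabilistic metrology
          (¬ ∃ E : ∀ N, Estimator d N,
              ErrorScaling (fun N => a.ofError ((E N).error c ℓ)) (2 + ε)))) ∧
    -- Unitary gates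
    (∀ (d : ℕ) [NeZero d], 2 ≤ d →
      -- The measure-and-prepare network built on a gate estimator
      (∀ (N M : ℕ) (E : GateEstimator d N),
        (∃ W : GateNetwork d N (Fin M → Fin d), W.IsDeterministic ∧
          (∀ (U : Gate (Fin d)) (ρ : Matrix (Fin M → Fin d) (Fin M → Fin d) ℂ) i j,
            W.run U ρ i j = ∫ V : Gate (Fin d),
              (gatePow M (V : Matrix (Fin d) (Fin d) ℂ) * ρ *
                (gatePow M (V : Matrix (Fin d) (Fin d) ℂ))ᴴ) i j ∂E.law U) ∧
          1 - ENNReal.ofReal ((d + 1) / d) * M * (1 - E.fidelity) ≤ W.fidelity (haar (Fin d))) ∧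
        ∃ W : GateNetwork d N (Fin M → Fin d), W.IsDeterministic ∧
          1 - ENNReal.ofReal ((d + 1) / d) * M * (1 - E.fidelity) ≤ W.fidelity (phaseGates d)) ∧
      -- Estimation fidelity `1 - O(1/N^β)` gives replication fidelity `1 - O(M(N)/N^β)`
      (∀ (β : ℝ), 0 < β → ∀ E : ∀ N, GateEstimator d N,
        ErrorScaling (fun N => 1 - (E N).fidelity) β →
        ∀ M : ℕ → ℕ, ∃ W : ∀ N, GateNetwork d N (Fin (M N) → Fin d),
          (∀ N, (W N).IsDeterministic) ∧
          ∃ K : ℝ, ∀ᶠ N : ℕ in atTop,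
            1 - ENNReal.ofReal (K * (M N / (N : ℝ) ^ β)) ≤ (W N).fidelity (haar (Fin d))) ∧
      ∀ ε : ℝ, 0 < ε →
        -- Beating the Heisenberg limit violates the strong converse for gate replication
        ((∃ E : ∀ N, GateEstimator d N, ErrorScaling (fun N => 1 - (E N).fidelity) (2 + ε)) →
          (∃ M : ℕ → ℕ,
            (fun N : ℕ => (M N : ℝ)) =Θ[atTop] (fun N : ℕ => (N : ℝ) ^ (2 + ε / 2)) ∧
            replicationRate M = ((2 + ε / 2 : ℝ) : EReal) ∧
            ∀ ν : Measure (Gate (Fin d)), ν = haar (Fin d) ∨ ν = phaseGates d →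
              ∃ W : ∀ N, GateNetwork d N (Fin (M N) → Fin d), (∀ N, (W N).IsDeterministic) ∧
                Tendsto (fun N => (W N).fidelity ν) atTop (𝓝 1)) ∧
          ¬ StrongConverseGates d) ∧
        -- The Heisenberg limit of gate estimation
        ¬ ∃ E : ∀ N, GateEstimator d N, ErrorScaling (fun N => 1 - (E N).fidelity) (2 + ε)) := by
  refine ⟨fun d c => ⟨fun N M E => ⟨E.measurePrepare c M,
    fun ρ hρ i j => E.measurePrepare_apply c M hρ i j, Estimator.isChannel_measurePrepare c M,
    fun π _ h => E.one_sub_error_pow_le c M π h⟩, c.cost_infidelity_le, fun a ℓ =>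
      ⟨fun β _ E hE M => ⟨fun N => (E N).measurePrepare c (M N),
        fun N h => Estimator.isChannel_measurePrepare c (M N) h,
        Estimator.exists_measurePrepare_fidelity c hE M⟩, fun ε hε => ⟨?_, ?_, ?_, ?_⟩⟩⟩,
    fun d _ hd => ⟨fun N M E => ⟨⟨E.network M, E.isDeterministic_network M, E.run_network M,
      one_sub_le_fidelity_haar E M⟩, exists_one_sub_le_fidelity_phaseGates E M⟩,
      fun β _ E hE M => ?_, fun ε hε => ⟨?_, ?_⟩⟩⟩
  · rintro ⟨E, hc, hE⟩
    have ht := Estimator.tendsto_fidelity_measurePrepare c (r := 1 + ε / 2) (by linarith)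
      (by linarith) hE
    have hr := replicationRate_ceil_rpow (r := 1 + ε / 2) (by linarith)
    have hch := fun N : ℕ => Estimator.isChannel_measurePrepare c ⌈(N : ℝ) ^ (1 + ε / 2)⌉₊ (hc N)
    refine ⟨⟨_, _, isTheta_ceil_rpow (by linarith), hr, hch, ht⟩, fun hs => ?_⟩
    -- The process has rate above the threshold, so the strong converse would make the same
    -- fidelities tend to `0` as well as to `1`.
    refine one_ne_zero (tendsto_nhds_unique ht (hs _ _ hch ?_))
    rw [hr]
    exact_mod_cast (by linarith : (1 : ℝ) < 1 + ε / 2)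
  · rintro ⟨E, hE⟩
    have ht := Estimator.tendsto_fidelity_measurePrepare c (r := 2 + ε / 2) (by linarith)
      (by linarith) hE
    have hr := replicationRate_ceil_rpow (r := 2 + ε / 2) (by linarith)
    refine ⟨⟨_, _, isTheta_ceil_rpow (by linarith), hr, ht⟩, fun hs => ?_⟩
    refine one_ne_zero (tendsto_nhds_unique ht (hs _ _ ?_))
    rw [hr]
    exact EReal.coe_lt_coe_iff.mpr (by linarith : (2 : ℝ) < 2 + ε / 2)
  · rintro ⟨E, hc, hE⟩
    exact Estimator.not_errorScaling_of_isComplete c hε hc hE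
  · rintro ⟨E, hE⟩
    exact Estimator.not_errorScaling c hε E hE
  · obtain ⟨K, hK⟩ := one_sub_le_of_errorScaling hE
    exact ⟨fun N => (E N).network (M N), fun N => (E N).isDeterministic_network (M N), K,
      hK.mono fun N hN => (hN (M N)).trans (one_sub_le_fidelity_haar (E N) (M N))⟩
  · rintro ⟨E, hE⟩
    have hr := replicationRate_ceil_rpow (r := 2 + ε / 2) (by linarith)
    -- For phase gates the network depends on the twist, which is chosen separately for each `N`.
    choose W hW hWf using fun N : ℕ =>
      exists_one_sub_le_fidelity_phaseGates (E N) ⌈(N : ℝ) ^ (2 + ε / 2)⌉₊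
    have ht := tendsto_fidelity_of_errorScaling (by linarith) (by linarith) hE _ hWf
    refine ⟨⟨_, isTheta_ceil_rpow (by linarith), hr, ?_⟩, fun hs => ?_⟩
    · rintro ν (rfl | rfl)
      · exact ⟨fun N => (E N).network _, fun N => (E N).isDeterministic_network _,
          tendsto_fidelity_of_errorScaling (by linarith) (by linarith) hE _
            fun N => one_sub_le_fidelity_haar (E N) _⟩
      · exact ⟨W, hW, ht⟩
    · refine one_ne_zero (tendsto_nhds_unique ht (hs _ W ?_))
      rw [hr]
      exact EReal.coe_lt_coe_iff.mpr (by linarith : (2 : ℝ) < 2 + ε / 2)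
  · rintro ⟨E, hE⟩
    exact GateEstimator.not_errorScaling hd hε E hE
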